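/- Let $A,B\subset\{0,1,2,\dots\}$ be finite sets with $\min A=\min B=0$ and $|A|,|B|\ge 2$, and put $L=|A||B|$. Let $A_1=A$, $A_{N+1}=A_N+L^{-N}A$ (so $A_N=\sum_{k=0}^{N-1}L^{-k}A$), similarly $B_N$, and $$S_N=A_N\times B_N+\{z\in\mathbb C:|z|<L^{-N}\},$$ where $A_N\times B_N$ is identified with $\{x+iy: x\in A_N,\ y\in B_N\}\subset\mathbb C$. The Favard length of $S\subset\mathbb C$ is $Fav(S)=\frac1\pi\int_0^\pi|proj_\theta(S)|\,d\theta$, where $proj_\theta(re^{i\theta'})=r\cos(\theta'-\theta)$ and $|\cdot|$ is Lebesgue measure on $\mathbb R$. Let $A(x)=\sum_{a\in A}x^a$ and let $\Phi_s$ be the $s$-th cyclotomic polynomial. Set $s_A=\mathrm{lcm}\{s\ge1:\ \Phi_s(x)\mid A(x),\ (s,L)=1\}$ (equal to $1$ if there is no such $s$). Say that $A$ satisfies condition (D) if either $s_A=1$, or $s_A=s_1s_2$ for some integers $s_1,s_2>1$ such that $s_2<|A|$ and $\Phi_q(x)\nmid A(x)$ for every $q\mid s_1$. Define $B(x)$,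 $s_B$ and condition (D) for $B$ in the same way, with the same $L$. **Theorem 1.4.** Assume that either $|A|,|B|\le 6$, or both $A$ and $B$ satisfy (D). Assume also that every complex root of $A(x)$ and of $B(x)$ on the unit circle is a root of unity. Then there are constants $p>0$ and $C>0$ (depending on $A$ and $B$) such that $$Fav(S_N)\le C\,N^{-p}\qquad\text{for all integers } N\ge1.$$ -/

import Mathlib

namespace BuffonNeedle

open MeasureTheory Polynomial

/-- Orthogonal projection of `z = r e^{iθ'}` onto the line through the origin forming the angle `θ`
with the positive real axis, as a real coordinate on that line: `r cos (θ' - θ)`. -/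
noncomputable def proj (θ : ℝ) (z : ℂ) : ℝ := z.re * Real.cos θ + z.im * Real.sin θ

/-- Favard length: `(1/π) ∫₀^π |proj_θ(S)| dθ`, with values in `[0, ∞]`. -/
noncomputable def favard (S : Set ℂ) : ENNReal :=
  ENNReal.ofReal (1 / Real.pi) *
    ∫⁻ θ in Set.Icc (0 : ℝ) Real.pi, volume (proj θ '' S)

/-- The iterates `A_N = A + L⁻¹ A + ⋯ + L^{-(N-1)} A`: here `A_0 = {0}`,
`A_{N+1} = A_N + L^{-N} A`, and so `A_1 = A`. -/
def iter (L : ℕ) (A : Finset ℕ) : ℕ → Set ℝ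
  | 0 => {0}
  | N + 1 => {x | ∃ y ∈ iter L A N, ∃ a ∈ A, x = y + (a : ℝ) / (L : ℝ) ^ N}

/-- `S_N = A_N × B_N + {z : |z| < L^{-N}}`, where `L = |A| |B|` and `A_N × B_N` is the set
of `x + iy` with `x ∈ A_N`, `y ∈ B_N`. -/
def cantorNbhd (A B : Finset ℕ) (N : ℕ) : Set ℂ :=
  {z | ∃ x ∈ iter (A.card * B.card) A N, ∃ y ∈ iter (A.card * B.card) B N,
    ‖z - (x + y * Complex.I)‖ < 1 / ((A.card * B.card : ℕ) : ℝ) ^ N}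

/-- The generating function `A(x) = ∑_{a ∈ A} x^a`. -/
noncomputable def genPoly (A : Finset ℕ) : ℤ[X] := ∑ a ∈ A, X ^ a

/-- The `s ≥ 1` with `Φ_s(x) ∣ A(x)` and `(s, L) = 1`. -/
def badOrders (L : ℕ) (A : Finset ℕ) : Set ℕ :=
  {s | 0 < s ∧ cyclotomic s ℤ ∣ genPoly A ∧ Nat.Coprime s L}

/-- `s_A = lcm {s : Φ_s ∣ A, (s, L) = 1}`, the least positive common multiple (`1` if there is no
such `s`). -/
noncomputable def badLcm (L : ℕ) (A : Finset ℕ) : ℕ :=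
  sInf {M | 0 < M ∧ ∀ s ∈ badOrders L A, s ∣ M}

/-- For nonempty `A` there are only finitely many such `s`, so that `badLcm` is the lcm. -/
theorem badOrders_finite (L : ℕ) (A : Finset ℕ) (hA : A.Nonempty) : (badOrders L A).Finite := by
  have hne : genPoly A ≠ 0 := by
    intro h
    have h1 : (genPoly A).eval 1 = A.card := by simp [genPoly, eval_finsetSum]
    rw [h] at h1
    have := hA.card_pos
    simp at h1
    omega
  refine Set.Finite.subset (((genPoly A).aroots ℂ).toFinset.image orderOf).finite_toSet ?_
  rintro s ⟨hs, hd, -⟩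
  have hp := Complex.isPrimitiveRoot_exp s hs.ne'
  simp only [Finset.coe_image, Set.mem_image, Finset.mem_coe, Multiset.mem_toFinset]
  refine ⟨_, ?_, hp.eq_orderOf.symm⟩
  rw [mem_aroots]
  refine ⟨hne, ?_⟩
  obtain ⟨g, hg⟩ := hd
  have : aeval (Complex.exp (2 * Real.pi * Complex.I / s)) (cyclotomic s ℤ) = 0 := by
    haveI : NeZero (s : ℂ) := ⟨by exact_mod_cast hs.ne'⟩
    rw [aeval_def, eval₂_eq_eval_map, map_cyclotomic]
    exact isRoot_cyclotomic_iff.2 hp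
  rw [hg, map_mul, this, zero_mul]

/-- The defining properties of the lcm. -/
theorem badLcm_spec (L : ℕ) (A : Finset ℕ) (hA : A.Nonempty) :
    0 < badLcm L A ∧ ∀ M : ℕ, badLcm L A ∣ M ↔ ∀ s ∈ badOrders L A, s ∣ M := by
  have hmem : badLcm L A ∈ {M | 0 < M ∧ ∀ s ∈ badOrders L A, s ∣ M} := by
    apply Nat.sInf_mem
    refine ⟨∏ s ∈ (badOrders_finite L A hA).toFinset, s, ?_, ?_⟩
    · apply Finset.prod_pos
      intro s hs
      exact ((badOrders_finite L A hA).mem_toFinset.1 hs).1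
    · intro s hs
      exact Finset.dvd_prod_of_mem (fun s => s) ((badOrders_finite L A hA).mem_toFinset.2 hs)
  refine ⟨hmem.1, fun M => ⟨fun h s hs => (hmem.2 s hs).trans h, fun h => ?_⟩⟩
  have hg : badLcm L A ≤ Nat.gcd (badLcm L A) M :=
    Nat.sInf_le ⟨Nat.gcd_pos_of_pos_left _ hmem.1, fun s hs => Nat.dvd_gcd (hmem.2 s hs) (h s hs)⟩
  have := le_antisymm hg (Nat.gcd_le_left _ hmem.1)
  rw [this]
  exact Nat.gcd_dvd_right _ _

/-- The divisor condition on `A`: either `A(x)` has no divisor `Φ_s` with `(s, L) = 1`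
(i.e. `s_A = 1`), or `s_A = s₁ s₂` with `s₁, s₂ > 1`, `s₂ < |A|`, and `Φ_q ∤ A` for all `q ∣ s₁`. -/
def DivisorCondition (L : ℕ) (A : Finset ℕ) : Prop :=
  badLcm L A = 1 ∨
    ∃ s₁ s₂ : ℕ, 1 < s₁ ∧ 1 < s₂ ∧ badLcm L A = s₁ * s₂ ∧ s₂ < A.card ∧
      ∀ q : ℕ, q ∣ s₁ → ¬ cyclotomic q ℤ ∣ genPoly A

/-- Every complex root of `A(x)` on the unit circle is a root of unity. -/
def UnitRootsAreRootsOfUnity (A : Finset ℕ) : Prop :=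
  ∀ z : ℂ, aeval z (genPoly A) = 0 → ‖z‖ = 1 → ∃ n : ℕ, 0 < n ∧ z ^ n = 1

end BuffonNeedle

/-!
The proof follows the Fourier-analytic approach of Nazarov, Peres and Volberg to the decay of Favard
length, in the form that Bond, Łaba and Volberg gave it for product sets.

Rescaled, the projection of the `N`-th iterate in direction `θ` is the set of digit sums
`l(d_0) + L l(d_1) + ⋯ + L^{N-1} l(d_{N-1})`, where `d_i ∈ D = A × B` and `l(a, b) = a cos θ + b sin θ`
(`digitSum`, `projHom`). If two words of digits represent the same point of the plane, then the
number of points grows more slowly than `L ^ N`, and the Favard length decays at once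
(`exists_decay_of_not_uniqueDigits`). From here on, suppose that this does not happen.

*Dichotomy.* Fix `θ` and a large `K`. Either all levels up to `N` have at most `2 K L^n` pairs of
points with close projections, or the projections of the levels `N j` have measure `O(L^{N j} / K)`
as soon as `j` is large compared with `K²` (`closePairs_or_density`). To see this, remove at every
level the points that lie in piles of `K` points with close projections. The neighbourhood of the
removed points is small, and if the removed points make up a definite proportion of all words, then
self-similarity lets this smallness spread; if they make up a small proportion, then close pairs are
rare.

*Fourier side.* A bound for the number of close pairs bounds the `L²` norm over `[-1, 1]` of the
exponential sum of level `n` (`exists_integral_expSum_le`), whose square is, up to normalization, the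
product of `f(ξ), f(L ξ), …, f(L^{n-1} ξ)`, with `f` the normalized squared exponential sum of `D`.
The opposite bound comes from the high-frequency factors, those with index in `[m, n)`. The
exponential sum is positive definite, so that its integral over a difference set `Γ - Γ` is at least
what the diagonal terms contribute (Salem's argument, `measure_mul_pow_le`); if `|Γ|` is about
`(ρ / L)^m` with `ρ > 1`, this forces a mass of order `ρ^m`, while few close pairs allow only `O(K)`.
It remains to compare the product of the high-frequency factors with that of all factors, that is,
to bound the low-frequency factors from below on `Γ - Γ`.

*Low frequencies.* The factor `f` is the product of the contributions of `A` and of `B` at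
`ξ cos θ` and `ξ sin θ`. Each zero of the polynomial of `A` on the unit circle is a root of unity of
some order `s`. If `s` is not prime to `L`, then the corresponding factor is at least a quotient
`|e(S L^i u) - 1| / |e(S u) - 1|` up to a constant, and the product of these quotients along
`u, L u, L² u, …` telescopes (`le_powProd`): it is small only where `S L^{m+i} u` is nearly an
integer. If `s` is prime to `L`, then the factor is bounded below on a set `X` in which `s₁ u` is
nearly an integer. A Cantor set `Γ` built with the digits `0, …, |B|` to base `L` has all its dilated
differences in `X`, because of `s₂ < |A|`, and its measure is of order `((|B| + 1) / L)^m`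
(`exists_admissible`). A similar set for `B` and a Fubini argument yield a set `Γ` on the line, with
`ρ = (|A| + 1) (|B| + 1) / L > 1` (`exists_line_set`).

*Average over directions.* The nearly integral `S L^{m+i} u` are not avoided for individual `θ`.
But in polar coordinates the average over `θ` of the mass near such points is a product of
one-dimensional integrals, which orthogonality of characters evaluates (`lintegral_polar_le`,
`lintegral_lintegral_nearRational_le`). Hence they matter only for a set of directions of measure
`O(ρ^{-m})` (`exists_exceptional_set`). All other directions, with `K` of order `ρ^m` and `N`
exponential in `m`, are in the second case of the dichotomy, and so their projections have measure
`O(ρ^{-m})` at a level exponential in `m`. This is the power law.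

*Sets with at most six elements* satisfy the divisor condition
(`divisorCondition_of_card_le_six`). Vanishing sums of at most six roots of unity, whose order is prime
to their number, exist only for five summands; these split into an antipodal pair and an equilateral
triangle, which makes all orders `s` in question have the same `3`-adic valuation, and `s₂ = 3` is
admissible.
-/

namespace BuffonNeedle

open MeasureTheory Polynomial

/-! ### Digit sums -/

section DigitSum

variable {G : Type*} [AddCommMonoid G] [DecidableEq G]

/-- The `L`-adic digit sums `d_0 + L d_1 + ⋯ + L^{n-1} d_{n-1}` with all `d_i ∈ D`: the iterate
`A_n`, rescaled by `L^{n-1}`. -/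
def digitSum (L : ℕ) (D : Finset G) : ℕ → Finset G
  | 0 => {0}
  | n + 1 => (digitSum L D n ×ˢ D).image fun p => L • p.1 + p.2

/-- All words of digits in `D` represent different elements. -/
def UniqueDigits (L : ℕ) (D : Finset G) : Prop :=
  ∀ n, (digitSum L D n).card = D.card ^ n

variable {L : ℕ} {D : Finset G}

theorem digitSum_add (i j : ℕ) :
    digitSum L D (i + j) =
      (digitSum L D i ×ˢ digitSum L D j).image fun p => L ^ j • p.1 + p.2 := by
  induction j with
  | zero => ext w; simp [digitSum]
  | succ j ih =>
    rw [← add_assoc, digitSum, ih, digitSum]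
    ext w
    simp only [Finset.mem_image, Finset.mem_product, Prod.exists]
    constructor
    · rintro ⟨_, d, ⟨⟨u, x, ⟨hu, hx⟩, rfl⟩, hd⟩, rfl⟩
      refine ⟨u, L • x + d, ⟨hu, x, d, ⟨hx, hd⟩, rfl⟩, ?_⟩
      rw [smul_add, smul_smul, pow_succ', add_assoc]
    · rintro ⟨u, _, ⟨hu, x, d, ⟨hx, hd⟩, rfl⟩, rfl⟩
      refine ⟨L ^ j • u + x, d, ⟨⟨u, x, ⟨hu, hx⟩, rfl⟩, hd⟩, ?_⟩
      rw [smul_add, smul_smul, pow_succ', add_assoc]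

theorem card_digitSum_add_le (i j : ℕ) :
    (digitSum L D (i + j)).card ≤ (digitSum L D i).card * (digitSum L D j).card := by
  rw [digitSum_add, ← Finset.card_product]
  exact Finset.card_image_le

theorem digitSum_one : digitSum L D 1 = D := by
  ext w
  simp [digitSum]

theorem card_digitSum_le (n : ℕ) : (digitSum L D n).card ≤ D.card ^ n := by
  induction n with
  | zero => simp [digitSum]
  | succ n ih =>
    refine (card_digitSum_add_le n 1).trans ?_
    rw [digitSum_one, pow_succ]
    exact Nat.mul_le_mul_right _ ih

theorem UniqueDigits.injOn (h : UniqueDigits L D) (i j : ℕ) :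
    Set.InjOn (fun p : G × G => L ^ j • p.1 + p.2)
      (digitSum L D i ×ˢ digitSum L D j : Finset (G × G)) := by
  rw [← Finset.card_image_iff, ← digitSum_add, h, Finset.card_product, h, h, pow_add]

theorem UniqueDigits.sum_add (h : UniqueDigits L D) {E : Type*} [AddCommMonoid E] (i j : ℕ)
    (f : G → E) :
    ∑ w ∈ digitSum L D (i + j), f w =
      ∑ u ∈ digitSum L D i, ∑ x ∈ digitSum L D j, f (L ^ j • u + x) := by
  rw [digitSum_add, Finset.sum_image (h.injOn i j), Finset.sum_product]

theorem exists_of_mem_digitSum_add {i j : ℕ} {w : G} (hw : w ∈ digitSum L D (i + j)) :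
    ∃ u ∈ digitSum L D i, ∃ x ∈ digitSum L D j, w = L ^ j • u + x := by
  rw [digitSum_add] at hw
  obtain ⟨⟨u, x⟩, hux, rfl⟩ := Finset.mem_image.1 hw
  exact ⟨u, (Finset.mem_product.1 hux).1, x, (Finset.mem_product.1 hux).2, rfl⟩

theorem abs_le_of_mem_digitSum {l : G →+ ℝ} {C : ℝ} (hL : 2 ≤ L) (hC : ∀ d ∈ D, |l d| ≤ C)
    {n : ℕ} {w : G} (hw : w ∈ digitSum L D n) : |l w| ≤ C * ((L : ℝ) ^ n - 1) := by
  induction n generalizing w with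
  | zero =>
    have : w = 0 := by simpa [digitSum] using hw
    simp [this]
  | succ n ih =>
    obtain ⟨u, hu, d, hd, rfl⟩ := exists_of_mem_digitSum_add hw
    rw [digitSum_one] at hd
    have h1 := ih hu
    have h2 := hC d hd
    have hL' : (2 : ℝ) ≤ L := by exact_mod_cast hL
    have hC0 : 0 ≤ C := (abs_nonneg _).trans h2
    simp only [pow_one, map_add, map_nsmul, nsmul_eq_mul]
    calc |(L : ℝ) * l u + l d| ≤ |(L : ℝ) * l u| + |l d| := abs_add_le _ _
      _ = L * |l u| + |l d| := by rw [abs_mul, Nat.abs_cast]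
      _ ≤ L * (C * ((L : ℝ) ^ n - 1)) + C := by gcongr
      _ ≤ C * ((L : ℝ) ^ (n + 1) - 1) := by
        rw [pow_succ]; nlinarith

end DigitSum

/-! ### Pairs of points with close projections -/

section Energy

/-- Among pairs of points of `S`, those whose `f`-values differ by `q` are at most as many as those
with equal `f`-values. -/
theorem card_shift_le {ι : Type*} (S : Finset ι) (f : ι → ℤ) (q : ℤ) :
    ((S ×ˢ S).filter fun p => f p.2 = f p.1 + q).card ≤
      ((S ×ˢ S).filter fun p => f p.2 = f p.1).card := by
  classical
  set c : ℤ → ℕ := fun r => (S.filter fun y => f y = r).card with hc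
  have key : ∀ q : ℤ, ((S ×ˢ S).filter fun p => f p.2 = f p.1 + q).card =
      ∑ r ∈ S.image f, c r * c (r + q) := by
    intro q
    rw [Finset.card_filter, Finset.sum_product]
    simp only [← Finset.card_filter]
    rw [← Finset.sum_fiberwise_of_maps_to (g := f) (t := S.image f)
      (fun x hx => Finset.mem_image_of_mem f hx)]
    refine Finset.sum_congr rfl fun r _ => ?_
    rw [Finset.sum_congr rfl (g := fun _ => c (r + q)), Finset.sum_const, smul_eq_mul]
    intro x hx
    rw [(Finset.mem_filter.1 hx).2]
  have key0 := key 0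
  simp only [add_zero] at key0
  rw [key, key0]
  have h1 : ∑ r ∈ S.image f, c (r + q) * c (r + q) ≤ ∑ r ∈ S.image f, c r * c r := by
    refine (Finset.sum_map (S.image f) (addRightEmbedding q) (fun r => c r * c r)).symm.trans_le ?_
    refine Finset.sum_le_sum_of_ne_zero fun r _ hr => ?_
    have : c r ≠ 0 := fun h => hr (by simp [h])
    obtain ⟨y, hy⟩ := Finset.card_ne_zero.1 this
    rw [Finset.mem_filter] at hy
    exact Finset.mem_image.2 ⟨y, hy.1, hy.2⟩
  have h2 : ∑ r ∈ S.image f, 2 * (c r * c (r + q)) ≤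
      ∑ r ∈ S.image f, (c r * c r + c (r + q) * c (r + q)) := by
    refine Finset.sum_le_sum fun r _ => ?_
    zify
    nlinarith [sq_nonneg ((c r : ℤ) - c (r + q))]
  rw [← Finset.mul_sum, Finset.sum_add_distrib] at h2
  omega

/-- The pairs of points of `S` whose images under `l` are at distance at most `R`. -/
noncomputable def closePairs {ι : Type*} (l : ι → ℝ) (R : ℝ) (S : Finset ι) : Finset (ι × ι) :=
  (S ×ˢ S).filter fun p => |l p.1 - l p.2| ≤ R

/-- Points in the same cell of length `R` are close. -/
theorem card_sameBin_le {ι : Type*} (l : ι → ℝ) {R : ℝ} (hR : 0 < R) (S : Finset ι) :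
    ((S ×ˢ S).filter fun p => ⌊l p.2 / R⌋ = ⌊l p.1 / R⌋).card ≤ (closePairs l R S).card := by
  refine Finset.card_le_card fun p hp => ?_
  rw [Finset.mem_filter] at hp
  rw [closePairs, Finset.mem_filter]
  refine ⟨hp.1, ?_⟩
  have := Int.abs_sub_lt_one_of_floor_eq_floor hp.2
  rw [← sub_div, abs_div, abs_of_pos hR, div_lt_one hR, abs_sub_comm] at this
  exact this.le

/-- The number of pairs with `l x - l y` in a given interval of length `2R` is controlled by the
number of close pairs. -/
theorem card_shifted_closePairs_le {ι : Type*} (l : ι → ℝ) {R : ℝ} (hR : 0 < R) (S : Finset ι)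
    (s : ℝ) :
    ((S ×ˢ S).filter fun p => |s + (l p.1 - l p.2)| ≤ R).card ≤ 4 * (closePairs l R S).card := by
  classical
  set σ := ⌊s / R⌋
  have hsub : ((S ×ˢ S).filter fun p => |s + (l p.1 - l p.2)| ≤ R) ⊆
      (Finset.Icc (σ - 1) (σ + 2)).biUnion fun q =>
        (S ×ˢ S).filter fun p => ⌊l p.2 / R⌋ = ⌊l p.1 / R⌋ + q := by
    intro p hp
    rw [Finset.mem_filter] at hp
    have h := abs_le.1 hp.2
    have e1 : l p.2 / R ≤ l p.1 / R + s / R + 1 := by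
      rw [← add_div, div_add_one hR.ne']; gcongr; linarith
    have e2 : l p.1 / R + s / R - 1 ≤ l p.2 / R := by
      rw [← add_div, div_sub_one hR.ne']; gcongr; linarith
    have f1 := Int.floor_le (l p.1 / R)
    have f2 := Int.lt_floor_add_one (l p.1 / R)
    have f3 := Int.floor_le (l p.2 / R)
    have f4 := Int.lt_floor_add_one (l p.2 / R)
    have f5 := Int.floor_le (s / R)
    have f6 := Int.lt_floor_add_one (s / R)
    refine Finset.mem_biUnion.2 ⟨⌊l p.2 / R⌋ - ⌊l p.1 / R⌋, Finset.mem_Icc.2 ⟨?_, ?_⟩,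
      Finset.mem_filter.2 ⟨hp.1, by ring⟩⟩
    · have : ((⌊s / R⌋ - 2 : ℤ) : ℝ) < ((⌊l p.2 / R⌋ - ⌊l p.1 / R⌋ : ℤ) : ℝ) := by
        push_cast; linarith
      have := Int.cast_lt.1 this
      omega
    · have : ((⌊l p.2 / R⌋ - ⌊l p.1 / R⌋ : ℤ) : ℝ) < ((⌊s / R⌋ + 3 : ℤ) : ℝ) := by
        push_cast; linarith
      have := Int.cast_lt.1 this
      omega
  refine (Finset.card_le_card hsub).trans (Finset.card_biUnion_le.trans ?_)
  refine (Finset.sum_le_card_nsmul _ _ _ fun q _ =>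
    (card_shift_le S (fun x => ⌊l x / R⌋) q).trans (card_sameBin_le l hR S)).trans ?_
  rw [Int.card_Icc, smul_eq_mul]
  have : (σ + 2 + 1 - (σ - 1)).toNat = 4 := by
    rw [show σ + 2 + 1 - (σ - 1) = 4 by ring]; rfl
  rw [this]

end Energy

/-! ### Neighbourhoods of projections -/

section Nbhd

variable {G : Type*}

/-- The `r`-neighbourhood of the projection by `l` of a finite set of points. -/
def nbhd (l : G → ℝ) (r : ℝ) (S : Finset G) : Set ℝ := ⋃ w ∈ S, Metric.ball (l w) r

theorem nbhd_union [DecidableEq G] (l : G → ℝ) (r : ℝ) (S T : Finset G) :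
    nbhd l r (S ∪ T) = nbhd l r S ∪ nbhd l r T := by
  unfold nbhd
  rw [Finset.set_biUnion_union]

theorem measure_nbhd_lt_top (l : G → ℝ) (r : ℝ) (S : Finset G) : volume (nbhd l r S) < ⊤ :=
  (measure_biUnion_lt_top S.finite_toSet fun _ _ => measure_ball_lt_top)

theorem measureReal_nbhd_le (l : G → ℝ) {r : ℝ} (hr : 0 ≤ r) (S : Finset G) :
    volume.real (nbhd l r S) ≤ S.card * (2 * r) := by
  refine (measureReal_biUnion_finset_le _ _).trans ?_
  simp only [Real.volume_real_ball hr, Finset.sum_const, nsmul_eq_mul]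
  rfl

end Nbhd

/-! ### Removal of piles -/

section Piles

variable {G : Type*} [AddCommMonoid G] [DecidableEq G]

/-- From any finite set `C` one can remove a set `V` whose neighbourhood has measure at most
`2 (R + r) |V| / K`, so that no point of the remaining set has `K` remaining points nearby. -/
theorem exists_piles {G : Type*} [DecidableEq G] (l : G → ℝ) {R r K : ℝ} (hR : 0 ≤ R) (hr : 0 ≤ r)
    (hK : 0 < K) (C : Finset G) :
    ∃ V ⊆ C, volume.real (nbhd l r V) ≤ 2 * (R + r) * V.card / K ∧
      ∀ w ∈ C \ V, (((C \ V).filter fun v => |l w - l v| ≤ R).card : ℝ) < K := by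
  classical
  obtain ⟨V, hV, hmax⟩ := Finset.exists_max_image
    (C.powerset.filter fun V => volume.real (nbhd l r V) ≤ 2 * (R + r) * V.card / K)
    Finset.card ⟨∅, Finset.mem_filter.2 ⟨by simp, by simp [nbhd]⟩⟩
  rw [Finset.mem_filter, Finset.mem_powerset] at hV
  refine ⟨V, hV.1, hV.2, fun w hw => ?_⟩
  by_contra! hcon
  set P := (C \ V).filter fun v => |l w - l v| ≤ R with hP
  have hdisj : Disjoint V P :=
    (Finset.disjoint_sdiff (s := V) (t := C)).mono_right (Finset.filter_subset _ _)
  have hPm : volume.real (nbhd l r P) ≤ 2 * (R + r) := by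
    have hsub : nbhd l r P ⊆ Metric.ball (l w) (R + r) := by
      refine Set.iUnion₂_subset fun v hv => Metric.ball_subset_ball' ?_
      have := (Finset.mem_filter.1 hv).2
      rw [Real.dist_eq, abs_sub_comm]
      linarith
    refine (measureReal_mono hsub measure_ball_lt_top.ne).trans ?_
    rw [Real.volume_real_ball (by linarith)]
  have hmem : V ∪ P ∈
      C.powerset.filter fun V => volume.real (nbhd l r V) ≤ 2 * (R + r) * V.card / K := by
    rw [Finset.mem_filter, Finset.mem_powerset]
    refine ⟨Finset.union_subset hV.1 ((Finset.filter_subset _ _).trans Finset.sdiff_subset), ?_⟩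
    rw [nbhd_union, Finset.card_union_of_disjoint hdisj]
    refine (measureReal_union_le _ _).trans ?_
    have h1 : 2 * (R + r) ≤ 2 * (R + r) * P.card / K := by
      rw [le_div_iff₀ hK]
      gcongr
    push_cast
    rw [mul_add, add_div]
    linarith [hV.2]
  have h2 := hmax _ hmem
  rw [Finset.card_union_of_disjoint hdisj] at h2
  have h3 : (0 : ℝ) < P.card := hK.trans_le hcon
  have : 0 < P.card := by exact_mod_cast h3
  omega

/-- The successors `L u + d` of the points of `S`. -/
def children (L : ℕ) (D : Finset G) (S : Finset G) : Finset G :=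
  (S ×ˢ D).image fun p => L • p.1 + p.2

/-- A system of piles: `S i` are the points of level `i` that survive, `V (i + 1)` the points
removed from the successors of `S i`. The removed points have a small neighbourhood, and no
surviving point has more than `K` survivors within distance `R`. -/
structure PileSystem (L : ℕ) (D : Finset G) (l : G → ℝ) (R r K : ℝ) where
  S : ℕ → Finset G
  V : ℕ → Finset G
  zero : S 0 = {0}
  succ : ∀ i, S (i + 1) = children L D (S i) \ V (i + 1)
  sub : ∀ i, V (i + 1) ⊆ children L D (S i)
  cover : ∀ i, volume.real (nbhd l r (V (i + 1))) ≤ 2 * (R + r) * (V (i + 1)).card / K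
  sparse : ∀ i, ∀ w ∈ S i, (((S i).filter fun v => |l w - l v| ≤ R).card : ℝ) ≤ K

theorem exists_pileSystem (L : ℕ) (D : Finset G) (l : G → ℝ) {R r K : ℝ} (hR : 0 ≤ R)
    (hr : 0 ≤ r) (hK : 1 ≤ K) : Nonempty (PileSystem L D l R r K) := by
  classical
  choose g hg1 hg2 hg3 using exists_piles l hR hr (zero_lt_one.trans_le hK)
  let S : ℕ → Finset G := fun n =>
    Nat.rec {0} (fun _ T => children L D T \ g (children L D T)) n
  refine ⟨⟨S, fun i => g (children L D (S (i - 1))), rfl, fun i => rfl, fun i => hg1 _,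
    fun i => hg2 _, fun i w hw => ?_⟩⟩
  cases i with
  | zero =>
    refine le_trans ?_ hK
    exact_mod_cast Finset.card_filter_le ({0} : Finset G) _
  | succ i => exact (hg3 (children L D (S i)) w hw).le

end Piles

namespace PileSystem

variable {G : Type*} [AddCommMonoid G] [DecidableEq G] {L : ℕ} {D : Finset G} {l : G →+ ℝ}
  {R r K : ℝ} (PS : PileSystem L D l R r K)

theorem subset_digitSum (i : ℕ) : PS.S i ⊆ digitSum L D i := by
  induction i with
  | zero => rw [PS.zero]; exact subset_rfl
  | succ i ih =>
    rw [PS.succ]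
    exact Finset.sdiff_subset.trans (Finset.image_subset_image (Finset.product_subset_product_left ih))

theorem sum_children (hU : UniqueDigits L D) {E : Type*} [AddCommMonoid E] (i : ℕ) (f : G → E) :
    ∑ v ∈ children L D (PS.S i), f v = ∑ u ∈ PS.S i, ∑ d ∈ D, f (L • u + d) := by
  have h := hU.injOn i 1
  rw [digitSum_one, pow_one] at h
  rw [children, Finset.sum_image (h.mono ?_), Finset.sum_product]
  exact_mod_cast Finset.product_subset_product_left (PS.subset_digitSum i)

theorem sum_children_eq (i : ℕ) {E : Type*} [AddCommMonoid E] (f : G → E) :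
    ∑ v ∈ children L D (PS.S i), f v = ∑ v ∈ PS.V (i + 1), f v + ∑ v ∈ PS.S (i + 1), f v := by
  rw [PS.succ, add_comm, Finset.sum_sdiff (PS.sub i)]

theorem card_succ (hU : UniqueDigits L D) (i : ℕ) :
    (PS.V (i + 1)).card + (PS.S (i + 1)).card = D.card * (PS.S i).card := by
  have h1 := PS.sum_children hU i (fun _ => 1)
  rw [PS.sum_children_eq] at h1
  simpa [mul_comm] using h1

/-- The proportion of words that pass through a removed point of level at most `n`. -/
noncomputable def removed (n : ℕ) : ℝ := ∑ i ∈ Finset.range n, (PS.V (i + 1)).card / (L : ℝ) ^ (i + 1)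

/-- The words that do not pass through a removed point are those that lead to `S n`. -/
theorem removed_eq (hU : UniqueDigits L D) (hD : D.card = L) (hL : 2 ≤ L) (n : ℕ) :
    PS.removed n = 1 - (PS.S n).card / (L : ℝ) ^ n := by
  have hL0 : (L : ℝ) ≠ 0 := by positivity
  induction n with
  | zero => simp [removed, PS.zero]
  | succ n ih =>
    have h : ((PS.V (n + 1)).card : ℝ) + (PS.S (n + 1)).card = L * (PS.S n).card := by
      have := PS.card_succ hU n
      rw [hD] at this
      exact_mod_cast this
    rw [removed, Finset.sum_range_succ, ← removed, ih]
    field_simp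
    rw [pow_succ]
    linear_combination (L : ℝ) ^ n * h

theorem removed_mono {m n : ℕ} (h : m ≤ n) : PS.removed m ≤ PS.removed n := by
  refine Finset.sum_le_sum_of_subset_of_nonneg (Finset.range_mono h) fun i _ _ => by positivity

/-- The neighbourhood of the projection of the descendants of `S` after `k` further levels. -/
def desc (L : ℕ) (D : Finset G) (l : G → ℝ) (r : ℝ) (S : Finset G) (k : ℕ) : Set ℝ :=
  ⋃ u ∈ S, ⋃ x ∈ digitSum L D k, Metric.ball ((L : ℝ) ^ k * l u + l x) r

theorem desc_singleton_zero (l : G →+ ℝ) (k : ℕ) :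
    desc L D l r {0} k = nbhd l r (digitSum L D k) := by
  simp [desc, nbhd]

theorem measure_desc_lt_top (l : G → ℝ) (S : Finset G) (k : ℕ) :
    volume (desc L D l r S k) < ⊤ :=
  measure_biUnion_lt_top S.finite_toSet fun _ _ =>
    measure_biUnion_lt_top (Finset.finite_toSet _) fun _ _ => measure_ball_lt_top

theorem measureReal_desc_le (l : G → ℝ) (S : Finset G) (k : ℕ) :
    volume.real (desc L D l r S k) ≤ S.card * volume.real (nbhd l r (digitSum L D k)) := by
  refine (measureReal_biUnion_finset_le _ _).trans ?_
  rw [← nsmul_eq_mul]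
  refine Finset.sum_le_card_nsmul _ _ _ fun u _ => le_of_eq ?_
  have : (⋃ x ∈ digitSum L D k, Metric.ball ((L : ℝ) ^ k * l u + l x) r) =
      (fun y => -((L : ℝ) ^ k * l u) + y) ⁻¹' nbhd l r (digitSum L D k) := by
    ext y
    simp only [nbhd, Set.mem_iUnion, Set.mem_preimage, Metric.mem_ball, Real.dist_eq, exists_prop]
    refine exists_congr fun x => and_congr_right fun _ => ?_
    rw [show y - ((L : ℝ) ^ k * l u + l x) = -((L : ℝ) ^ k * l u) + y - l x by ring]
  rw [this, measureReal_def, measure_preimage_add, measureReal_def]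

theorem measureReal_scaled {G : Type*} (l : G → ℝ) (S : Finset G) (hL : 0 < L) (k : ℕ) :
    volume.real (⋃ v ∈ S, Metric.ball ((L : ℝ) ^ k * l v) ((L : ℝ) ^ k * r)) =
      (L : ℝ) ^ k * volume.real (nbhd l r S) := by
  have hL0 : (0 : ℝ) < (L : ℝ) ^ k := by positivity
  have : (⋃ v ∈ S, Metric.ball ((L : ℝ) ^ k * l v) ((L : ℝ) ^ k * r)) =
      (fun y => ((L : ℝ) ^ k)⁻¹ * y) ⁻¹' nbhd l r S := by
    ext y
    simp only [nbhd, Set.mem_iUnion, Set.mem_preimage, Metric.mem_ball, Real.dist_eq, exists_prop]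
    refine exists_congr fun x => and_congr_right fun _ => ?_
    have : y - (L : ℝ) ^ k * l x = (L : ℝ) ^ k * (((L : ℝ) ^ k)⁻¹ * y - l x) := by
      field_simp
    rw [this, abs_mul, abs_of_pos hL0, mul_lt_mul_iff_right₀ hL0]
  rw [this, measureReal_def, Real.volume_preimage_mul_left (inv_ne_zero hL0.ne'), inv_inv,
    abs_of_pos hL0, ENNReal.toReal_mul, ENNReal.toReal_ofReal hL0.le, measureReal_def]

variable {c : ℝ}

/-- Passing to the next level, the descendants of the removed points contribute at most the dilated
neighbourhood of these points. -/
theorem measureReal_desc_succ_le (hL : 2 ≤ L) (hc : ∀ d ∈ D, |l d| ≤ c) (hr : c ≤ r)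
    (i k : ℕ) :
    volume.real (desc L D l r (PS.S i) (k + 1)) ≤
      (L : ℝ) ^ k * (2 * (R + r) * (PS.V (i + 1)).card / K) +
        volume.real (desc L D l r (PS.S (i + 1)) k) := by
  have hsub : desc L D l r (PS.S i) (k + 1) ⊆
      (⋃ v ∈ PS.V (i + 1), Metric.ball ((L : ℝ) ^ k * l v) ((L : ℝ) ^ k * r)) ∪
        desc L D l r (PS.S (i + 1)) k := by
    intro y hy
    simp only [desc, Set.mem_iUnion, exists_prop] at hy
    obtain ⟨u, hu, w, hw, hy⟩ := hy
    rw [add_comm k 1] at hw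
    obtain ⟨d, hd, x, hx, rfl⟩ := exists_of_mem_digitSum_add hw
    rw [digitSum_one] at hd
    have hv : L • u + d ∈ children L D (PS.S i) :=
      Finset.mem_image.2 ⟨(u, d), Finset.mem_product.2 ⟨hu, hd⟩, rfl⟩
    have hy' : y ∈ Metric.ball ((L : ℝ) ^ k * l (L • u + d) + l x) r := by
      convert hy using 2
      simp only [map_add, map_nsmul, nsmul_eq_mul]
      push_cast
      ring
    by_cases hV : L • u + d ∈ PS.V (i + 1)
    · left
      simp only [Set.mem_iUnion, exists_prop]
      refine ⟨_, hV, Metric.ball_subset_ball' ?_ hy'⟩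
      rw [Real.dist_eq, add_sub_cancel_left]
      have h1 := abs_le_of_mem_digitSum hL hc hx
      have h2 : (1 : ℝ) ≤ (L : ℝ) ^ k := one_le_pow₀ (by exact_mod_cast (by omega : 1 ≤ L))
      nlinarith
    · right
      simp only [desc, Set.mem_iUnion, exists_prop]
      refine ⟨_, ?_, x, hx, hy'⟩
      rw [PS.succ]
      exact Finset.mem_sdiff.2 ⟨hv, hV⟩
  refine (measureReal_mono hsub ?_).trans ((measureReal_union_le _ _).trans ?_)
  · refine (measure_union_lt_top ?_ (measure_desc_lt_top _ _ _)).ne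
    exact measure_biUnion_lt_top (Finset.finite_toSet _) fun _ _ => measure_ball_lt_top
  · rw [measureReal_scaled _ _ (by omega)]
    gcongr
    exact PS.cover i

theorem measureReal_desc_zero_le (hL : 2 ≤ L) (hc : ∀ d ∈ D, |l d| ≤ c) (hr : c ≤ r) (n k : ℕ) :
    volume.real (desc L D l r (PS.S 0) (n + k)) ≤
      (L : ℝ) ^ (n + k) * (2 * (R + r) / K * PS.removed n) +
        volume.real (desc L D l r (PS.S n) k) := by
  induction n generalizing k with
  | zero => simp [removed]
  | succ n ih =>
    have h1 := ih (k + 1)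
    have h2 := PS.measureReal_desc_succ_le hL hc hr n k
    have hL0 : (L : ℝ) ≠ 0 := by positivity
    have h3 : (L : ℝ) ^ k * (2 * (R + r) * (PS.V (n + 1)).card / K) =
        (L : ℝ) ^ (n + 1 + k) * (2 * (R + r) / K * ((PS.V (n + 1)).card / (L : ℝ) ^ (n + 1))) := by
      rw [pow_add _ (n + 1) k]
      field_simp
    rw [show n + (k + 1) = n + 1 + k by ring] at h1
    rw [removed, Finset.sum_range_succ, ← removed]
    linarith

/-- The measure of the projected neighbourhood of level `n`, relative to `L ^ n`. -/
noncomputable def _root_.BuffonNeedle.density (L : ℕ) (D : Finset G) (l : G → ℝ) (r : ℝ) (n : ℕ) :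
    ℝ := volume.real (nbhd l r (digitSum L D n)) / (L : ℝ) ^ n

/-- The removed words contribute little, and the others are a proportion `1 - removed n` of copies of
level `k`. -/
theorem density_add_le (hU : UniqueDigits L D) (hD : D.card = L) (hL : 2 ≤ L)
    (hc : ∀ d ∈ D, |l d| ≤ c) (hr : c ≤ r) (n k : ℕ) :
    density L D l r (n + k) ≤
      2 * (R + r) / K * PS.removed n + (1 - PS.removed n) * density L D l r k := by
  have h1 := PS.measureReal_desc_zero_le hL hc hr n k
  have h2 := measureReal_desc_le (D := D) (L := L) (r := r) l (PS.S n) k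
  have hL0 : (0 : ℝ) < L := by positivity
  rw [PS.zero, desc_singleton_zero] at h1
  rw [density, density, div_le_iff₀ (by positivity)]
  have h3 : (1 - PS.removed n) = (PS.S n).card / (L : ℝ) ^ n := by
    rw [PS.removed_eq hU hD hL]; ring
  have h4 : (PS.S n).card * volume.real (nbhd l r (digitSum L D k)) =
      (1 - PS.removed n) * (volume.real (nbhd l r (digitSum L D k)) / (L : ℝ) ^ k) *
        (L : ℝ) ^ (n + k) := by
    rw [h3, pow_add]
    field_simp
  rw [add_mul, ← h4]
  linarith

theorem density_mul_le (hU : UniqueDigits L D) (hD : D.card = L) (hL : 2 ≤ L)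
    (hc : ∀ d ∈ D, |l d| ≤ c) (hr : c ≤ r) (hR : 0 ≤ R) (hr0 : 0 ≤ r) (hK : 0 < K) (n j : ℕ) :
    density L D l r (n * j) ≤ 2 * (R + r) / K + (1 - PS.removed n) ^ j * (2 * r) := by
  have hL0 : (0 : ℝ) < L := by positivity
  have h1 : 0 ≤ 1 - PS.removed n := by
    rw [PS.removed_eq hU hD hL]; ring_nf; positivity
  induction j with
  | zero =>
    have : density L D l r 0 ≤ 2 * r := by
      simpa [density, digitSum] using measureReal_nbhd_le l hr0 ({0} : Finset G)
    rw [mul_zero, pow_zero, one_mul]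
    have : 0 ≤ 2 * (R + r) / K := by positivity
    linarith
  | succ j ih =>
    have h2 := PS.density_add_le hU hD hL hc hr n (n * j)
    rw [show n * (j + 1) = n + n * j by ring]
    refine h2.trans ?_
    rw [pow_succ']
    nlinarith

/-- The number of close pairs of level `k` among the descendants of `u` and `v`. -/
noncomputable def cross (L : ℕ) (D : Finset G) (l : G → ℝ) (R : ℝ) (k : ℕ) (u v : G) : ℕ :=
  ∑ x ∈ digitSum L D k, ∑ y ∈ digitSum L D k,
    if |(L : ℝ) ^ k * (l u - l v) + (l x - l y)| ≤ R then 1 else 0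

theorem cross_eq_card (k : ℕ) (u v : G) : cross L D l R k u v =
    ((digitSum L D k ×ˢ digitSum L D k).filter
      fun p => |(L : ℝ) ^ k * (l u - l v) + (l p.1 - l p.2)| ≤ R).card := by
  rw [Finset.card_filter, Finset.sum_product, cross]

theorem cross_zero_zero (k : ℕ) :
    cross L D l R k 0 0 = (closePairs l R (digitSum L D k)).card := by
  rw [cross_eq_card, closePairs]
  simp

theorem cross_le (hR : 0 < R) (k : ℕ) (u v : G) :
    cross L D l R k u v ≤ 4 * (closePairs l R (digitSum L D k)).card := by
  rw [cross_eq_card]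
  exact card_shifted_closePairs_le _ hR _ _

theorem cross_comm (k : ℕ) (u v : G) : cross L D l R k u v = cross L D l R k v u := by
  rw [cross, Finset.sum_comm, cross]
  refine Finset.sum_congr rfl fun x _ => Finset.sum_congr rfl fun y _ => ?_
  rw [← abs_neg]
  congr 3
  ring

/-- The descendants of points that are not close are not close. -/
theorem cross_eq_zero (hL : 2 ≤ L) (hc : ∀ d ∈ D, |l d| ≤ c) (hR : 2 * c ≤ R) (k : ℕ) {u v : G}
    (h : ¬ |l u - l v| ≤ R) : cross L D l R k u v = 0 := by
  refine Finset.sum_eq_zero fun x hx => Finset.sum_eq_zero fun y hy => if_neg fun hcon => h ?_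
  have h1 := abs_le.1 (abs_le_of_mem_digitSum hL hc hx)
  have h2 := abs_le.1 (abs_le_of_mem_digitSum hL hc hy)
  have h3 := abs_le.1 hcon
  have h4 : (1 : ℝ) ≤ (L : ℝ) ^ k := one_le_pow₀ (by exact_mod_cast (by omega : 1 ≤ L))
  have h5 : 0 ≤ ((L : ℝ) ^ k - 1) * (R - 2 * c) := mul_nonneg (by linarith) (by linarith)
  rw [abs_le]
  constructor
  · refine le_of_mul_le_mul_left ?_ (by linarith : (0 : ℝ) < (L : ℝ) ^ k); nlinarith
  · refine le_of_mul_le_mul_left ?_ (by linarith : (0 : ℝ) < (L : ℝ) ^ k); nlinarith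

theorem cross_succ (hU : UniqueDigits L D) (k : ℕ) (u v : G) :
    cross L D l R (k + 1) u v = ∑ d ∈ D, ∑ e ∈ D, cross L D l R k (L • u + d) (L • v + e) := by
  simp only [cross, add_comm k 1, hU.sum_add 1 k, digitSum_one]
  refine Finset.sum_congr rfl fun d _ => ?_
  rw [Finset.sum_comm]
  refine Finset.sum_congr rfl fun e _ => Finset.sum_congr rfl fun x _ =>
    Finset.sum_congr rfl fun y _ => ?_
  simp only [map_add, map_nsmul, nsmul_eq_mul]
  push_cast
  rw [show (L : ℝ) ^ (1 + k) * (l u - l v) + ((L : ℝ) ^ k * l d + l x - ((L : ℝ) ^ k * l e + l y)) =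
    (L : ℝ) ^ k * (L * l u + l d - (L * l v + l e)) + (l x - l y) by ring]

/-- Neighbouring children have neighbouring parents, of which there are at most `K`. -/
theorem card_near_children (hD : D.card = L) (hL : 2 ≤ L) (hc : ∀ d ∈ D, |l d| ≤ c)
    (hR : 2 * c ≤ R) (i : ℕ) {v : G} (hv : v ∈ children L D (PS.S i)) :
    (((children L D (PS.S i)).filter fun w => |l v - l w| ≤ R).card : ℝ) ≤ L * K := by
  obtain ⟨⟨u, d⟩, hud, rfl⟩ := Finset.mem_image.1 hv
  rw [Finset.mem_product] at hud
  have hL' : (2 : ℝ) ≤ L := by exact_mod_cast hL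
  have hsub : ((children L D (PS.S i)).filter fun w => |l (L • u + d) - l w| ≤ R) ⊆
      children L D ((PS.S i).filter fun w => |l u - l w| ≤ R) := by
    intro w hw
    obtain ⟨hw1, hw2⟩ := Finset.mem_filter.1 hw
    obtain ⟨⟨u', d'⟩, hud', rfl⟩ := Finset.mem_image.1 hw1
    rw [Finset.mem_product] at hud'
    refine Finset.mem_image.2 ⟨(u', d'), Finset.mem_product.2 ⟨Finset.mem_filter.2 ⟨hud'.1, ?_⟩,
      hud'.2⟩, rfl⟩
    simp only [map_add, map_nsmul, nsmul_eq_mul] at hw2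
    have h1 := abs_le.1 (hc _ hud.2)
    have h2 := abs_le.1 (hc _ hud'.2)
    have h3 := abs_le.1 hw2
    simp only at h1 h2
    have hR0 : 0 ≤ R := (abs_nonneg _).trans hw2
    rw [abs_le]
    constructor <;> nlinarith
  have h1 := Finset.card_le_card hsub
  have h2 : (children L D ((PS.S i).filter fun w => |l u - l w| ≤ R)).card ≤
      ((PS.S i).filter fun w => |l u - l w| ≤ R).card * L := by
    refine Finset.card_image_le.trans_eq ?_
    rw [Finset.card_product, hD]
  have h3 := PS.sparse i u hud.1
  calc _ ≤ ((((PS.S i).filter fun w => |l u - l w| ≤ R).card * L : ℕ) : ℝ) := by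
        exact_mod_cast h1.trans h2
    _ ≤ L * K := by push_cast; rw [mul_comm]; gcongr

theorem sum_cross_le (hD : D.card = L) (hL : 2 ≤ L) (hc : ∀ d ∈ D, |l d| ≤ c)
    (hR : 2 * c ≤ R) (hR0 : 0 < R) (i k : ℕ) {v : G} (hv : v ∈ children L D (PS.S i)) :
    ∑ w ∈ children L D (PS.S i), (cross L D l R k v w : ℝ) ≤
      L * K * (4 * (closePairs l R (digitSum L D k)).card) := by
  rw [← Finset.sum_filter_of_ne (p := fun w => |l v - l w| ≤ R) (fun w _ hw => by
    by_contra hcon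
    exact hw (by rw [cross_eq_zero hL hc hR k hcon, Nat.cast_zero]))]
  refine (Finset.sum_le_card_nsmul _ _ (4 * (closePairs l R (digitSum L D k)).card : ℝ)
    fun w _ => by exact_mod_cast cross_le hR0 k v w).trans ?_
  rw [nsmul_eq_mul]
  gcongr
  exact PS.card_near_children hD hL hc hR i hv

/-- The close pairs of descendants of `S i` either involve a removed point of level `i + 1`, which has
at most `L K` neighbours, or descend from pairs of points of `S (i + 1)`. -/
theorem sum_sum_cross_succ_le (hU : UniqueDigits L D) (hD : D.card = L) (hL : 2 ≤ L)
    (hc : ∀ d ∈ D, |l d| ≤ c) (hR : 2 * c ≤ R) (hR0 : 0 < R) (i k : ℕ) :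
    ∑ u ∈ PS.S i, ∑ v ∈ PS.S i, (cross L D l R (k + 1) u v : ℝ) ≤
      8 * L * K * (PS.V (i + 1)).card * (closePairs l R (digitSum L D k)).card +
      ∑ u ∈ PS.S (i + 1), ∑ v ∈ PS.S (i + 1), (cross L D l R k u v : ℝ) := by
  have h1 : ∑ u ∈ PS.S i, ∑ v ∈ PS.S i, (cross L D l R (k + 1) u v : ℝ) =
      ∑ v ∈ children L D (PS.S i), ∑ w ∈ children L D (PS.S i), (cross L D l R k v w : ℝ) := by
    simp_rw [PS.sum_children hU, cross_succ hU, Nat.cast_sum]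
    refine Finset.sum_congr rfl fun u _ => Finset.sum_comm
  have h2 : ∀ v ∈ PS.V (i + 1), ∑ w ∈ children L D (PS.S i), (cross L D l R k v w : ℝ) ≤
      L * K * (4 * (closePairs l R (digitSum L D k)).card) := fun v hv =>
    PS.sum_cross_le hD hL hc hR hR0 i k (PS.sub i hv)
  have h3 := Finset.sum_le_card_nsmul _ _ _ h2
  have h4 : ∑ v ∈ PS.S (i + 1), ∑ w ∈ PS.V (i + 1), (cross L D l R k v w : ℝ) ≤
      ∑ v ∈ PS.V (i + 1), ∑ w ∈ children L D (PS.S i), (cross L D l R k v w : ℝ) := by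
    rw [Finset.sum_comm]
    refine Finset.sum_le_sum fun w _ => ?_
    simp_rw [cross_comm k _ w]
    refine Finset.sum_le_sum_of_subset_of_nonneg ?_ fun _ _ _ => by positivity
    rw [PS.succ]
    exact Finset.sdiff_subset
  rw [h1, PS.sum_children_eq]
  have h5 : ∑ v ∈ PS.S (i + 1), ∑ w ∈ children L D (PS.S i), (cross L D l R k v w : ℝ) =
      ∑ v ∈ PS.S (i + 1), ∑ w ∈ PS.V (i + 1), (cross L D l R k v w : ℝ) +
      ∑ u ∈ PS.S (i + 1), ∑ v ∈ PS.S (i + 1), (cross L D l R k u v : ℝ) := by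
    rw [← Finset.sum_add_distrib]
    exact Finset.sum_congr rfl fun v _ => PS.sum_children_eq i _
  rw [h5]
  rw [nsmul_eq_mul] at h3
  linarith

theorem card_closePairs_le (hU : UniqueDigits L D) (hD : D.card = L) (hL : 2 ≤ L)
    (hc : ∀ d ∈ D, |l d| ≤ c) (hR : 2 * c ≤ R) (hR0 : 0 < R) (n k : ℕ) :
    ((closePairs l R (digitSum L D (n + k))).card : ℝ) ≤
      (∑ i ∈ Finset.range n, 8 * L * K * (PS.V (i + 1)).card *
        (closePairs l R (digitSum L D (n + k - (i + 1)))).card) +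
      ∑ u ∈ PS.S n, ∑ v ∈ PS.S n, (cross L D l R k u v : ℝ) := by
  induction n generalizing k with
  | zero => simp [PS.zero, cross_zero_zero]
  | succ n ih =>
    have h1 := ih (k + 1)
    have h2 := PS.sum_sum_cross_succ_le hU hD hL hc hR hR0 n k
    rw [Finset.sum_range_succ, show n + 1 + k - (n + 1) = k by omega]
    rw [show n + (k + 1) = n + 1 + k by ring] at h1
    linarith

/-- If few words are removed, the number of close pairs is small at every level. -/
theorem card_closePairs_le_of_removed (hU : UniqueDigits L D) (hD : D.card = L) (hL : 2 ≤ L)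
    (hc : ∀ d ∈ D, |l d| ≤ c) (hR : 2 * c ≤ R) (hR0 : 0 < R) (hK : 0 < K) {N : ℕ}
    (hN : 16 * L * K * PS.removed N ≤ 1) {n : ℕ} (hn : n ≤ N) :
    ((closePairs l R (digitSum L D n)).card : ℝ) ≤ 2 * K * (L : ℝ) ^ n := by
  induction n using Nat.strong_induction_on with
  | _ n ih =>
    have hL0 : (0 : ℝ) < L := by positivity
    have h1 := PS.card_closePairs_le hU hD hL hc hR hR0 n 0
    have h2 : ∑ u ∈ PS.S n, ∑ v ∈ PS.S n, (cross L D l R 0 u v : ℝ) ≤ K * (L : ℝ) ^ n := by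
      calc _ = ∑ u ∈ PS.S n, (((PS.S n).filter fun v => |l u - l v| ≤ R).card : ℝ) := by
            refine Finset.sum_congr rfl fun u _ => ?_
            rw [Finset.card_filter, Nat.cast_sum]
            refine Finset.sum_congr rfl fun v _ => ?_
            simp only [cross, digitSum, Finset.sum_singleton, pow_zero, one_mul, sub_self, add_zero]
        _ ≤ (PS.S n).card • K := Finset.sum_le_card_nsmul _ _ _ (PS.sparse n)
        _ ≤ K * (L : ℝ) ^ n := by
          rw [nsmul_eq_mul, mul_comm]
          gcongr
          have := Finset.card_le_card (PS.subset_digitSum n)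
          rw [hU, hD] at this
          exact_mod_cast this
    have h3 : (∑ i ∈ Finset.range n, 8 * L * K * (PS.V (i + 1)).card *
        ((closePairs l R (digitSum L D (n + 0 - (i + 1)))).card : ℝ)) ≤
        ∑ i ∈ Finset.range n, 16 * L * K * (K * (L : ℝ) ^ n) *
          ((PS.V (i + 1)).card / (L : ℝ) ^ (i + 1)) := by
      refine Finset.sum_le_sum fun i hi => ?_
      rw [Finset.mem_range] at hi
      have h4 := ih (n - (i + 1)) (by omega) (by omega)
      have h5 : (L : ℝ) ^ n = (L : ℝ) ^ (n - (i + 1)) * (L : ℝ) ^ (i + 1) := by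
        rw [← pow_add]; congr 1; omega
      calc _ ≤ 8 * L * K * (PS.V (i + 1)).card * (2 * K * (L : ℝ) ^ (n - (i + 1))) := by
            rw [add_zero]; gcongr
        _ = _ := by rw [h5]; field_simp; ring
    rw [← Finset.mul_sum, ← removed] at h3
    have h6 := PS.removed_mono hn
    have h7 : 16 * L * K * (K * (L : ℝ) ^ n) * PS.removed n ≤ K * (L : ℝ) ^ n := by
      calc _ ≤ 16 * L * K * (K * (L : ℝ) ^ n) * PS.removed N := by gcongr
        _ = (16 * L * K * PS.removed N) * (K * (L : ℝ) ^ n) := by ring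
        _ ≤ 1 * (K * (L : ℝ) ^ n) := by gcongr
        _ = _ := one_mul _
    rw [add_zero] at h1
    simp only [add_zero] at h3
    linarith

end PileSystem

/-! ### Few close pairs or small projections -/

section Dichotomy

variable {G : Type*} [AddCommMonoid G] [DecidableEq G] {L : ℕ} {D : Finset G} {l : G →+ ℝ}

/-- Either the number of close pairs is small at all levels up to `N`, or the projections of the
levels `N j` shrink rapidly to size `O(1 / K)`. -/
theorem closePairs_or_density (hU : UniqueDigits L D) (hD : D.card = L) (hL : 2 ≤ L) {c K : ℝ}
    (hc0 : 0 < c) (hc : ∀ d ∈ D, |l d| ≤ c) (hK : 1 ≤ K) (N : ℕ) :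
    (∀ n ≤ N, ((closePairs l (2 * c) (digitSum L D n)).card : ℝ) ≤ 2 * K * (L : ℝ) ^ n) ∨
      ∀ j, density L D l c (N * j) ≤ 6 * c / K + (1 - 1 / (16 * L * K)) ^ j * (2 * c) := by
  have hL0 : (0 : ℝ) < L := by positivity
  have hK0 : 0 < K := by linarith
  obtain ⟨PS⟩ := exists_pileSystem L D l (R := 2 * c) (r := c) (by positivity) hc0.le hK
  rcases le_or_gt (16 * L * K * PS.removed N) 1 with h | h
  · exact Or.inl fun n hn =>
      PS.card_closePairs_le_of_removed hU hD hL hc le_rfl (by positivity) hK0 h hn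
  · refine Or.inr fun j => ?_
    refine (PS.density_mul_le hU hD hL hc le_rfl (by positivity) hc0.le hK0 N j).trans ?_
    have h1 : 0 ≤ 1 - PS.removed N := by
      rw [PS.removed_eq hU hD hL]; ring_nf; positivity
    have h2 : 1 / (16 * L * K) ≤ PS.removed N := by
      rw [div_le_iff₀ (by positivity)]; linarith
    have h3 : (1 - PS.removed N) ^ j ≤ (1 - 1 / (16 * L * K)) ^ j := by gcongr
    rw [show 2 * (2 * c + c) / K = 6 * c / K by ring]
    nlinarith

end Dichotomy

/-! ### Exponential sums -/

section ExpSums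

/-- The character `x ↦ e^{2πix}`. -/
noncomputable def expi (x : ℝ) : ℂ := Complex.exp ((2 * Real.pi * x : ℝ) * Complex.I)

theorem expi_add (x y : ℝ) : expi (x + y) = expi x * expi y := by
  rw [expi, expi, expi, ← Complex.exp_add]
  congr 1
  push_cast
  ring

@[simp] theorem expi_zero : expi 0 = 1 := by simp [expi]

@[simp] theorem norm_expi (x : ℝ) : ‖expi x‖ = 1 := Complex.norm_exp_ofReal_mul_I _

theorem expi_neg (x : ℝ) : expi (-x) = (starRingEnd ℂ) (expi x) := by
  rw [expi, expi, ← Complex.exp_conj, map_mul, Complex.conj_ofReal, Complex.conj_I]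
  congr 1
  push_cast
  ring

theorem expi_intCast (n : ℤ) : expi n = 1 := by
  rw [expi, Complex.exp_eq_one_iff]
  exact ⟨n, by push_cast; ring⟩

theorem expi_nat_mul (n : ℕ) (x : ℝ) : expi (n * x) = expi x ^ n := by
  rw [expi, expi, ← Complex.exp_nat_mul]
  congr 1
  push_cast
  ring

@[fun_prop]
theorem continuous_expi : Continuous expi := by unfold expi; fun_prop

theorem norm_expi_sub_one_le (x : ℝ) : ‖expi x - 1‖ ≤ 2 * Real.pi * |x| := by
  have h := Real.norm_exp_I_mul_ofReal_sub_one_le (x := 2 * Real.pi * x)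
  rw [mul_comm] at h
  refine h.trans_eq ?_
  rw [Real.norm_eq_abs, abs_mul, abs_of_pos Real.two_pi_pos]

/-- The exponential sum `∑_{d ∈ D} e(l(d) u)`. -/
noncomputable def expSum {ι : Type*} (D : Finset ι) (l : ι → ℝ) (u : ℝ) : ℂ :=
  ∑ d ∈ D, expi (l d * u)

@[fun_prop]
theorem continuous_expSum {ι : Type*} (D : Finset ι) (l : ι → ℝ) : Continuous (expSum D l) := by
  unfold expSum; fun_prop

theorem norm_expSum_le {ι : Type*} (D : Finset ι) (l : ι → ℝ) (u : ℝ) :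
    ‖expSum D l u‖ ≤ D.card := by
  refine (norm_sum_le _ _).trans ?_
  simp

theorem expSum_neg {ι : Type*} (D : Finset ι) (l : ι → ℝ) (u : ℝ) :
    expSum D l (-u) = (starRingEnd ℂ) (expSum D l u) := by
  simp only [expSum, map_sum, ← expi_neg, mul_neg]

/-- The squared absolute value of the normalized exponential sum, `|D|⁻² |∑_{d ∈ D} e(l(d) u)|²`. -/
noncomputable def powerSpec {ι : Type*} (D : Finset ι) (l : ι → ℝ) (u : ℝ) : ℝ :=
  ‖expSum D l u‖ ^ 2 / (D.card : ℝ) ^ 2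

@[fun_prop]
theorem continuous_powerSpec {ι : Type*} (D : Finset ι) (l : ι → ℝ) :
    Continuous (powerSpec D l) := by
  unfold powerSpec; fun_prop

theorem powerSpec_nonneg {ι : Type*} (D : Finset ι) (l : ι → ℝ) (u : ℝ) :
    0 ≤ powerSpec D l u := by unfold powerSpec; positivity

theorem powerSpec_le_one {ι : Type*} (D : Finset ι) (l : ι → ℝ) (u : ℝ) :
    powerSpec D l u ≤ 1 := by
  refine div_le_one_of_le₀ ?_ (by positivity)
  gcongr
  exact norm_expSum_le D l u

theorem powerSpec_neg {ι : Type*} (D : Finset ι) (l : ι → ℝ) (u : ℝ) :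
    powerSpec D l (-u) = powerSpec D l u := by
  rw [powerSpec, expSum_neg, RCLike.norm_conj, powerSpec]

theorem norm_expSum_sub_le {ι : Type*} (D : Finset ι) (l : ι → ℝ) {c : ℝ}
    (hc : ∀ d ∈ D, |l d| ≤ c) (u : ℝ) :
    ‖expSum D l u - D.card‖ ≤ D.card * (2 * Real.pi * c * |u|) := by
  have : expSum D l u - D.card = ∑ d ∈ D, (expi (l d * u) - 1) := by
    simp [expSum]
  rw [this]
  refine (norm_sum_le _ _).trans ?_
  rw [← nsmul_eq_mul]
  refine Finset.sum_le_card_nsmul _ _ _ fun d hd => ?_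
  refine (norm_expi_sub_one_le _).trans ?_
  rw [abs_mul, mul_assoc _ c]
  have := hc d hd
  gcongr

theorem one_sub_le_powerSpec {ι : Type*} {D : Finset ι} (hD : D.Nonempty) (l : ι → ℝ) {c : ℝ}
    (hc : ∀ d ∈ D, |l d| ≤ c) (u : ℝ) :
    1 - 4 * Real.pi * c * |u| ≤ powerSpec D l u := by
  have hD0 : (0 : ℝ) < D.card := by exact_mod_cast hD.card_pos
  have h1 := norm_expSum_sub_le D l hc u
  have h2 : (D.card : ℝ) * (1 - 2 * Real.pi * c * |u|) ≤ ‖expSum D l u‖ := by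
    have := norm_sub_norm_le (D.card : ℂ) (expSum D l u)
    rw [norm_sub_rev, Complex.norm_natCast] at this
    linarith
  rcases le_or_gt (1 - 2 * Real.pi * c * |u|) 0 with h | h
  · refine le_trans ?_ (powerSpec_nonneg D l u)
    obtain ⟨d, hd⟩ := hD
    have : 0 ≤ c := (abs_nonneg _).trans (hc d hd)
    have : 0 ≤ 2 * Real.pi * c * |u| := by positivity
    linarith
  · have h3 : (1 - 2 * Real.pi * c * |u|) ^ 2 ≤ powerSpec D l u := by
      rw [powerSpec, ← div_pow]
      gcongr
      rw [le_div_iff₀ hD0]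
      linarith
    nlinarith [sq_nonneg (2 * Real.pi * c * |u|)]

/-- The product `∏_{i ≤ k < j} f(L^k u)`. -/
noncomputable def powProd (f : ℝ → ℝ) (L i j : ℕ) (u : ℝ) : ℝ :=
  ∏ k ∈ Finset.Ico i j, f ((L : ℝ) ^ k * u)

section PowProd

variable {f : ℝ → ℝ} {L : ℕ}

theorem continuous_powProd (hf : Continuous f) (i j : ℕ) : Continuous (powProd f L i j) := by
  unfold powProd; fun_prop

theorem powProd_nonneg (h0 : ∀ u, 0 ≤ f u) (i j : ℕ) (u : ℝ) : 0 ≤ powProd f L i j u :=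
  Finset.prod_nonneg fun _ _ => h0 _

theorem powProd_le_one (h0 : ∀ u, 0 ≤ f u) (h1 : ∀ u, f u ≤ 1) (i j : ℕ) (u : ℝ) :
    powProd f L i j u ≤ 1 := Finset.prod_le_one (fun _ _ => h0 _) fun _ _ => h1 _

theorem powProd_mul {i j k : ℕ} (hij : i ≤ j) (hjk : j ≤ k) (u : ℝ) :
    powProd f L i j u * powProd f L j k u = powProd f L i k u :=
  Finset.prod_Ico_consecutive _ hij hjk

theorem powProd_le_right (h0 : ∀ u, 0 ≤ f u) (h1 : ∀ u, f u ≤ 1) {i j k : ℕ} (hij : i ≤ j)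
    (hjk : j ≤ k) (u : ℝ) : powProd f L i k u ≤ powProd f L j k u := by
  rw [← powProd_mul hij hjk]
  exact mul_le_of_le_one_left (powProd_nonneg h0 _ _ _) (powProd_le_one h0 h1 _ _ _)

theorem powProd_scale (i n : ℕ) (u : ℝ) :
    powProd f L i (i + n) u = powProd f L 0 n ((L : ℝ) ^ i * u) := by
  rw [powProd, powProd, Finset.prod_Ico_eq_prod_range, add_tsub_cancel_left,
    Finset.range_eq_Ico]
  refine Finset.prod_congr rfl fun k _ => ?_
  rw [← mul_assoc, ← pow_add, add_comm k]

theorem powProd_neg (h : ∀ u, f (-u) = f u) (i j : ℕ) (u : ℝ) :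
    powProd f L i j (-u) = powProd f L i j u := by
  unfold powProd
  simp only [mul_neg, h]

end PowProd

theorem expSum_digitSum {G : Type*} [AddCommMonoid G] [DecidableEq G] {L : ℕ} {D : Finset G}
    (l : G →+ ℝ) (hU : UniqueDigits L D) (n : ℕ) (u : ℝ) :
    expSum (digitSum L D n) l u = ∏ k ∈ Finset.range n, expSum D l ((L : ℝ) ^ k * u) := by
  induction n generalizing u with
  | zero => simp [expSum, digitSum]
  | succ n ih =>
    rw [expSum, hU.sum_add n 1, digitSum_one, Finset.prod_range_succ']
    have h := ih (L * u)
    simp only [← mul_assoc, ← pow_succ] at h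
    rw [← h, pow_zero, one_mul, expSum, expSum, Finset.sum_mul_sum]
    refine Finset.sum_congr rfl fun w _ => Finset.sum_congr rfl fun d _ => ?_
    rw [← expi_add]
    congr 1
    simp only [map_add, map_nsmul, nsmul_eq_mul, pow_one]
    ring

theorem norm_expSum_digitSum {G : Type*} [AddCommMonoid G] [DecidableEq G] {L : ℕ} {D : Finset G}
    (l : G →+ ℝ) (hU : UniqueDigits L D) (hD : D.Nonempty) (n : ℕ) (u : ℝ) :
    ‖expSum (digitSum L D n) l u‖ ^ 2 =
      ((D.card : ℝ) ^ n) ^ 2 * powProd (powerSpec D l) L 0 n u := by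
  have hD0 : (D.card : ℝ) ≠ 0 := by exact_mod_cast hD.card_pos.ne'
  rw [expSum_digitSum l hU, norm_prod, powProd, ← Finset.range_eq_Ico]
  simp only [powerSpec]
  rw [Finset.prod_div_distrib, Finset.prod_pow, Finset.prod_const, Finset.card_range,
    ← pow_mul, ← pow_mul, mul_comm n 2, mul_div_cancel₀ _ (pow_ne_zero _ hD0)]

end ExpSums

/-! ### Mean values of exponential sums -/

section Salem

variable {ι : Type*}

theorem norm_expSum_sub_sq (S : Finset ι) (l : ι → ℝ) (x y : ℝ) :
    ((‖expSum S l (x - y)‖ ^ 2 : ℝ) : ℂ) =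
      ∑ i ∈ S, ∑ j ∈ S, expi ((l i - l j) * x) * expi (-((l i - l j) * y)) := by
  rw [Complex.ofReal_pow, ← Complex.mul_conj', ← expSum_neg, expSum, expSum, Finset.sum_mul_sum]
  refine Finset.sum_congr rfl fun w _ => Finset.sum_congr rfl fun d _ => ?_
  rw [← expi_add, ← expi_add]
  congr 1
  ring

/-- The mean of `|∑ e(λ (x - y))|²` over `x, y ∈ Γ` is a sum of squares. -/
theorem integral_integral_norm_expSum_sq (S : Finset ι) (l : ι → ℝ) {Γ : Set ℝ}
    (hΓ : volume Γ ≠ ⊤) :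
    ∫ y in Γ, ∫ x in Γ, ‖expSum S l (x - y)‖ ^ 2 =
      ∑ i ∈ S, ∑ j ∈ S, ‖∫ x in Γ, expi ((l i - l j) * x)‖ ^ 2 := by
  have hint : ∀ f : ℝ → ℝ, Continuous f → IntegrableOn (fun x => expi (f x)) Γ := fun f hf =>
    Measure.integrableOn_of_bounded (M := 1) hΓ
      (by fun_prop : Continuous fun x => expi (f x)).aestronglyMeasurable
      (Filter.Eventually.of_forall fun x => (norm_expi _).le)
  apply Complex.ofReal_injective
  rw [← integral_complex_ofReal]
  have h1 : ∀ y : ℝ, ((∫ x in Γ, ‖expSum S l (x - y)‖ ^ 2 : ℝ) : ℂ) =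
      ∑ i ∈ S, ∑ j ∈ S, (∫ x in Γ, expi ((l i - l j) * x)) * expi (-((l i - l j) * y)) := by
    intro y
    rw [← integral_complex_ofReal]
    simp_rw [norm_expSum_sub_sq]
    rw [integral_finsetSum]
    · refine Finset.sum_congr rfl fun i _ => ?_
      rw [integral_finsetSum]
      · exact Finset.sum_congr rfl fun j _ => integral_mul_const _ _
      · exact fun j _ => (hint _ (by fun_prop)).mul_const _
    · exact fun i _ => integrable_finsetSum _ fun j _ => (hint _ (by fun_prop)).mul_const _
  simp_rw [h1]
  rw [integral_finsetSum]
  · rw [Complex.ofReal_sum]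
    refine Finset.sum_congr rfl fun i _ => ?_
    rw [integral_finsetSum]
    · rw [Complex.ofReal_sum]
      refine Finset.sum_congr rfl fun j _ => ?_
      rw [integral_const_mul]
      simp_rw [expi_neg]
      rw [integral_conj, Complex.ofReal_pow, ← Complex.mul_conj']
    · exact fun j _ => (hint _ (by fun_prop)).const_mul _
  · exact fun i _ => integrable_finsetSum _ fun j _ => (hint _ (by fun_prop)).const_mul _

/-- Salem's inequality: the diagonal terms `i = j` of a sum of squares. -/
theorem card_mul_sq_le_integral (S : Finset ι) (l : ι → ℝ) {Γ : Set ℝ} (hΓ : volume Γ ≠ ⊤) :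
    S.card * volume.real Γ ^ 2 ≤ ∫ y in Γ, ∫ x in Γ, ‖expSum S l (x - y)‖ ^ 2 := by
  rw [integral_integral_norm_expSum_sq S l hΓ, ← nsmul_eq_mul]
  refine Finset.card_nsmul_le_sum _ _ _ fun i hi => ?_
  refine le_trans (le_of_eq ?_) (Finset.single_le_sum (fun _ _ => by positivity) hi)
  simp

theorem exists_sum_le : ∃ C : ℝ, 0 < C ∧ ∀ T : Finset ℤ, ∑ q ∈ T, 18 / (1 + (q : ℝ) ^ 2) ≤ C := by
  have hs : Summable fun q : ℤ => 18 / (1 + (q : ℝ) ^ 2) := by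
    have h1 : Summable fun q : ℤ => 18 * (1 / (q : ℝ) ^ 2) :=
      (Real.summable_one_div_int_pow.2 (by norm_num)).mul_left 18
    refine Summable.of_norm_bounded_eventually h1 ?_
    rw [Filter.eventually_cofinite]
    refine (Set.finite_singleton (0 : ℤ)).subset fun q hq => ?_
    by_contra hq0
    apply hq
    have : (q : ℝ) ≠ 0 := by exact_mod_cast hq0
    have : 0 < (q : ℝ) ^ 2 := by positivity
    rw [Real.norm_of_nonneg (by positivity), mul_one_div]
    gcongr
    linarith
  refine ⟨∑' q : ℤ, 18 / (1 + (q : ℝ) ^ 2) + 1, ?_, fun T => ?_⟩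
  · have : 0 ≤ ∑' q : ℤ, 18 / (1 + (q : ℝ) ^ 2) := tsum_nonneg fun q => by positivity
    linarith
  · have := hs.sum_le_tsum T fun q _ => by positivity
    linarith

theorem norm_integral_expi_le (δ : ℝ) :
    ‖∫ x in Set.Icc (-1 : ℝ) 2, expi (δ * x)‖ ≤ 3 ∧
      |δ| * ‖∫ x in Set.Icc (-1 : ℝ) 2, expi (δ * x)‖ ≤ 1 := by
  constructor
  · refine (norm_setIntegral_le_of_norm_le_const (C := 1) (by simp) (by simp)).trans ?_
    rw [one_mul, Real.volume_real_Icc]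
    norm_num
  · rcases eq_or_ne δ 0 with rfl | hδ
    · simp
    rw [integral_Icc_eq_integral_Ioc, ← intervalIntegral.integral_of_le (by norm_num)]
    have hc : (2 * Real.pi * δ : ℂ) * Complex.I ≠ 0 := by
      simp [hδ, Real.pi_ne_zero]
    have : ∀ x : ℝ, expi (δ * x) = Complex.exp ((2 * Real.pi * δ : ℂ) * Complex.I * x) := by
      intro x
      rw [expi]; congr 1; push_cast; ring
    simp_rw [this]
    rw [integral_exp_mul_complex hc]
    simp_rw [← this]
    rw [norm_div, norm_mul, Complex.norm_I, mul_one]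
    have h1 : ‖(2 * Real.pi * δ : ℂ)‖ = 2 * Real.pi * |δ| := by
      rw [show (2 * Real.pi * δ : ℂ) = ((2 * Real.pi * δ : ℝ) : ℂ) by push_cast; ring,
        Complex.norm_real, Real.norm_eq_abs, abs_mul, abs_of_pos Real.two_pi_pos]
    have h2 : ‖expi (δ * (2 : ℝ)) - expi (δ * (-1 : ℝ))‖ ≤ 2 := by
      refine (norm_sub_le _ _).trans ?_
      rw [norm_expi, norm_expi]; norm_num
    have hδ' : 0 < |δ| := abs_pos.2 hδ
    rw [h1, ← mul_div_assoc, div_le_one (by positivity)]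
    have : (1 : ℝ) ≤ Real.pi := by linarith [Real.pi_gt_three]
    nlinarith

/-- The `L²` norm of an exponential sum over `[-1, 1]` is controlled by the number of pairs of close
frequencies. -/
theorem exists_integral_expSum_le : ∃ C : ℝ, 0 < C ∧ ∀ (ι : Type) (S : Finset ι) (l : ι → ℝ)
    (R : ℝ), 1 ≤ R → ∫ ξ in Set.Icc (-1 : ℝ) 1, ‖expSum S l ξ‖ ^ 2 ≤
      C * (closePairs l R S).card := by
  obtain ⟨C, hC, hC'⟩ := exists_sum_le
  refine ⟨C, hC, fun ι S l R hR => ?_⟩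
  have hR0 : 0 < R := by linarith
  have hcont : ∀ y : ℝ, Continuous fun x => ‖expSum S l (x - y)‖ ^ 2 := fun y => by fun_prop
  set Γ := Set.Icc (-1 : ℝ) 2
  set I := ∫ ξ in Set.Icc (-1 : ℝ) 1, ‖expSum S l ξ‖ ^ 2 with hI
  have hΓ : volume Γ ≠ ⊤ := by simp [Γ]
  have h1 : I ≤ ∫ y in Γ, ∫ x in Γ, ‖expSum S l (x - y)‖ ^ 2 := by
    have h2 : ∀ y ∈ Set.Icc (0 : ℝ) 1, I ≤ ∫ x in Γ, ‖expSum S l (x - y)‖ ^ 2 := by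
      intro y hy
      have e1 : I = ∫ x in (fun x => x + -y) ⁻¹' Set.Icc (-1 : ℝ) 1, ‖expSum S l (x - y)‖ ^ 2 :=
        ((measurePreserving_add_right volume (-y)).setIntegral_preimage_emb
          (measurableEmbedding_addRight (-y)) (fun ξ => ‖expSum S l ξ‖ ^ 2) _).symm
      rw [e1]
      refine setIntegral_mono_set ((hcont y).integrableOn_Icc)
        (Filter.Eventually.of_forall fun x => by positivity) (LE.le.eventuallyLE ?_)
      intro x hx
      simp only [Set.mem_preimage, Set.mem_Icc] at hx hy
      exact Set.mem_Icc.2 ⟨by linarith, by linarith⟩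
    have hcont2 : Continuous fun y => ∫ x in Γ, ‖expSum S l (x - y)‖ ^ 2 :=
      continuous_parametric_integral_of_continuous (f := fun y x => ‖expSum S l (x - y)‖ ^ 2)
        (by simp only [Function.uncurry_def]; fun_prop) isCompact_Icc
    calc I = ∫ y in Set.Icc (0 : ℝ) 1, I := by simp
      _ ≤ ∫ y in Set.Icc (0 : ℝ) 1, ∫ x in Γ, ‖expSum S l (x - y)‖ ^ 2 :=
        setIntegral_mono_on (by simp) hcont2.integrableOn_Icc measurableSet_Icc h2
      _ ≤ _ := by
        refine setIntegral_mono_set hcont2.integrableOn_Icc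
          (Filter.Eventually.of_forall fun y => integral_nonneg fun x => by positivity)
          (LE.le.eventuallyLE ?_)
        exact Set.Icc_subset_Icc (by norm_num) (by norm_num)
  refine h1.trans ?_
  rw [integral_integral_norm_expSum_sq S l hΓ, ← Finset.sum_product']
  set q : ι × ι → ℤ := fun p => ⌊l p.2 / R⌋ - ⌊l p.1 / R⌋
  have h2 : ∀ p ∈ S ×ˢ S, ‖∫ x in Γ, expi ((l p.1 - l p.2) * x)‖ ^ 2 ≤
      18 / (1 + (q p : ℝ) ^ 2) := by
    intro p _
    obtain ⟨b1, b2⟩ := norm_integral_expi_le (l p.1 - l p.2)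
    set F := ‖∫ x in Γ, expi ((l p.1 - l p.2) * x)‖
    have hF : 0 ≤ F := norm_nonneg _
    rw [le_div_iff₀ (by positivity)]
    -- the gap between the two frequencies is at least `|q| - 1`
    have h3 : |(q p : ℝ)| ≤ |l p.1 - l p.2| + 1 := by
      have f1 := Int.floor_le (l p.1 / R)
      have f2 := Int.lt_floor_add_one (l p.1 / R)
      have f3 := Int.floor_le (l p.2 / R)
      have f4 := Int.lt_floor_add_one (l p.2 / R)
      have h4 : |l p.2 / R - l p.1 / R| ≤ |l p.1 - l p.2| := by
        rw [← sub_div, abs_div, abs_of_pos hR0, abs_sub_comm]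
        exact div_le_self (abs_nonneg _) hR
      have h5 := abs_le.1 h4
      simp only [q]
      push_cast
      rw [abs_le]
      constructor <;> linarith
    have hq2 : (q p : ℝ) ^ 2 ≤ (|l p.1 - l p.2| + 1) ^ 2 := by
      rw [← sq_abs (q p : ℝ)]; gcongr
    have hF2 : F ^ 2 ≤ 9 := by nlinarith
    have h6 : (|l p.1 - l p.2| * F) ^ 2 ≤ 1 := by
      have : 0 ≤ |l p.1 - l p.2| * F := by positivity
      nlinarith
    have h7 : (|l p.1 - l p.2| * F + F) ^ 2 ≤ 16 := by
      have : 0 ≤ |l p.1 - l p.2| * F := by positivity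
      nlinarith
    rcases le_or_gt (|(q p : ℤ)|) 1 with hq | hq
    · have : (q p : ℝ) ^ 2 ≤ 1 := by
        have : |(q p : ℝ)| ≤ 1 := by exact_mod_cast hq
        rw [← sq_abs]; nlinarith [abs_nonneg (q p : ℝ)]
      nlinarith
    · have h8 : (2 : ℝ) ≤ |(q p : ℝ)| := by exact_mod_cast hq
      have h9 : 1 ≤ |l p.1 - l p.2| := by linarith
      have h10 : F ≤ 1 := by nlinarith
      nlinarith
  refine (Finset.sum_le_sum h2).trans ?_
  classical
  rw [← Finset.sum_fiberwise_of_maps_to (g := q) (t := (S ×ˢ S).image q)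
      (fun x hx => Finset.mem_image_of_mem q hx)]
  calc _ ≤ ∑ r ∈ (S ×ˢ S).image q, 18 / (1 + (r : ℝ) ^ 2) * (closePairs l R S).card := by
        refine Finset.sum_le_sum fun r _ => ?_
        rw [Finset.sum_congr rfl (g := fun _ => 18 / (1 + (r : ℝ) ^ 2)), Finset.sum_const,
          nsmul_eq_mul, mul_comm]
        · refine mul_le_mul_of_nonneg_left (Nat.cast_le.2 ?_) (by positivity)
          have h3 := (card_shift_le S (fun x => ⌊l x / R⌋) r).trans (card_sameBin_le l hR0 S)
          refine le_trans (le_of_eq (congrArg Finset.card ?_)) h3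
          refine Finset.filter_congr fun p _ => ?_
          simp only [q]
          omega
        · intro p hp
          rw [(Finset.mem_filter.1 hp).2]
    _ ≤ _ := by
      rw [← Finset.sum_mul]
      gcongr
      exact hC' _

end Salem

/-! ### Lower bounds from the roots of the generating polynomial -/

section Roots

theorem norm_pow_sub_pow_le' {x z : ℂ} (hx : ‖x‖ ≤ 1) (hz : ‖z‖ ≤ 1) (n : ℕ) :
    ‖x ^ n - z ^ n‖ ≤ n * ‖x - z‖ := by
  induction n with
  | zero => simp
  | succ n ih =>
    have : x ^ (n + 1) - z ^ (n + 1) = x ^ n * (x - z) + (x ^ n - z ^ n) * z := by ring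
    rw [this]
    refine (norm_add_le _ _).trans ?_
    rw [norm_mul, norm_mul, norm_pow]
    have h1 : ‖x‖ ^ n ≤ 1 := pow_le_one₀ (norm_nonneg _) hx
    have h2 : ‖x ^ n - z ^ n‖ * ‖z‖ ≤ ‖x ^ n - z ^ n‖ :=
      mul_le_of_le_one_right (norm_nonneg _) hz
    have h3 : ‖x‖ ^ n * ‖x - z‖ ≤ ‖x - z‖ := mul_le_of_le_one_left (norm_nonneg _) h1
    push_cast
    linarith

/-- Every positive integer divides the product of an integer prime to `L` and a power of `L`. -/
theorem exists_coprime_part (L T : ℕ) (hT : 0 < T) :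
    ∃ S i : ℕ, 0 < S ∧ Nat.Coprime S L ∧ T ∣ S * L ^ i := by
  induction T using Nat.strong_induction_on with
  | _ T ih =>
    by_cases h : Nat.Coprime T L
    · exact ⟨T, 0, hT, h, by simp⟩
    · have hg : 1 < Nat.gcd T L := by
        have := Nat.gcd_pos_of_pos_left L hT
        have : Nat.gcd T L ≠ 1 := h
        omega
      obtain ⟨T', hT'⟩ := Nat.gcd_dvd_left T L
      have hT'0 : 0 < T' := by
        rcases Nat.eq_zero_or_pos T' with h0 | h0
        · rw [h0] at hT'; omega
        · exact h0
      have hlt : T' < T := by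
        calc T' = 1 * T' := (one_mul _).symm
          _ < Nat.gcd T L * T' := Nat.mul_lt_mul_of_pos_right hg hT'0
          _ = T := hT'.symm
      obtain ⟨S, i, hS, hSL, hdvd⟩ := ih T' hlt hT'0
      refine ⟨S, i + 1, hS, hSL, ?_⟩
      rw [hT', pow_succ, ← mul_assoc, mul_comm]
      exact Nat.mul_dvd_mul hdvd (Nat.gcd_dvd_right _ _)

variable {A : Finset ℕ}

theorem genPoly_ne_zero (hA : A.Nonempty) : genPoly A ≠ 0 := by
  intro h
  have h1 : (genPoly A).eval 1 = A.card := by simp [genPoly, eval_finsetSum]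
  rw [h] at h1
  have := hA.card_pos
  simp at h1
  omega

theorem aeval_genPoly (A : Finset ℕ) (z : ℂ) : aeval z (genPoly A) = ∑ a ∈ A, z ^ a := by
  simp [genPoly]

theorem expSum_eq_aeval (A : Finset ℕ) (u : ℝ) :
    expSum A (fun a => (a : ℝ)) u = aeval (expi u) (genPoly A) := by
  rw [aeval_genPoly, expSum]
  exact Finset.sum_congr rfl fun a _ => expi_nat_mul a u

theorem cyclotomic_dvd_genPoly {z : ℂ} (hz : aeval z (genPoly A) = 0) (hfin : 0 < orderOf z) :
    cyclotomic (orderOf z) ℤ ∣ genPoly A := by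
  have hp : IsPrimitiveRoot z (orderOf z) := IsPrimitiveRoot.orderOf z
  rw [cyclotomic_eq_minpoly hp hfin]
  exact minpoly.isIntegrallyClosed_dvd (hp.isIntegral hfin) hz

/-- A lower bound for each of the factors `x - z` of a polynomial multiplies up. -/
theorem exists_prod_bound {α : Type*} (X : Set α) (f g : α → ℝ) (F : α → ℂ → ℝ)
    (hf : ∀ u, 0 ≤ f u) (hF : ∀ u z, 0 ≤ F u z) (hg : ∀ u, 0 ≤ g u) (s : Multiset ℂ)
    (h : ∀ z ∈ s, ∃ c : ℝ, 0 < c ∧ ∀ u ∈ X, c * f u ≤ F u z * g u) :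
    ∃ c : ℝ, 0 < c ∧ ∀ u ∈ X, c * f u ^ s.card ≤ (s.map (F u)).prod * g u ^ s.card := by
  induction s using Multiset.induction_on with
  | empty => exact ⟨1, one_pos, by simp⟩
  | cons z s ih =>
    obtain ⟨c, hc, h1⟩ := ih fun z hz => h z (Multiset.mem_cons_of_mem hz)
    obtain ⟨c', hc', h2⟩ := h z (Multiset.mem_cons_self z s)
    refine ⟨c' * c, by positivity, fun u hu => ?_⟩
    rw [Multiset.card_cons, Multiset.map_cons, Multiset.prod_cons, pow_succ, pow_succ]
    have h3 := mul_le_mul (h1 u hu) (h2 u hu) (mul_nonneg hc'.le (hf u))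
      (mul_nonneg (Multiset.prod_nonneg fun x hx => by
        obtain ⟨z, _, rfl⟩ := Multiset.mem_map.1 hx; exact hF u z) (pow_nonneg (hg u) _))
    linarith

/-- `|A(e(u))|²` is bounded below by a quotient `|e(S L^i u) - 1| / |e(S u) - 1|`, up to constants
and powers, on any set `X` that stays away from the roots of order prime to `L`. The products of
such quotients along `u, L u, L² u, …` telescope. -/
theorem exists_powerSpec_bound (hA : A.Nonempty) (hroots : UnitRootsAreRootsOfUnity A) {L : ℕ}
    (hL : 0 < L) (X : Set ℝ)
    (hX : ∀ z : ℂ, aeval z (genPoly A) = 0 → 0 < orderOf z → Nat.Coprime (orderOf z) L →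
      ∃ c : ℝ, 0 < c ∧ ∀ u ∈ X, c ≤ ‖expi u - z‖) :
    ∃ S i D : ℕ, ∃ c : ℝ, 0 < S ∧ 0 < i ∧ 0 < c ∧ ∀ u ∈ X,
      c * ‖expi (S * L ^ i * u) - 1‖ ^ D ≤
        powerSpec A (fun a => (a : ℝ)) u * ‖expi (S * u) - 1‖ ^ D := by
  classical
  set P : ℂ[X] := (genPoly A).map (algebraMap ℤ ℂ) with hP
  have hP0 : P ≠ 0 :=
    (Polynomial.map_ne_zero_iff (algebraMap ℤ ℂ).injective_int).2 (genPoly_ne_zero hA)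
  have hroot : ∀ z ∈ P.roots, aeval z (genPoly A) = 0 := fun z hz => by
    have := (mem_roots hP0).1 hz
    rwa [IsRoot, hP, eval_map_algebraMap] at this
  -- a common multiple of the orders of the roots on the unit circle
  set T := ∏ z ∈ P.roots.toFinset.filter (fun z => 0 < orderOf z), orderOf z with hTdef
  have hT : 0 < T := Finset.prod_pos fun z hz => (Finset.mem_filter.1 hz).2
  obtain ⟨S, i, hS, hSL, hdvd⟩ := exists_coprime_part L T hT
  have hdvd' : T ∣ S * L ^ (i + 1) := hdvd.trans (mul_dvd_mul_left _ (pow_dvd_pow _ (Nat.le_succ _)))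
  set q := L ^ (i + 1) with hq
  have hq0 : 0 < q := by positivity
  have hexp : ∀ u : ℝ, expi (S * L ^ (i + 1) * u) = expi (S * u) ^ q := fun u => by
    rw [← expi_nat_mul, hq]; congr 1; push_cast; ring
  have hexpS : ∀ u : ℝ, expi (S * u) = expi u ^ S := fun u => expi_nat_mul S u
  have hfg : ∀ u : ℝ, ‖expi (S * L ^ (i + 1) * u) - 1‖ ≤ q * ‖expi (S * u) - 1‖ := fun u => by
    have := norm_pow_sub_pow_le' (norm_expi (S * u)).le (norm_one (α := ℂ)).le q
    rwa [one_pow, ← hexp] at this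
  have hq1 : (0 : ℝ) < q := by exact_mod_cast hq0
  have hfar : ∀ z : ℂ, (∃ c : ℝ, 0 < c ∧ ∀ u ∈ X, c ≤ ‖expi u - z‖) →
      ∃ c : ℝ, 0 < c ∧ ∀ u ∈ X, c * ‖expi (S * L ^ (i + 1) * u) - 1‖ ≤
        ‖expi u - z‖ * ‖expi (S * u) - 1‖ := by
    rintro z ⟨c, hc, h⟩
    refine ⟨c / q, by positivity, fun u hu => ?_⟩
    rw [div_mul_eq_mul_div, div_le_iff₀ hq1]
    have := mul_le_mul (h u hu) (hfg u) (norm_nonneg _) (norm_nonneg _)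
    linarith
  have hz : ∀ z ∈ P.roots, ∃ c : ℝ, 0 < c ∧ ∀ u ∈ X,
      c * ‖expi (S * L ^ (i + 1) * u) - 1‖ ≤ ‖expi u - z‖ * ‖expi (S * u) - 1‖ := by
    intro z hz
    have hz0 := hroot z hz
    by_cases hn : ‖z‖ = 1
    · obtain ⟨n, hn0, hn1⟩ := hroots z hz0 hn
      have hord : 0 < orderOf z := orderOf_pos_iff.2 (isOfFinOrder_iff_pow_eq_one.2 ⟨n, hn0, hn1⟩)
      by_cases hcop : Nat.Coprime (orderOf z) L
      · exact hfar z (hX z hz0 hord hcop)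
      · have hzq : (z ^ S) ^ q = 1 := by
          rw [← pow_mul]
          refine orderOf_dvd_iff_pow_eq_one.1 ((Finset.dvd_prod_of_mem _ ?_).trans hdvd')
          exact Finset.mem_filter.2 ⟨Multiset.mem_toFinset.2 hz, hord⟩
        have hzS : z ^ S ≠ 1 := fun h =>
          hcop (Nat.Coprime.coprime_dvd_left (orderOf_dvd_iff_pow_eq_one.2 h) hSL)
        have hgeom : ∑ k ∈ Finset.range q, (z ^ S) ^ k = 0 := by
          have := mul_geom_sum (z ^ S) q
          rw [hzq, sub_self] at this
          exact (mul_eq_zero.1 this).resolve_left (sub_ne_zero.2 hzS)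
        have hS1 : (0 : ℝ) < S := by exact_mod_cast hS
        refine ⟨1 / (q * (q * S)), by positivity, fun u _ => ?_⟩
        rw [one_div_mul_eq_div, div_le_iff₀ (by positivity), hexp, ← mul_geom_sum, norm_mul]
        have hsum : ‖∑ k ∈ Finset.range q, expi (S * u) ^ k‖ ≤ q * (q * S) * ‖expi u - z‖ := by
          calc ‖∑ k ∈ Finset.range q, expi (S * u) ^ k‖
              = ‖∑ k ∈ Finset.range q, (expi (S * u) ^ k - (z ^ S) ^ k)‖ := by
                rw [Finset.sum_sub_distrib, hgeom, sub_zero]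
            _ ≤ (Finset.range q).card • (q * (S * ‖expi u - z‖)) := by
                refine norm_sum_le_of_le _ (fun k hk => ?_) |>.trans
                  (Finset.sum_le_card_nsmul _ (fun _ => (q * (S * ‖expi u - z‖) : ℝ)) _
                    fun _ _ => le_rfl)
                have h1 := norm_pow_sub_pow_le' (x := expi u) (z := z) (norm_expi _).le hn.le S
                have h2 := norm_pow_sub_pow_le' (x := expi (S * u)) (z := z ^ S) (norm_expi _).le
                  (by rw [norm_pow, hn, one_pow]) k
                rw [← hexpS] at h1
                have h3 : (k : ℝ) ≤ q := by exact_mod_cast (Finset.mem_range.1 hk).le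
                refine h2.trans ?_
                gcongr
            _ = _ := by rw [Finset.card_range, nsmul_eq_mul]; ring
        calc ‖expi (S * u) - 1‖ * ‖∑ k ∈ Finset.range q, expi (S * u) ^ k‖
            ≤ ‖expi (S * u) - 1‖ * (q * (q * S) * ‖expi u - z‖) := by gcongr
          _ = _ := by ring
    · refine hfar z ⟨|‖z‖ - 1|, abs_pos.2 (sub_ne_zero.2 hn), fun u _ => ?_⟩
      have := abs_norm_sub_norm_le z (expi u)
      rwa [norm_expi, norm_sub_rev] at this
  obtain ⟨c, hc, hbound⟩ := exists_prod_bound X (fun u => ‖expi (S * L ^ (i + 1) * u) - 1‖)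
    (fun u => ‖expi (S * u) - 1‖) (fun u z => ‖expi u - z‖) (fun _ => norm_nonneg _)
    (fun _ _ => norm_nonneg _) (fun _ => norm_nonneg _) P.roots hz
  have hev : ∀ u : ℝ, ‖expSum A (fun a => (a : ℝ)) u‖ =
      ‖P.leadingCoeff‖ * (P.roots.map fun z => ‖expi u - z‖).prod := by
    intro u
    rw [expSum_eq_aeval, ← eval_map_algebraMap, ← hP,
      (IsAlgClosed.splits P).eval_eq_prod_roots, norm_mul]
    congr 1
    induction P.roots using Multiset.induction_on with
    | empty => simp
    | cons z s ih => simp [ih]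
  have hlc : 0 < ‖P.leadingCoeff‖ := norm_pos_iff.2 (leadingCoeff_ne_zero.2 hP0)
  have hA0 : (0 : ℝ) < A.card := by exact_mod_cast hA.card_pos
  refine ⟨S, i + 1, P.roots.card * 2, (‖P.leadingCoeff‖ * c / A.card) ^ 2, hS, by omega,
    by positivity, fun u hu => ?_⟩
  rw [powerSpec, ← div_pow, pow_mul, pow_mul, ← mul_pow, ← mul_pow]
  refine pow_le_pow_left₀ (by positivity) ?_ 2
  rw [hev, div_mul_eq_mul_div, div_mul_eq_mul_div]
  refine div_le_div_of_nonneg_right ?_ hA0.le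
  have := mul_le_mul_of_nonneg_left (hbound u hu) hlc.le
  linarith

end Roots

/-! ### Cantor sets with restricted digits -/

section Gamma

/-- The points `d_1 / L + ⋯ + d_m / L^m + t / L^m` with digits `d_i ∈ {0, …, b}` and `t ∈ [0, β]`. -/
def digitCantor (L b : ℕ) (β : ℝ) : ℕ → Set ℝ
  | 0 => Set.Icc 0 β
  | m + 1 => ⋃ d ∈ Finset.range (b + 1), (fun y => (L : ℝ) * y - d) ⁻¹' digitCantor L b β m

variable {L b : ℕ} {β : ℝ}

theorem measurableSet_digitCantor (m : ℕ) : MeasurableSet (digitCantor L b β m) := by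
  induction m with
  | zero => exact measurableSet_Icc
  | succ m ih =>
    exact Finset.measurableSet_biUnion _ fun d _ =>
      ih.preimage (by fun_prop : Measurable fun y => (L : ℝ) * y - d)

theorem digitCantor_subset (hL : 0 < L) (hβ : b + β ≤ L * β) (m : ℕ) :
    digitCantor L b β m ⊆ Set.Icc 0 β := by
  induction m with
  | zero => exact subset_rfl
  | succ m ih =>
    intro y hy
    simp only [digitCantor, Set.mem_iUnion, Finset.mem_range, Set.mem_preimage, exists_prop] at hy
    obtain ⟨d, hd, hy⟩ := hy
    have h := ih hy
    rw [Set.mem_Icc] at h ⊢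
    have hL0 : (0 : ℝ) < L := by exact_mod_cast hL
    have hd' : (d : ℝ) ≤ b := by exact_mod_cast Nat.lt_succ_iff.1 hd
    have hd0 : (0 : ℝ) ≤ d := by positivity
    constructor
    · exact le_of_mul_le_mul_left (by linarith) hL0
    · exact le_of_mul_le_mul_left (by linarith) hL0

theorem volume_digitCantor (hL : 0 < L) (hβ0 : 0 ≤ β) (hβ : b + β ≤ L * β) (hβ1 : β < 1) (m : ℕ) :
    volume.real (digitCantor L b β m) = β * (((b : ℝ) + 1) / L) ^ m := by
  have hL0 : (0 : ℝ) < L := by exact_mod_cast hL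
  induction m with
  | zero => simp [digitCantor, hβ0]
  | succ m ih =>
    have hpre : ∀ d : ℕ, volume.real ((fun y => (L : ℝ) * y - d) ⁻¹' digitCantor L b β m) =
        (L : ℝ)⁻¹ * volume.real (digitCantor L b β m) := by
      intro d
      have : (fun y => (L : ℝ) * y - d) ⁻¹' digitCantor L b β m =
          (fun y => (L : ℝ) * y) ⁻¹' ((fun y => y + -(d : ℝ)) ⁻¹' digitCantor L b β m) := by
        ext y; simp [sub_eq_add_neg]
      rw [this, measureReal_def, Real.volume_preimage_mul_left hL0.ne',
        measure_preimage_add_right, ENNReal.toReal_mul, ENNReal.toReal_ofReal (abs_nonneg _),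
        abs_of_pos (inv_pos.2 hL0), measureReal_def]
    have hfin : ∀ d ∈ Finset.range (b + 1),
        volume ((fun y => (L : ℝ) * y - (d : ℕ)) ⁻¹' digitCantor L b β m) ≠ ⊤ := by
      intro d _
      refine ((measure_mono ?_).trans_lt (measure_Icc_lt_top (a := (0 : ℝ)) (b := β + d))).ne
      intro y hy
      have h1 := digitCantor_subset hL hβ m hy
      have hL1 : (1 : ℝ) ≤ L := by exact_mod_cast hL
      have hd0 : (0 : ℝ) ≤ d := by positivity
      rw [Set.mem_Icc] at h1 ⊢
      have : 0 ≤ (L : ℝ) * y := by linarith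
      have : 0 ≤ y := by by_contra! h; nlinarith
      constructor
      · assumption
      · nlinarith
    rw [digitCantor, measureReal_biUnion_finset ?_ ?_ hfin]
    · simp only [hpre]
      rw [ih, Finset.sum_const, Finset.card_range, nsmul_eq_mul, pow_succ]
      push_cast
      field_simp
    · intro d _ d' _ hne
      rw [Function.onFun, Set.disjoint_left]
      intro y hy hy'
      have h1 := digitCantor_subset hL hβ m hy
      have h2 := digitCantor_subset hL hβ m hy'
      simp only [Set.mem_Icc] at h1 h2
      have h3 : |((d : ℤ) : ℝ) - (d' : ℤ)| < 1 := by
        rw [abs_lt]; push_cast; constructor <;> linarith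
      have h4 : |(d : ℤ) - d'| < 1 := by exact_mod_cast h3
      rw [Int.abs_lt_one_iff] at h4
      omega
    · exact fun d _ => (measurableSet_digitCantor m).preimage
        (by fun_prop : Measurable fun y => (L : ℝ) * y - d)

/-- The dilates `L^k (x - y)`, `k ≤ m`, of the differences stay near the integers. -/
theorem exists_int_near (hL : 0 < L) (hβ : b + β ≤ L * β) {k m : ℕ} (hk : k ≤ m) {x y : ℝ}
    (hx : x ∈ digitCantor L b β m) (hy : y ∈ digitCantor L b β m) :
    ∃ r : ℤ, |(L : ℝ) ^ k * (x - y) - r| ≤ β := by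
  induction k generalizing m x y with
  | zero =>
    have h1 := digitCantor_subset hL hβ m hx
    have h2 := digitCantor_subset hL hβ m hy
    rw [Set.mem_Icc] at h1 h2
    refine ⟨0, ?_⟩
    rw [pow_zero, one_mul, Int.cast_zero, sub_zero, abs_le]
    constructor <;> linarith
  | succ k ih =>
    obtain ⟨m, rfl⟩ : ∃ n, m = n + 1 := ⟨m - 1, by omega⟩
    simp only [digitCantor, Set.mem_iUnion, Finset.mem_range, Set.mem_preimage,
      exists_prop] at hx hy
    obtain ⟨d, _, hx⟩ := hx
    obtain ⟨e, _, hy⟩ := hy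
    obtain ⟨r, hr⟩ := ih (by omega) hx hy
    refine ⟨r + L ^ k * (d - e), ?_⟩
    convert hr using 2
    push_cast
    ring

end Gamma

/-! ### The divisor condition -/

section Admissible

/-- The consequence of the divisor condition: the exponential sum of `A` admits a telescoping lower
bound on a set `X` that contains all dilates `L^k (x - y)`, `k < m`, of differences of points of a
large set `Γ`. -/
theorem exists_admissible {A : Finset ℕ} {b : ℕ} (hA : 2 ≤ A.card) (hb : 2 ≤ b)
    (hroots : UnitRootsAreRootsOfUnity A) (hD : DivisorCondition (A.card * b) A) :
    ∃ (X : Set ℝ) (S i D : ℕ) (c c' : ℝ), 0 < S ∧ 0 < i ∧ 0 < c ∧ 0 < c' ∧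
      (∀ u ∈ X, c * ‖expi (S * ((A.card * b : ℕ) : ℝ) ^ i * u) - 1‖ ^ D ≤
        powerSpec A (fun a => (a : ℝ)) u * ‖expi (S * u) - 1‖ ^ D) ∧
      ∀ m : ℕ, ∃ Γ ⊆ Set.Icc (0 : ℝ) 1, MeasurableSet Γ ∧
        c' * (((b : ℝ) + 1) / (A.card * b : ℕ)) ^ m ≤ volume.real Γ ∧
        ∀ x ∈ Γ, ∀ y ∈ Γ, ∀ k < m, ((A.card * b : ℕ) : ℝ) ^ k * (x - y) ∈ X := by
  set L := A.card * b with hLdef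
  have hLb : 2 * b ≤ L := Nat.mul_le_mul_right b hA
  have hL : 0 < L := by omega
  have hL0 : (0 : ℝ) < L := by exact_mod_cast hL
  have hAne : A.Nonempty := Finset.card_pos.1 (by omega)
  have hbad : ∀ z : ℂ, aeval z (genPoly A) = 0 → 0 < orderOf z → Nat.Coprime (orderOf z) L →
      orderOf z ∣ badLcm L A ∧ cyclotomic (orderOf z) ℤ ∣ genPoly A := by
    intro z hz hord hcop
    have hc := cyclotomic_dvd_genPoly hz hord
    exact ⟨((badLcm_spec L A hAne).2 _).1 dvd_rfl _ ⟨hord, hc, hcop⟩, hc⟩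
  rcases hD with h1 | ⟨s₁, s₂, hs₁, hs₂, hs, hsA, hq⟩
  · obtain ⟨S, i, D, c, hS, hi, hc, hbd⟩ := exists_powerSpec_bound hAne hroots hL Set.univ (by
      intro z hz hord hcop
      have h2 := (hbad z hz hord hcop).1
      rw [h1, Nat.dvd_one, orderOf_eq_one_iff] at h2
      rw [h2, aeval_genPoly] at hz
      have : A.card = 0 := by simpa using hz
      omega)
    refine ⟨Set.univ, S, i, D, c, 1, hS, hi, hc, one_pos, hbd, fun m => ⟨Set.Icc 0 1, subset_rfl,
      measurableSet_Icc, ?_, fun _ _ _ _ _ _ => Set.mem_univ _⟩⟩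
    rw [one_mul, Real.volume_real_Icc_of_le zero_le_one, sub_zero]
    refine pow_le_one₀ (by positivity) ((div_le_one hL0).2 ?_)
    have : b + 1 ≤ L := by omega
    exact_mod_cast this
  -- with `β = b / (L - 1)`, the largest expansion with digits at most `b`, one has `s₂ β < 1`; for
  -- `u ∈ X`, `e(s₁ u)` lies on an arc around `1` that contains no other `s₂`-th root of unity
  · set β : ℝ := b / (L - 1) with hβdef
    have hL1 : (0 : ℝ) < L - 1 := by
      have : (2 : ℝ) ≤ L := by exact_mod_cast (by omega : 2 ≤ L)
      linarith
    have hb0 : (0 : ℝ) < b := by exact_mod_cast (by omega : 0 < b)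
    have hβ0 : 0 < β := by positivity
    have hβ : b + β ≤ L * β := by
      have : (L - 1) * β = b := by rw [hβdef]; field_simp
      linarith
    have hs2β : s₂ * β < 1 := by
      rw [hβdef, ← mul_div_assoc, div_lt_one hL1]
      have h2 : (s₂ + 1) * b ≤ L := Nat.mul_le_mul_right b hsA
      have h3 : ((s₂ : ℝ) + 1) * b ≤ L := by exact_mod_cast h2
      have h4 : (2 : ℝ) ≤ b := by exact_mod_cast hb
      linarith
    have hs20 : (1 : ℝ) < s₂ := by exact_mod_cast hs₂
    have hs10 : (1 : ℝ) < s₁ := by exact_mod_cast hs₁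
    have hβ1 : β < 1 := by nlinarith
    set X : Set ℝ := {u | ∃ r : ℤ, |s₁ * u - r| ≤ β} with hX
    obtain ⟨S, i, D, c, hS, hi, hc, hbd⟩ := exists_powerSpec_bound hAne hroots hL X (by
      intro z hz hord hcop
      obtain ⟨hdvd, hcyc⟩ := hbad z hz hord hcop
      have hz1 : z ^ s₁ ≠ 1 := fun h => hq _ (orderOf_dvd_iff_pow_eq_one.2 h) hcyc
      have hz2 : (z ^ s₁) ^ s₂ = 1 := by
        rw [← pow_mul, ← hs]; exact orderOf_dvd_iff_pow_eq_one.1 hdvd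
      have hzn : ‖z‖ = 1 := (isOfFinOrder_iff_pow_eq_one.2
        ⟨orderOf z, hord, pow_orderOf_eq_one z⟩).norm_eq_one
      obtain ⟨δ, hδ, hmin⟩ := (isCompact_Icc (a := -β) (b := β)).exists_isMinOn
        ⟨0, by constructor <;> linarith⟩
        (by fun_prop : Continuous fun δ => ‖expi δ - z ^ s₁‖).continuousOn
      have hpos : 0 < ‖expi δ - z ^ s₁‖ := by
        rw [norm_pos_iff, sub_ne_zero]
        intro heq
        have h2 : expi (s₂ * δ) = 1 := by rw [expi_nat_mul, heq, hz2]
        rw [expi, Complex.exp_eq_one_iff] at h2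
        obtain ⟨n, hn⟩ := h2
        have h3 : (2 * Real.pi * (s₂ * δ) : ℝ) = n * (2 * Real.pi) := by
          have : ((2 * Real.pi * (s₂ * δ) : ℝ) : ℂ) * Complex.I =
            ((n * (2 * Real.pi) : ℝ) : ℂ) * Complex.I := by
              rw [hn]; push_cast; ring
          exact_mod_cast mul_right_cancel₀ Complex.I_ne_zero this
        have h4 : s₂ * δ = n := by
          have := Real.two_pi_pos
          refine mul_left_cancel₀ this.ne' ?_
          linarith
        have h5 : |(n : ℝ)| < 1 := by
          rw [← h4, abs_mul, Nat.abs_cast]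
          refine lt_of_le_of_lt ?_ hs2β
          gcongr
          exact abs_le.2 hδ
        have h6 : n = 0 := by
          rw [← Int.abs_lt_one_iff]; exact_mod_cast h5
        have h7 : δ = 0 := by
          rw [h6, Int.cast_zero] at h4
          exact (mul_eq_zero.1 h4).resolve_left (by linarith)
        rw [h7, expi_zero] at heq
        exact hz1 heq.symm
      refine ⟨‖expi δ - z ^ s₁‖ / s₁, by positivity, ?_⟩
      rintro u ⟨r, hr⟩
      rw [div_le_iff₀ (by linarith), mul_comm]
      refine le_trans ?_ (norm_pow_sub_pow_le' (norm_expi u).le hzn.le s₁)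
      have h2 : expi u ^ s₁ = expi (s₁ * u - r) := by
        rw [← expi_nat_mul, sub_eq_add_neg, expi_add, expi_neg, expi_intCast, map_one, mul_one]
      rw [h2]
      exact hmin (abs_le.1 hr))
    refine ⟨X, S, i, D, c, β / s₁, hS, hi, hc, by positivity, hbd, fun m =>
      ⟨(fun x => (s₁ : ℝ) * x) ⁻¹' digitCantor L b β m, ?_, ?_, ?_, ?_⟩⟩
    · intro x hx
      have h2 := digitCantor_subset hL hβ m hx
      rw [Set.mem_Icc] at h2 ⊢
      constructor
      · by_contra! h; nlinarith
      · by_contra! h; nlinarith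
    · exact (measurableSet_digitCantor m).preimage (by fun_prop)
    · rw [measureReal_def, Real.volume_preimage_mul_left (by linarith), ENNReal.toReal_mul,
        ENNReal.toReal_ofReal (abs_nonneg _), abs_of_pos (by positivity), ← measureReal_def,
        volume_digitCantor hL hβ0.le hβ hβ1]
      apply le_of_eq
      field_simp
    · intro x hx y hy k hk
      obtain ⟨r, hr⟩ := exists_int_near hL hβ hk.le hx hy
      refine ⟨r, ?_⟩
      convert hr using 2
      ring

end Admissible

/-! ### Telescoping products -/

section Telescope

/-- Telescoping of the lower bounds of `exists_admissible` along `u, L u, …, L^{m-1} u`. -/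
theorem le_powProd {f : ℝ → ℝ} (h0 : ∀ u, 0 ≤ f u) {X : Set ℝ} {L S i D : ℕ} {c : ℝ}
    (hc : 0 ≤ c) (hi : 0 < i)
    (hX : ∀ u ∈ X, c * ‖expi (S * (L : ℝ) ^ i * u) - 1‖ ^ D ≤ f u * ‖expi (S * u) - 1‖ ^ D)
    (m : ℕ) {u : ℝ} (hu : ∀ k < m, (L : ℝ) ^ k * u ∈ X) :
    c ^ m * ∏ k ∈ Finset.range i, ‖expi (S * (L : ℝ) ^ (m + k) * u) - 1‖ ^ D ≤
      powProd f L 0 m u * ∏ k ∈ Finset.range i, ‖expi (S * (L : ℝ) ^ k * u) - 1‖ ^ D := by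
  induction m with
  | zero => simp [powProd]
  | succ m ih =>
    obtain ⟨i, rfl⟩ : ∃ j, i = j + 1 := ⟨i - 1, by omega⟩
    have h1 := ih fun k hk => hu k (by omega)
    have h2 := hX _ (hu m (by omega))
    rw [← mul_assoc, ← mul_assoc, mul_assoc (S : ℝ), ← pow_add] at h2
    rw [Finset.prod_range_succ' _ i] at h1
    have e1 : ∏ k ∈ Finset.range i, ‖expi (S * (L : ℝ) ^ (m + (k + 1)) * u) - 1‖ ^ D =
        ∏ k ∈ Finset.range i, ‖expi (S * (L : ℝ) ^ (m + 1 + k) * u) - 1‖ ^ D := by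
      refine Finset.prod_congr rfl fun k _ => ?_
      rw [show m + (k + 1) = m + 1 + k by ring]
    rw [e1] at h1
    rw [Finset.prod_range_succ _ i, show m + 1 + i = i + 1 + m by ring]
    have e2 : powProd f L 0 (m + 1) u = powProd f L 0 m u * f ((L : ℝ) ^ m * u) :=
      Finset.prod_Ico_succ_top (Nat.zero_le m) _
    rw [e2]
    set p := ∏ k ∈ Finset.range i, ‖expi (S * (L : ℝ) ^ (m + 1 + k) * u) - 1‖ ^ D
    have hp : 0 ≤ p := Finset.prod_nonneg fun _ _ => by positivity
    have h3 := mul_le_mul_of_nonneg_left h2 (mul_nonneg (pow_nonneg hc m) hp)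
    have h4 := mul_le_mul_of_nonneg_left h1 (h0 ((L : ℝ) ^ m * u))
    rw [add_zero] at h4
    rw [pow_succ c]
    linarith

/-- Away from the points where `S L^{m+i} u` is nearly an integer, the product of `m` factors is at
least exponentially small. -/
theorem le_powProd_of_far {f : ℝ → ℝ} (h0 : ∀ u, 0 ≤ f u) {X : Set ℝ} {L S i D : ℕ} {c : ℝ}
    (hc : 0 ≤ c) (hi : 0 < i) (hL : 0 < L)
    (hX : ∀ u ∈ X, c * ‖expi (S * (L : ℝ) ^ i * u) - 1‖ ^ D ≤ f u * ‖expi (S * u) - 1‖ ^ D)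
    (m : ℕ) {u : ℝ} (hu : ∀ k < m, (L : ℝ) ^ k * u ∈ X) {h : ℝ} (hh : 0 ≤ h)
    (hfar : h ≤ ‖expi (S * (L : ℝ) ^ (m + i) * u) - 1‖) :
    c ^ m * (h / (L : ℝ) ^ i / 2) ^ (D * i) ≤ powProd f L 0 m u := by
  have h1 := le_powProd h0 hc hi hX m hu
  have hL1 : (1 : ℝ) ≤ L := by exact_mod_cast hL
  have h2 : ∏ k ∈ Finset.range i, ‖expi (S * (L : ℝ) ^ k * u) - 1‖ ^ D ≤ 2 ^ (D * i) := by
    calc _ ≤ ∏ k ∈ Finset.range i, (2 : ℝ) ^ D := by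
          refine Finset.prod_le_prod (fun _ _ => by positivity) fun k _ => ?_
          gcongr
          refine (norm_sub_le _ _).trans ?_
          rw [norm_expi, norm_one]; norm_num
      _ = _ := by rw [Finset.prod_const, Finset.card_range, ← pow_mul]
  have h3 : (h / (L : ℝ) ^ i) ^ (D * i) ≤
      ∏ k ∈ Finset.range i, ‖expi (S * (L : ℝ) ^ (m + k) * u) - 1‖ ^ D := by
    calc _ = ∏ k ∈ Finset.range i, ((h / (L : ℝ) ^ i) ^ D) := by
          rw [Finset.prod_const, Finset.card_range, ← pow_mul]
      _ ≤ _ := by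
        refine Finset.prod_le_prod (fun _ _ => by positivity) fun k hk => ?_
        gcongr
        rw [div_le_iff₀ (by positivity), mul_comm]
        have h4 := norm_pow_sub_pow_le' (norm_expi (S * (L : ℝ) ^ (m + k) * u)).le
          (norm_one (α := ℂ)).le (L ^ (i - k))
        rw [one_pow, ← expi_nat_mul] at h4
        have hk' := Finset.mem_range.1 hk
        have h5 : ((L ^ (i - k) : ℕ) : ℝ) * (S * (L : ℝ) ^ (m + k) * u) =
            S * (L : ℝ) ^ (m + i) * u := by
          rw [show m + i = (i - k) + (m + k) by omega, pow_add (L : ℝ) (i - k)]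
          push_cast
          ring
        rw [h5] at h4
        refine hfar.trans (h4.trans ?_)
        push_cast
        gcongr
        omega
  have h4 := powProd_nonneg h0 (L := L) 0 m u
  rw [div_pow _ 2, ← mul_div_assoc, div_le_iff₀ (by positivity)]
  calc _ ≤ _ := mul_le_mul_of_nonneg_left h3 (pow_nonneg hc m)
    _ ≤ _ := h1
    _ ≤ _ := mul_le_mul_of_nonneg_left h2 h4

end Telescope

/-! ### Vanishing sums of roots of unity -/

section VanishingSums

variable {A C : Finset ℕ} {s p : ℕ} {z : ℂ}

theorem sum_pow_eq_zero (hs : 0 < s) (h : cyclotomic s ℤ ∣ genPoly A) (hz : IsPrimitiveRoot z s) :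
    ∑ a ∈ A, z ^ a = 0 := by
  obtain ⟨g, hg⟩ := h
  have : aeval z (cyclotomic s ℤ) = 0 := by
    have : NeZero (s : ℂ) := ⟨by exact_mod_cast hs.ne'⟩
    rw [aeval_def, eval₂_eq_eval_map, map_cyclotomic]
    exact isRoot_cyclotomic_iff.2 hz
  rw [← aeval_genPoly, hg, map_mul, this, zero_mul]

theorem dvd_genPoly_of_sum (hs : 0 < s) (hz : IsPrimitiveRoot z s) (h : ∑ a ∈ A, z ^ a = 0) :
    cyclotomic s ℤ ∣ genPoly A := by
  rw [← aeval_genPoly] at h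
  rw [hz.eq_orderOf] at hs ⊢
  exact cyclotomic_dvd_genPoly h hs

theorem exists_primitive (hs : 0 < s) : ∃ z : ℂ, IsPrimitiveRoot z s :=
  ⟨_, Complex.isPrimitiveRoot_exp s hs.ne'⟩

theorem pow_eq_pow_iff_dvd (hz : IsPrimitiveRoot z s) (hs : 0 < s) (a b : ℕ) :
    z ^ a = z ^ b ↔ (s : ℤ) ∣ a - b := by
  have : IsUnit z := hz.isUnit hs.ne'
  have hz0 : z ≠ 0 := this.ne_zero
  rw [← hz.zpow_eq_one_iff_dvd, zpow_sub₀ hz0, div_eq_one_iff_eq (zpow_ne_zero _ hz0)]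
  simp

theorem norm_primitive (hz : IsPrimitiveRoot z s) (hs : 0 < s) : ‖z‖ = 1 :=
  hz.norm'_eq_one hs.ne'

/-- Fourier inversion on `ℤ/p`: the sum over a residue class in terms of twisted sums. -/
theorem sum_twist {ω : ℂ} (hω : IsPrimitiveRoot ω p) (A : Finset ℕ) (z : ℂ) (r : ℕ)
    (hr : r < p) :
    ∑ j ∈ Finset.range p, (ω ^ (p - r)) ^ j * ∑ a ∈ A, (z * ω ^ j) ^ a =
      p * ∑ a ∈ A.filter (fun a => a % p = r), z ^ a := by
  simp_rw [Finset.mul_sum]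
  rw [Finset.sum_comm, Finset.sum_filter]
  refine Finset.sum_congr rfl fun a _ => ?_
  have h1 : ∀ j, (ω ^ (p - r)) ^ j * (z * ω ^ j) ^ a = z ^ a * (ω ^ (p - r + a)) ^ j := by
    intro j; rw [mul_pow, pow_add, mul_pow, ← pow_mul ω j a, ← pow_mul ω a j, mul_comm j a]; ring
  simp_rw [h1]
  rw [← Finset.mul_sum]
  have h2 : ω ^ (p - r + a) = 1 ↔ a % p = r := by
    rw [hω.pow_eq_one_iff_dvd]
    constructor
    · rintro ⟨k, hk⟩
      have : a + p = r + p * k := by omega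
      rw [← Nat.add_mod_right, this, Nat.add_mul_mod_self_left, Nat.mod_eq_of_lt hr]
    · intro h
      have := Nat.div_add_mod a p
      refine ⟨a / p + 1, ?_⟩
      rw [mul_add, mul_one]
      omega
  split_ifs with h
  · rw [h2.2 h]; simp [mul_comm]
  · have hne : ω ^ (p - r + a) - 1 ≠ 0 := sub_ne_zero.2 (mt h2.1 h)
    have := mul_geom_sum (ω ^ (p - r + a)) p
    rw [← pow_mul, mul_comm _ p, pow_mul, hω.pow_eq_one, one_pow, sub_self] at this
    rw [(mul_eq_zero.1 this).resolve_left hne, mul_zero]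

/-- If `p² ∣ s`, or if `A` misses a residue class mod `p`, then a vanishing sum of `s`-th roots of
unity over `A` splits into vanishing sums over the residue classes mod `p`. The Galois conjugates
`z ω^j`, with `ω` of order `p`, of a primitive root `z` are again primitive roots, with at most one
exception `j`. -/
theorem cyclotomic_dvd_class (hs : 0 < s) (hp : p.Prime) (hps : p ∣ s)
    (h : cyclotomic s ℤ ∣ genPoly A)
    (hcase : p ^ 2 ∣ s ∨ ∃ r < p, ∀ a ∈ A, a % p ≠ r) (r : ℕ) (hr : r < p) :
    cyclotomic s ℤ ∣ genPoly (A.filter fun a => a % p = r) := by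
  obtain ⟨z, hz⟩ := exists_primitive hs
  obtain ⟨t, rfl⟩ := hps
  have ht : 0 < t := Nat.pos_of_ne_zero fun h => by simp [h] at hs
  have hω : IsPrimitiveRoot (z ^ t) p := hz.pow hs (mul_comm _ _)
  refine dvd_genPoly_of_sum hs hz ?_
  have hF : ∀ j, ¬ p ∣ 1 + t * j → ∑ a ∈ A, (z * (z ^ t) ^ j) ^ a = 0 := by
    intro j hj
    refine sum_pow_eq_zero hs h ?_
    rw [← pow_mul, ← pow_succ', add_comm]
    refine hz.pow_of_coprime _ (Nat.Coprime.mul_right ?_ ?_)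
    · exact ((Nat.Prime.coprime_iff_not_dvd hp).2 hj).symm
    · simp
  have hp0 : (p : ℂ) ≠ 0 := by exact_mod_cast hp.ne_zero
  have hinv := fun r hr => sum_twist hω A z r hr
  by_cases hpt : p ∣ t
  · have h0 : ∀ j, ∑ a ∈ A, (z * (z ^ t) ^ j) ^ a = 0 := fun j => hF j fun hd => by
      have := (Nat.dvd_add_left (hpt.mul_right j)).1 hd
      exact hp.one_lt.ne' (Nat.dvd_one.1 this)
    have h1 := hinv r hr
    simp only [h0, mul_zero, Finset.sum_const_zero] at h1
    exact (mul_eq_zero.1 h1.symm).resolve_left hp0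
  · obtain ⟨r₀, hr₀, hemp⟩ := hcase.resolve_left fun hd => hpt (by
      rw [pow_two] at hd
      exact Nat.dvd_of_mul_dvd_mul_left hp.pos hd)
    -- at most one `j < p` has `p ∣ 1 + t j`
    have huniq : ∀ j < p, ∀ j' < p, p ∣ 1 + t * j → p ∣ 1 + t * j' → j = j' := by
      intro j hj j' hj' h1 h2
      have h3 : 1 + t * j ≡ 1 + t * j' [MOD p] :=
        (Nat.modEq_zero_iff_dvd.2 h1).trans (Nat.modEq_zero_iff_dvd.2 h2).symm
      have h4 := Nat.ModEq.add_left_cancel' 1 h3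
      have h5 := Nat.ModEq.cancel_left_of_coprime ((Nat.Prime.coprime_iff_not_dvd hp).2 hpt) h4
      exact Nat.ModEq.eq_of_lt_of_lt h5 hj hj'
    by_cases hex : ∃ j₀ < p, p ∣ 1 + t * j₀
    · obtain ⟨j₀, hj₀, hd⟩ := hex
      have hsingle : ∀ r, r < p → ((z ^ t) ^ (p - r)) ^ j₀ * ∑ a ∈ A, (z * (z ^ t) ^ j₀) ^ a =
          p * ∑ a ∈ A.filter (fun a => a % p = r), z ^ a := by
        intro r hr
        rw [← hinv r hr, Finset.sum_eq_single_of_mem j₀ (Finset.mem_range.2 hj₀)]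
        intro j hj hne
        rw [hF j fun hd' => hne (huniq j (Finset.mem_range.1 hj) j₀ hj₀ hd' hd), mul_zero]
      have h0 := hsingle r₀ hr₀
      rw [Finset.filter_false_of_mem hemp, Finset.sum_empty, mul_zero] at h0
      have hz0 : z ≠ 0 := (hz.isUnit hs.ne').ne_zero
      have h2 := (mul_eq_zero.1 h0).resolve_left (pow_ne_zero _ (pow_ne_zero _ (pow_ne_zero _ hz0)))
      have h1 := hsingle r hr
      rw [h2, mul_zero] at h1
      exact (mul_eq_zero.1 h1.symm).resolve_left hp0
    · have h1 := hinv r hr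
      rw [Finset.sum_eq_zero] at h1
      · exact (mul_eq_zero.1 h1.symm).resolve_left hp0
      · intro j hj
        rw [hF j fun hd => hex ⟨j, Finset.mem_range.1 hj, hd⟩, mul_zero]

theorem sum_pow_class {r : ℕ} (hA : ∀ a ∈ A, a % p = r) (z : ℂ) :
    ∑ a ∈ A, z ^ a = z ^ r * ∑ b ∈ A.image (· / p), (z ^ p) ^ b := by
  rw [Finset.sum_image, Finset.mul_sum]
  · refine Finset.sum_congr rfl fun a ha => ?_
    rw [← pow_mul, ← pow_add, add_comm, ← hA a ha, Nat.div_add_mod]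
  · intro a ha b hb hab
    rw [← Nat.div_add_mod a p, ← Nat.div_add_mod b p, hA a ha, hA b hb]
    rw [show a / p = b / p from hab]

theorem card_image_class {r : ℕ} (hA : ∀ a ∈ A, a % p = r) : (A.image (· / p)).card = A.card := by
  refine Finset.card_image_of_injOn fun a ha b hb hab => ?_
  rw [← Nat.div_add_mod a p, ← Nat.div_add_mod b p, hA a ha, hA b hb]
  rw [show a / p = b / p from hab]

/-- If `A` lies in one residue class mod `p ∣ s`, the order `s` may be lowered to `s / p`. -/
theorem cyclotomic_dvd_iff_class {r t : ℕ} (hp : 0 < p) (ht : 0 < t) (hA : ∀ a ∈ A, a % p = r) :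
    cyclotomic (p * t) ℤ ∣ genPoly A ↔ cyclotomic t ℤ ∣ genPoly (A.image (· / p)) := by
  have hs : 0 < p * t := Nat.mul_pos hp ht
  obtain ⟨z, hz⟩ := exists_primitive hs
  have hzp : IsPrimitiveRoot (z ^ p) t := hz.pow hs rfl
  have hz0 : z ≠ 0 := (hz.isUnit hs.ne').ne_zero
  have hsum := sum_pow_class hA z
  constructor
  · intro h
    rw [sum_pow_eq_zero hs h hz] at hsum
    exact dvd_genPoly_of_sum ht hzp ((mul_eq_zero.1 hsum.symm).resolve_left (pow_ne_zero _ hz0))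
  · intro h
    rw [sum_pow_eq_zero ht h hzp, mul_zero] at hsum
    exact dvd_genPoly_of_sum hs hz hsum

theorem card_ne_one (hs : 0 < s) (h : cyclotomic s ℤ ∣ genPoly A) : A.card ≠ 1 := by
  intro h1
  obtain ⟨a, rfl⟩ := Finset.card_eq_one.1 h1
  obtain ⟨z, hz⟩ := exists_primitive hs
  have := sum_pow_eq_zero hs h hz
  rw [Finset.sum_singleton] at this
  exact pow_ne_zero _ (hz.isUnit hs.ne').ne_zero this

end VanishingSums

/-! ### Sets with at most six elements -/

section SmallSets

variable {A C : Finset ℕ} {s p : ℕ} {z : ℂ}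

/-- Two roots of unity with sum zero are antipodal. -/
theorem pair_relation {a b : ℕ} (hs : 0 < s) (hab : a ≠ b)
    (h : cyclotomic s ℤ ∣ genPoly {a, b}) : (s : ℤ) ∣ 2 * (a - b) ∧ ¬ (s : ℤ) ∣ a - b := by
  obtain ⟨z, hz⟩ := exists_primitive hs
  have h1 := sum_pow_eq_zero hs h hz
  rw [Finset.sum_pair hab] at h1
  have h2 : z ^ a = -z ^ b := eq_neg_of_add_eq_zero_left h1
  have hz0 : z ≠ 0 := (hz.isUnit hs.ne').ne_zero
  constructor
  · have h3 : z ^ (2 * a) = z ^ (2 * b) := by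
      rw [mul_comm 2, mul_comm 2, pow_mul, pow_mul, h2, neg_sq]
    have := (pow_eq_pow_iff_dvd hz hs _ _).1 h3
    push_cast at this
    rwa [mul_sub]
  · intro hd
    have h3 := (pow_eq_pow_iff_dvd hz hs _ _).2 hd
    rw [h3] at h1
    have : z ^ b = 0 := by linear_combination h1 / 2
    exact pow_ne_zero _ hz0 this

theorem cube_eq_of_sum_eq_zero {u v w : ℂ} (hu : ‖u‖ = 1) (hv : ‖v‖ = 1) (hw : ‖w‖ = 1)
    (h : u + v + w = 0) : u ^ 3 = v ^ 3 ∧ u ≠ v := by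
  have conj_inv : ∀ x : ℂ, ‖x‖ = 1 → x * (starRingEnd ℂ) x = 1 := fun x hx => by
    rw [Complex.mul_conj', hx]; simp
  have h1 := congrArg (starRingEnd ℂ) h
  simp only [map_add, map_zero] at h1
  have hu1 := conj_inv u hu
  have hv1 := conj_inv v hv
  have hw1 := conj_inv w hw
  have hw2 : w = -(u + v) := by linear_combination h
  have e1 : u * v + u * w + v * w = 0 := by
    linear_combination (u * v * w) * h1 - v * w * hu1 - u * w * hv1 - u * v * hw1
  have e2 : u ^ 2 + u * v + v ^ 2 = 0 := by
    rw [hw2] at e1; linear_combination -e1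
  constructor
  · linear_combination (u - v) * e2
  · rintro rfl
    have : u ^ 2 = 0 := by linear_combination e2 / 3
    have hu0 : u = 0 := pow_eq_zero_iff (two_ne_zero) |>.1 this
    rw [hu0, norm_zero] at hu
    exact zero_ne_one hu

/-- Three roots of unity with sum zero differ by cube roots of unity. -/
theorem triple_relation (hs : 0 < s) (hA : A.card = 3) (h : cyclotomic s ℤ ∣ genPoly A) {a b : ℕ}
    (ha : a ∈ A) (hb : b ∈ A) (hab : a ≠ b) : (s : ℤ) ∣ 3 * (a - b) ∧ ¬ (s : ℤ) ∣ a - b := by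
  obtain ⟨z, hz⟩ := exists_primitive hs
  have h1 := sum_pow_eq_zero hs h hz
  have hn : ∀ k : ℕ, ‖z ^ k‖ = 1 := fun k => by rw [norm_pow, norm_primitive hz hs, one_pow]
  have hcard : ((A.erase a).erase b).card = 1 := by
    rw [Finset.card_erase_of_mem (Finset.mem_erase.2 ⟨hab.symm, hb⟩),
      Finset.card_erase_of_mem ha, hA]
  obtain ⟨c, hc⟩ := Finset.card_eq_one.1 hcard
  rw [← Finset.add_sum_erase A _ ha,
    ← Finset.add_sum_erase (A.erase a) _ (Finset.mem_erase.2 ⟨hab.symm, hb⟩), hc,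
    Finset.sum_singleton, ← add_assoc] at h1
  obtain ⟨h2, h3⟩ := cube_eq_of_sum_eq_zero (hn a) (hn b) (hn c) h1
  constructor
  · rw [← pow_mul, ← pow_mul, mul_comm a, mul_comm b, pow_eq_pow_iff_dvd hz hs] at h2
    push_cast at h2
    rwa [mul_sub]
  · rwa [Ne, pow_eq_pow_iff_dvd hz hs] at h3

theorem not_coprime_of_relation {n : ℕ} {d : ℤ} (h : (s : ℤ) ∣ n * d ∧ ¬ (s : ℤ) ∣ d) :
    ¬ Nat.Coprime s n := fun hc =>
  h.2 (IsCoprime.dvd_of_dvd_mul_left (Nat.isCoprime_iff_coprime.2 hc) h.1)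

theorem two_dvd_of_pair (hs : 0 < s) (hA : A.card = 2) (h : cyclotomic s ℤ ∣ genPoly A) :
    2 ∣ s := by
  obtain ⟨a, b, hab, rfl⟩ := Finset.card_eq_two.1 hA
  have := not_coprime_of_relation (n := 2) (by exact_mod_cast pair_relation hs hab h)
  by_contra h2
  exact this ((Nat.Prime.coprime_iff_not_dvd Nat.prime_two).2 h2).symm

theorem three_dvd_of_triple (hs : 0 < s) (hA : A.card = 3) (h : cyclotomic s ℤ ∣ genPoly A) :
    3 ∣ s := by
  obtain ⟨a, b, c, hab, -, -, rfl⟩ := Finset.card_eq_three.1 hA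
  have := not_coprime_of_relation (n := 3)
    (by exact_mod_cast triple_relation hs hA h (a := a) (b := b) (by simp) (by simp) hab)
  by_contra h2
  exact this ((Nat.Prime.coprime_iff_not_dvd Nat.prime_three).2 h2).symm

theorem ne_prime_of_coprime (hA : A.Nonempty) (hcop : Nat.Coprime s A.card)
    (h : cyclotomic s ℤ ∣ genPoly A) : s ≠ 1 ∧ ¬ s.Prime := by
  have hev : (genPoly A).eval 1 = A.card := by simp [genPoly, eval_finsetSum]
  have hd := eval_dvd (x := 1) h
  rw [hev] at hd
  constructor
  · rintro rfl
    rw [cyclotomic_one] at hd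
    simp at hd
    exact hA.ne_empty hd
  · intro hp
    have : Fact s.Prime := ⟨hp⟩
    rw [eval_one_cyclotomic_prime] at hd
    have hd' : s ∣ A.card := by exact_mod_cast hd
    exact hp.one_lt.ne' (Nat.Coprime.eq_one_of_dvd hcop hd')

/-- Splitting into residue classes mod `p` produces either a vanishing sum with at most half as
many terms, or one class only. -/
theorem exists_half_or_class (hs : 0 < s) (hp : p.Prime) (hps : p ∣ s) (hA : A.Nonempty)
    (h : cyclotomic s ℤ ∣ genPoly A) (hcase : p ^ 2 ∣ s ∨ A.card < p) :
    (∃ C ⊆ A, C.Nonempty ∧ 2 * C.card ≤ A.card ∧ cyclotomic s ℤ ∣ genPoly C) ∨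
      ∃ r, ∀ a ∈ A, a % p = r := by
  have hcls : ∀ r < p, cyclotomic s ℤ ∣ genPoly (A.filter fun a => a % p = r) := by
    refine cyclotomic_dvd_class hs hp hps h (hcase.imp_right fun hlt => ?_)
    by_contra! hall
    have : (Finset.range p) ⊆ A.image (· % p) := fun r hr => by
      obtain ⟨a, ha, har⟩ := hall r (Finset.mem_range.1 hr)
      exact Finset.mem_image.2 ⟨a, ha, har⟩
    have := (Finset.card_le_card this).trans Finset.card_image_le
    rw [Finset.card_range] at this
    omega
  obtain ⟨a, ha⟩ := hA
  by_cases hone : ∀ b ∈ A, b % p = a % p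
  · exact Or.inr ⟨_, hone⟩
  push Not at hone
  obtain ⟨b, hb, hab⟩ := hone
  left
  have hdisj : Disjoint (A.filter fun c => c % p = a % p) (A.filter fun c => c % p = b % p) := by
    rw [Finset.disjoint_filter]
    intro c _ h1 h2
    exact hab (h2.symm.trans h1)
  have hcard := Finset.card_le_card (Finset.union_subset
    (Finset.filter_subset (fun c => c % p = a % p) A)
    (Finset.filter_subset (fun c => c % p = b % p) A))
  rw [Finset.card_union_of_disjoint hdisj] at hcard
  by_cases hle : 2 * (A.filter fun c => c % p = a % p).card ≤ A.card
  · exact ⟨A.filter fun c => c % p = a % p, Finset.filter_subset _ _,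
      ⟨a, Finset.mem_filter.2 ⟨ha, rfl⟩⟩, hle,
      hcls _ (Nat.mod_lt _ hp.pos)⟩
  · exact ⟨A.filter fun c => c % p = b % p, Finset.filter_subset _ _,
      ⟨b, Finset.mem_filter.2 ⟨hb, rfl⟩⟩, by omega,
      hcls _ (Nat.mod_lt _ hp.pos)⟩

theorem image_card_of_class {r : ℕ} (h : ∀ a ∈ A, a % p = r) (hps : p ∣ s) (hs : 0 < s)
    (hp : 0 < p) (hd : cyclotomic s ℤ ∣ genPoly A) :
    (A.image (· / p)).card = A.card ∧ cyclotomic (s / p) ℤ ∣ genPoly (A.image (· / p)) := by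
  obtain ⟨t, rfl⟩ := hps
  rw [Nat.mul_div_cancel_left _ hp]
  exact ⟨card_image_class h,
    (cyclotomic_dvd_iff_class hp (Nat.pos_of_ne_zero fun h => by simp [h] at hs) h).1 hd⟩

/-- Four or six `s`-th roots of unity, with `s` prime to their number, have nonzero sum. -/
theorem not_dvd_of_card_four_six (s : ℕ) (A : Finset ℕ) (hs : 0 < s) (hA : A.card = 4 ∨ A.card = 6)
    (hcop : Nat.Coprime s A.card) : ¬ cyclotomic s ℤ ∣ genPoly A := by
  induction s using Nat.strong_induction_on generalizing A with
  | _ s ih =>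
    intro h
    have hne : A.Nonempty := Finset.card_pos.1 (by omega)
    obtain ⟨h1, hpr⟩ := ne_prime_of_coprime hne hcop h
    have h2 : ¬ 2 ∣ s := fun hd => by
      have := Nat.dvd_gcd hd (show 2 ∣ A.card by omega)
      rw [hcop] at this
      omega
    -- a prime factor `p` of `s` with `p² ∣ s` or `p > |A|`
    obtain ⟨p, hp, hps, hcase⟩ : ∃ p, p.Prime ∧ p ∣ s ∧ (p ^ 2 ∣ s ∨ A.card < p) := by
      by_contra! hcon
      have hsmall : ∀ p, p.Prime → p ∣ s → p = if A.card = 4 then 3 else 5 := by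
        intro p hp hps
        have hle := (hcon p hp hps).2
        have hnd : ¬ p ∣ A.card := fun hd => by
          have := Nat.dvd_gcd hps hd
          rw [hcop] at this
          exact hp.one_lt.ne' (Nat.dvd_one.1 this)
        rcases hA with h4 | h6
        · rw [h4] at hle hnd
          rw [if_pos h4]
          have := hp.two_le
          interval_cases p
          · omega
          · rfl
          · omega
        · rw [h6] at hle hnd
          rw [if_neg (by omega)]
          have := hp.two_le
          interval_cases p
          · omega
          · omega
          · exact absurd hp (by norm_num)
          · rfl
          · omega
      have hmin := Nat.minFac_prime h1
      obtain ⟨t, ht⟩ := Nat.minFac_dvd s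
      by_cases ht1 : t = 1
      · rw [ht1, mul_one] at ht
        rw [ht] at hpr
        exact hpr hmin
      · have hp2 := Nat.minFac_prime ht1
        have e1 := hsmall _ hmin (Nat.minFac_dvd s)
        have e2 := hsmall _ hp2 ((Nat.minFac_dvd t).trans ⟨_, by rw [mul_comm]; exact ht⟩)
        refine (hcon _ hmin (Nat.minFac_dvd s)).1 ?_
        conv_rhs => rw [ht]
        rw [pow_two]
        refine Nat.mul_dvd_mul_left _ ?_
        rw [e1, ← e2]
        exact Nat.minFac_dvd t
    rcases exists_half_or_class hs hp hps hne h hcase with ⟨C, -, hCne, hCcard, hC⟩ | ⟨r, hr⟩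
    · have c0 := hCne.card_pos
      have c1 := card_ne_one hs hC
      have c2 : C.card ≠ 2 := fun h => h2 (two_dvd_of_pair hs h hC)
      have c3 : C.card = 3 := by omega
      have h3 := three_dvd_of_triple hs c3 hC
      have := Nat.dvd_gcd h3 (show 3 ∣ A.card by omega)
      rw [hcop] at this
      omega
    · obtain ⟨e1, e2⟩ := image_card_of_class hr hps hs hp.pos h
      refine ih (s / p) (Nat.div_lt_self hs hp.one_lt) _ (Nat.div_pos (Nat.le_of_dvd hs hps) hp.pos)
        (by rwa [e1]) ?_ e2
      rw [e1]
      exact Nat.Coprime.coprime_dvd_left (Nat.div_dvd_of_dvd hps) hcop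

/-- A vanishing sum of five sixth roots of unity contains an antipodal pair. -/
theorem exists_pair_of_six (hA : A.card = 5) (h : cyclotomic 6 ℤ ∣ genPoly A) :
    ∃ C ⊆ A, C.card = 2 ∧ cyclotomic 6 ℤ ∣ genPoly C := by
  obtain ⟨z, hz⟩ := exists_primitive (s := 6) (by norm_num)
  have h6 : z ^ 6 = 1 := hz.pow_eq_one
  have h3 : z ^ 3 = -1 := by
    have hne : z ^ 3 ≠ 1 := fun h => by
      have := (hz.pow_eq_one_iff_dvd 3).1 h
      omega
    have : (z ^ 3 - 1) * (z ^ 3 + 1) = 0 := by linear_combination h6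
    exact eq_neg_of_add_eq_zero_left ((mul_eq_zero.1 this).resolve_left (sub_ne_zero.2 hne))
  have h2 : z ^ 2 = z - 1 := by
    have hne : z ≠ -1 := fun h => by
      have : z ^ 2 = 1 := by rw [h]; norm_num
      have := (hz.pow_eq_one_iff_dvd 2).1 this
      omega
    have : (z + 1) * (z ^ 2 - z + 1) = 0 := by linear_combination h3
    have := (mul_eq_zero.1 this).resolve_left fun h => hne (eq_neg_of_add_eq_zero_left h)
    linear_combination this
  have him : z.im ≠ 0 := by
    intro h0
    have h4 : z = (z.re : ℂ) := Complex.ext (by simp) (by simp [h0])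
    rw [h4] at h2
    have h5 : z.re ^ 2 = z.re - 1 := by exact_mod_cast h2
    nlinarith [sq_nonneg (z.re - 1 / 2)]
  set c : ℕ → ℕ := fun j => (A.filter fun a => a % 6 = j).card with hc
  have hmap : ∀ a ∈ A, a % 6 ∈ Finset.range 6 := fun a _ =>
    Finset.mem_range.2 (Nat.mod_lt _ (by norm_num))
  have hcard : c 0 + c 1 + c 2 + c 3 + c 4 + c 5 = 5 := by
    have := Finset.card_eq_sum_card_fiberwise hmap
    rw [hA] at this
    simp only [Finset.sum_range_succ, Finset.sum_range_zero, zero_add] at this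
    exact this.symm
  have hsum := sum_pow_eq_zero (by norm_num) h hz
  rw [← Finset.sum_fiberwise_of_maps_to hmap] at hsum
  have hcls : ∀ j, ∑ a ∈ A.filter (fun a => a % 6 = j), z ^ a = c j * z ^ j := by
    intro j
    rw [Finset.sum_congr rfl (g := fun _ => z ^ j), Finset.sum_const, nsmul_eq_mul]
    intro a ha
    rw [← (Finset.mem_filter.1 ha).2]
    conv_lhs => rw [← Nat.div_add_mod a 6, pow_add, pow_mul, h6, one_pow, one_mul]
  simp only [hcls, Finset.sum_range_succ, Finset.sum_range_zero, zero_add] at hsum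
  have h4 : z ^ 4 = -z := by linear_combination z * h3
  have h5 : z ^ 5 = -(z - 1) := by rw [← h2]; linear_combination z ^ 2 * h3
  rw [h2, h3, h4, h5] at hsum
  have hlin : (((c 0 : ℝ) - c 3 - c 2 + c 5 : ℝ) : ℂ) +
      (((c 1 : ℝ) - c 4 + c 2 - c 5 : ℝ) : ℂ) * z = 0 := by
    push_cast
    linear_combination hsum
  have e1 : ((c 1 : ℝ) - c 4 + c 2 - c 5) = 0 := by
    have := congrArg Complex.im hlin
    simp only [Complex.add_im, Complex.ofReal_im, Complex.im_ofReal_mul,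
      zero_add, Complex.zero_im] at this
    exact (mul_eq_zero.1 this).resolve_right him
  have e0 : ((c 0 : ℝ) - c 3 - c 2 + c 5) = 0 := by
    rw [e1] at hlin
    simp only [Complex.ofReal_zero, zero_mul, add_zero] at hlin
    exact_mod_cast hlin
  have e1' : c 1 + c 2 = c 4 + c 5 := by
    have : (c 1 : ℝ) + c 2 = c 4 + c 5 := by linarith
    exact_mod_cast this
  have e0' : c 0 + c 5 = c 3 + c 2 := by
    have : (c 0 : ℝ) + c 5 = c 3 + c 2 := by linarith
    exact_mod_cast this
  have hex : ∃ j, 0 < c j ∧ 0 < c (j + 3) := by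
    by_contra! hcon
    have f0 := hcon 0
    have f1 := hcon 1
    have f2 := hcon 2
    simp only [Nat.reduceAdd] at f0 f1 f2
    omega
  obtain ⟨j, hj, hj3⟩ := hex
  obtain ⟨a, ha⟩ := Finset.card_pos.1 hj
  obtain ⟨b, hb⟩ := Finset.card_pos.1 hj3
  rw [Finset.mem_filter] at ha hb
  have hab : a ≠ b := fun h => by rw [h] at ha; omega
  refine ⟨{a, b}, by
    intro x hx
    rcases Finset.mem_insert.1 hx with rfl | hx
    · exact ha.1
    · rw [Finset.mem_singleton.1 hx]; exact hb.1, Finset.card_pair hab,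
    dvd_genPoly_of_sum (by norm_num) hz ?_⟩
  rw [Finset.sum_pair hab]
  have hmod : ∀ n, z ^ n = z ^ (n % 6) := fun n => by
    conv_lhs => rw [← Nat.div_add_mod n 6, pow_add, pow_mul, h6, one_pow, one_mul]
  rw [hmod a, hmod b, ha.2, hb.2, pow_add, h3]
  ring

/-- A vanishing sum of five `s`-th roots of unity with `5 ∤ s` contains an antipodal pair. -/
theorem exists_pair_of_five (s : ℕ) (A : Finset ℕ) (hs : 0 < s) (hA : A.card = 5)
    (hcop : Nat.Coprime s 5) (h : cyclotomic s ℤ ∣ genPoly A) :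
    ∃ C ⊆ A, C.card = 2 ∧ cyclotomic s ℤ ∣ genPoly C := by
  induction s using Nat.strong_induction_on generalizing A with
  | _ s ih =>
    have hne : A.Nonempty := Finset.card_pos.1 (by omega)
    obtain ⟨h1, hpr⟩ := ne_prime_of_coprime hne (by rwa [hA]) h
    by_cases hex : ∃ p, p.Prime ∧ p ∣ s ∧ (p ^ 2 ∣ s ∨ A.card < p)
    · obtain ⟨p, hp, hps, hcase⟩ := hex
      rcases exists_half_or_class hs hp hps hne h hcase with ⟨C, hCA, hCne, hCcard, hC⟩ | ⟨r, hr⟩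
      · have c0 := hCne.card_pos
        have c1 := card_ne_one hs hC
        exact ⟨C, hCA, by omega, hC⟩
      · obtain ⟨e1, e2⟩ := image_card_of_class hr hps hs hp.pos h
        have ht : 0 < s / p := Nat.div_pos (Nat.le_of_dvd hs hps) hp.pos
        obtain ⟨C', hC', hcard, hdvd⟩ := ih (s / p) (Nat.div_lt_self hs hp.one_lt) _ ht
          (by rw [e1, hA]) (Nat.Coprime.coprime_dvd_left (Nat.div_dvd_of_dvd hps) hcop) e2
        have himg : (A.filter fun a => a / p ∈ C').image (· / p) = C' := by
          ext b
          simp only [Finset.mem_image, Finset.mem_filter]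
          constructor
          · rintro ⟨a, ⟨_, h⟩, rfl⟩; exact h
          · intro hb
            obtain ⟨a, ha, rfl⟩ := Finset.mem_image.1 (hC' hb)
            exact ⟨a, ⟨ha, hb⟩, rfl⟩
        have hr' : ∀ a ∈ A.filter (fun a => a / p ∈ C'), a % p = r := fun a ha =>
          hr a (Finset.mem_filter.1 ha).1
        refine ⟨A.filter fun a => a / p ∈ C', Finset.filter_subset _ _, ?_, ?_⟩
        · rw [← card_image_class hr', himg, hcard]
        · have := cyclotomic_dvd_iff_class hp.pos ht hr'
          rw [Nat.mul_div_cancel' hps] at this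
          rw [this, himg]
          exact hdvd
    · push Not at hex
      have hsmall : ∀ p, p.Prime → p ∣ s → p = 2 ∨ p = 3 := by
        intro p hp hps
        have hle := (hex p hp hps).2
        rw [hA] at hle
        have := hp.two_le
        interval_cases p
        · exact Or.inl rfl
        · exact Or.inr rfl
        · exact absurd hp (by norm_num)
        · have := Nat.dvd_gcd hps (dvd_refl 5)
          rw [hcop] at this
          omega
      have hs6 : s ∣ 6 := by
        have hsq : Squarefree s := by
          rw [Nat.squarefree_iff_prime_squarefree]
          intro p hp hd
          rw [← pow_two] at hd
          exact (hex p hp ((dvd_pow_self p two_ne_zero).trans hd)).1 hd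
        rw [← Nat.prod_primeFactors_of_squarefree hsq, show (6 : ℕ) = ∏ p ∈ {2, 3}, p by rfl]
        refine Finset.prod_dvd_prod_of_subset _ _ _ fun p hp => ?_
        rcases hsmall p (Nat.prime_of_mem_primeFactors hp) (Nat.dvd_of_mem_primeFactors hp) with
          rfl | rfl <;> simp
      have hle := Nat.le_of_dvd (by norm_num) hs6
      have h6 : s = 6 := by
        interval_cases s
        · omega
        · exact absurd Nat.prime_two hpr
        · exact absurd Nat.prime_three hpr
        · omega
        · omega
        · rfl
      subst h6
      exact exists_pair_of_six hA h

theorem factorization_of_relation {q : ℕ} (hq : q.Prime) {d : ℤ} (hs : 0 < s) (hd : d ≠ 0)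
    (h : (s : ℤ) ∣ q * d ∧ ¬ (s : ℤ) ∣ d) :
    s.factorization q = d.natAbs.factorization q + 1 ∧
      ∀ r, r ≠ q → s.factorization r ≤ d.natAbs.factorization r := by
  have hd0 : d.natAbs ≠ 0 := Int.natAbs_ne_zero.2 hd
  have h1 : s ∣ q * d.natAbs := by
    have := Int.natAbs_dvd_natAbs.2 h.1
    rwa [Int.natAbs_mul, Int.natAbs_natCast, Int.natAbs_natCast] at this
  have h2 : ¬ s ∣ d.natAbs := fun hd => h.2 (Int.natCast_dvd.2 hd)
  have h3 := (Nat.factorization_le_iff_dvd hs.ne' (mul_ne_zero hq.ne_zero hd0)).2 h1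
  rw [Nat.factorization_mul hq.ne_zero hd0, hq.factorization] at h3
  have h4 : ∀ r, r ≠ q → s.factorization r ≤ d.natAbs.factorization r := fun r hr => by
    have := h3 r
    simpa [Finsupp.single_apply, hr.symm] using this
  have h5 := h3 q
  simp only [Finsupp.add_apply, Finsupp.single_eq_same] at h5
  refine ⟨?_, h4⟩
  by_contra hne
  refine h2 ((Nat.factorization_le_iff_dvd hs.ne' hd0).1 fun r => ?_)
  by_cases hr : r = q
  · subst hr; omega
  · exact h4 r hr

theorem sdiff_dvd (hCA : C ⊆ A) (h : cyclotomic s ℤ ∣ genPoly A)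
    (hC : cyclotomic s ℤ ∣ genPoly C) : cyclotomic s ℤ ∣ genPoly (A \ C) := by
  have : genPoly A = genPoly (A \ C) + genPoly C := (Finset.sum_sdiff hCA).symm
  rw [this] at h
  exact (dvd_add_left hC).1 h

/-- For a five-element set `A`, all `s` prime to `5` with `Φ_s ∣ A` have the same `3`-adic
valuation: two different splittings into a pair and a triple either have triples sharing two points,
or force `v₂(s) < v₂(s') < v₂(s)`. -/
theorem factorization_three_eq {s' : ℕ} (hs : 0 < s) (hs' : 0 < s') (hA : A.card = 5)
    (hcop : Nat.Coprime s 5) (hcop' : Nat.Coprime s' 5) (h : cyclotomic s ℤ ∣ genPoly A)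
    (h' : cyclotomic s' ℤ ∣ genPoly A) : s.factorization 3 = s'.factorization 3 := by
  obtain ⟨C, hCA, hC2, hC⟩ := exists_pair_of_five s A hs hA hcop h
  obtain ⟨C', hCA', hC2', hC'⟩ := exists_pair_of_five s' A hs' hA hcop' h'
  have hT := sdiff_dvd hCA h hC
  have hT' := sdiff_dvd hCA' h' hC'
  have hT3 : (A \ C).card = 3 := by rw [Finset.card_sdiff_of_subset hCA, hA, hC2]
  have hT3' : (A \ C').card = 3 := by rw [Finset.card_sdiff_of_subset hCA', hA, hC2']
  have hsub : ∀ x y : ℕ, x ≠ y → ((x : ℤ) - y) ≠ 0 := fun x y h => by omega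
  by_cases hint : 1 < ((A \ C) ∩ (A \ C')).card
  · obtain ⟨x, hx, y, hy, hxy⟩ := Finset.one_lt_card.1 hint
    rw [Finset.mem_inter] at hx hy
    have e1 := factorization_of_relation Nat.prime_three hs (hsub x y hxy)
      (by exact_mod_cast triple_relation hs hT3 hT hx.1 hy.1 hxy)
    have e2 := factorization_of_relation Nat.prime_three hs' (hsub x y hxy)
      (by exact_mod_cast triple_relation hs' hT3' hT' hx.2 hy.2 hxy)
    rw [e1.1, e2.1]
  · exfalso
    -- the pair of each of the two splittings lies in the triple of the other
    have key : ∀ (s s' : ℕ) (C C' : Finset ℕ), 0 < s → 0 < s' → C ⊆ A → C'.card = 2 →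
        (A \ C).card = 3 → ¬ 1 < ((A \ C) ∩ (A \ C')).card → cyclotomic s ℤ ∣ genPoly (A \ C) →
        cyclotomic s' ℤ ∣ genPoly C' → s.factorization 2 < s'.factorization 2 := by
      intro s s' C C' hs hs' hCA hC2' hT3 hint hT hC'
      have h1 : (A \ C) ∩ C' = C' := by
        refine Finset.eq_of_subset_of_card_le Finset.inter_subset_right ?_
        have h2 : A \ C ⊆ ((A \ C) ∩ (A \ C')) ∪ ((A \ C) ∩ C') := by
          intro x hx
          have hxA := (Finset.mem_sdiff.1 hx).1
          by_cases hxC : x ∈ C'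
          · exact Finset.mem_union_right _ (Finset.mem_inter.2 ⟨hx, hxC⟩)
          · exact Finset.mem_union_left _ (Finset.mem_inter.2 ⟨hx, Finset.mem_sdiff.2 ⟨hxA, hxC⟩⟩)
        have := (Finset.card_le_card h2).trans (Finset.card_union_le _ _)
        omega
      obtain ⟨x, y, hxy, rfl⟩ := Finset.card_eq_two.1 hC2'
      have hx : x ∈ A \ C := Finset.inter_eq_right.1 h1 (by simp)
      have hy : y ∈ A \ C := Finset.inter_eq_right.1 h1 (by simp)
      have e1 := factorization_of_relation Nat.prime_three hs (hsub x y hxy)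
        (by exact_mod_cast triple_relation hs hT3 hT hx hy hxy)
      have e2 := factorization_of_relation Nat.prime_two hs' (hsub x y hxy)
        (by exact_mod_cast pair_relation hs' hxy hC')
      have := e1.2 2 (by norm_num)
      omega
    have k1 := key s s' C C' hs hs' hCA hC2' hT3 hint hT hC'
    rw [Finset.inter_comm] at hint
    have k2 := key s' s C' C hs' hs hCA' hC2 hT3' hint hT' hC
    omega

/-- Sets with at most six elements satisfy the divisor condition. -/
theorem divisorCondition_of_card_le_six {L : ℕ} (h2 : 2 ≤ A.card) (h6 : A.card ≤ 6)
    (hL : A.card ∣ L) : DivisorCondition L A := by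
  have hne : A.Nonempty := Finset.card_pos.1 (by omega)
  have hcopA : ∀ s ∈ badOrders L A, Nat.Coprime s A.card := fun s hs =>
    Nat.Coprime.coprime_dvd_right hL hs.2.2
  by_cases hempty : badOrders L A = ∅
  · left
    have := ((badLcm_spec L A hne).2 1).2 (by simp [hempty])
    exact Nat.dvd_one.1 this
  obtain ⟨s₀, hs₀⟩ := Set.nonempty_iff_ne_empty.2 hempty
  have hc0 := hcopA s₀ hs₀
  obtain ⟨hpos0, hd0, -⟩ := id hs₀
  have h5 : A.card = 5 := by
    by_contra hn5
    have : A.card = 2 ∨ A.card = 3 ∨ A.card = 4 ∨ A.card = 6 := by omega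
    rcases this with h | h | h
    · have := Nat.dvd_gcd (two_dvd_of_pair hpos0 h hd0) (h ▸ dvd_rfl : 2 ∣ A.card)
      rw [hc0] at this
      omega
    · have := Nat.dvd_gcd (three_dvd_of_triple hpos0 h hd0) (h ▸ dvd_rfl : 3 ∣ A.card)
      rw [hc0] at this
      omega
    · exact not_dvd_of_card_four_six s₀ A hpos0 h hc0 hd0
  rw [h5] at hcopA
  right
  obtain ⟨hMpos, hM⟩ := badLcm_spec L A hne
  set M := badLcm L A with hMdef
  have hdvdM : ∀ s ∈ badOrders L A, s ∣ M := (hM M).1 dvd_rfl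
  obtain ⟨C, hCA, hC2, hC⟩ := exists_pair_of_five s₀ A hpos0 h5 (hcopA s₀ hs₀) hd0
  have h2s := two_dvd_of_pair hpos0 hC2 hC
  have h3s := three_dvd_of_triple hpos0
    (by rw [Finset.card_sdiff_of_subset hCA, h5, hC2]) (sdiff_dvd hCA hd0 hC)
  have h6M : 6 ∣ M := (Nat.Coprime.mul_dvd_of_dvd_of_dvd (by norm_num : Nat.Coprime 2 3) h2s
    h3s).trans (hdvdM _ hs₀)
  obtain ⟨k, hk⟩ := h6M
  have hk0 : 0 < k := by omega
  -- `s₂ = 3 < 5 = |A|` and `s₁ = M / 3`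
  refine ⟨2 * k, 3, by omega, by norm_num, by omega, by omega, fun q hq hcyc => ?_⟩
  have hqM : q ∣ M := hq.trans ⟨3, by omega⟩
  have hq0 : 0 < q := Nat.pos_of_dvd_of_pos hqM hMpos
  -- `M` is prime to `L`, so that `q` is one of the bad orders
  have hMcop : Nat.Coprime M L := by
    have hfin := badOrders_finite L A hne
    have h1 : M ∣ ∏ s ∈ hfin.toFinset, s := (hM _).2 fun s hs =>
      Finset.dvd_prod_of_mem (fun s => s) (hfin.mem_toFinset.2 hs)
    exact Nat.Coprime.coprime_dvd_left h1
      (Nat.Coprime.prod_left fun s hs => (hfin.mem_toFinset.1 hs).2.2)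
  have hqbad : q ∈ badOrders L A := ⟨hq0, hcyc, Nat.Coprime.coprime_dvd_left hqM hMcop⟩
  have heq : ∀ s ∈ badOrders L A, s.factorization 3 = q.factorization 3 := fun s hs =>
    factorization_three_eq hs.1 hq0 h5 (hcopA s hs) (hcopA q hqbad) hs.2.1 hcyc
  -- hence the `3`-adic valuation of `M` is that of `q`, although `q ∣ M / 3`
  have hM3 : M ∣ 3 ^ q.factorization 3 * (M / 3 ^ M.factorization 3) := by
    refine (hM _).2 fun s hs => ?_
    conv_lhs => rw [← Nat.ordProj_mul_ordCompl_eq_self s 3, heq s hs]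
    exact Nat.mul_dvd_mul_left _ (by
      have := Nat.ordCompl_dvd_ordCompl_of_dvd (hdvdM s hs) 3
      rwa [heq s hs] at this)
  have hcompl : 0 < M / 3 ^ M.factorization 3 := Nat.ordCompl_pos 3 hMpos.ne'
  have e1 := (Nat.factorization_le_iff_dvd hMpos.ne' (by positivity)).2 hM3 3
  rw [Nat.factorization_mul (by positivity) hcompl.ne', Finsupp.add_apply,
    Nat.Prime.factorization_pow Nat.prime_three, Finsupp.single_eq_same,
    Nat.factorization_ordCompl, Finsupp.erase_same, add_zero] at e1
  have e2 := (Nat.factorization_le_iff_dvd hq0.ne' (by omega)).2 hq 3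
  have e3 : M.factorization 3 = 1 + (2 * k).factorization 3 := by
    rw [show M = 3 * (2 * k) by omega, Nat.factorization_mul (by norm_num) (by omega),
      Finsupp.add_apply, Nat.Prime.factorization_self Nat.prime_three]
  omega

end SmallSets

/-! ### One-dimensional integrals of products -/

section Orthogonality

theorem ofReal_setIntegral {f : ℝ → ℝ} (hf : Continuous f) (h0 : ∀ x, 0 ≤ f x) (a b : ℝ) :
    ∫⁻ x in Set.Icc a b, ENNReal.ofReal (f x) = ENNReal.ofReal (∫ x in Set.Icc a b, f x) :=
  (ofReal_integral_eq_lintegral_ofReal hf.integrableOn_Icc (Filter.Eventually.of_forall h0)).symm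

theorem four_mul_le_norm_expi_sub_one (x : ℝ) : 4 * |x - round x| ≤ ‖expi x - 1‖ := by
  have h1 : expi x = expi (x - round x) := by
    have : x = (x - round x) + (round x : ℤ) := by ring
    conv_lhs => rw [this, expi_add, expi_intCast, mul_one]
  rw [h1]
  set y := x - round x
  have hy : |y| ≤ 1 / 2 := abs_sub_round x
  have h2 := Complex.norm_exp_I_mul_ofReal_sub_one (2 * Real.pi * y)
  rw [mul_comm] at h2
  rw [expi, h2, Real.norm_eq_abs, abs_mul, abs_two, mul_div_assoc, mul_assoc]
  have h3 : 2 * (Real.pi * (y / 2)) = Real.pi * y := by ring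
  have hpi := Real.pi_pos
  have h4 : |Real.pi * y| ≤ Real.pi / 2 := by
    rw [abs_mul, abs_of_pos hpi]; nlinarith
  have h5 := Real.mul_abs_le_abs_sin h4
  rw [abs_mul, abs_of_pos hpi, ← mul_assoc, div_mul_cancel₀ _ hpi.ne'] at h5
  rw [h3]
  linarith

theorem integral_expi_int (k : ℤ) (hk : k ≠ 0) (x : ℝ) :
    ∫ u in x..(x + 1), expi (k * u) = 0 := by
  have hc : (2 * Real.pi * k : ℂ) * Complex.I ≠ 0 := by
    simp [hk, Real.pi_ne_zero]
  have : ∀ u : ℝ, expi (k * u) = Complex.exp ((2 * Real.pi * k : ℂ) * Complex.I * u) := by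
    intro u
    rw [expi]; congr 1; push_cast; ring
  simp_rw [this]
  rw [integral_exp_mul_complex hc]
  simp_rw [← this]
  rw [mul_add, mul_one, expi_add, expi_intCast, mul_one, sub_self, zero_div]

/-- Orthogonality of characters with distinct integer frequencies. -/
theorem integral_norm_expSum_natCast (S : Finset ℕ) (x : ℝ) :
    ∫ u in x..(x + 1), ‖expSum S (fun a => (a : ℝ)) u‖ ^ 2 = S.card := by
  apply Complex.ofReal_injective
  rw [← intervalIntegral.integral_ofReal]
  have : ∀ u : ℝ, ((‖expSum S (fun a => (a : ℝ)) u‖ ^ 2 : ℝ) : ℂ) =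
      ∑ i ∈ S, ∑ j ∈ S, expi (((i : ℤ) - j : ℤ) * u) := fun u => by
    have := norm_expSum_sub_sq S (fun a => (a : ℝ)) u 0
    simpa using this
  simp_rw [this]
  rw [intervalIntegral.integral_finsetSum]
  · have h1 : ∀ i ∈ S, ∫ u in x..(x + 1), ∑ j ∈ S, expi (((i : ℤ) - j : ℤ) * u) = 1 := by
      intro i hi
      rw [intervalIntegral.integral_finsetSum, Finset.sum_eq_single_of_mem i hi]
      · simp
      · intro j _ hne
        exact integral_expi_int _ (by omega) x
      · exact fun j _ => Continuous.intervalIntegrable (by fun_prop) _ _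
    rw [Finset.sum_congr rfl h1]
    simp
  · exact fun i _ => Continuous.intervalIntegrable (by fun_prop) _ _

variable {L : ℕ} {A : Finset ℕ}

theorem integral_powProd_one (hU : UniqueDigits L A) (hA : A.Nonempty) (n : ℕ) (x : ℝ) :
    ∫ u in Set.Icc x (x + 1), powProd (powerSpec A fun a => (a : ℝ)) L 0 n u =
      1 / (A.card : ℝ) ^ n := by
  have hA0 : (0 : ℝ) < A.card := by exact_mod_cast hA.card_pos
  have h1 := integral_norm_expSum_natCast (digitSum L A n) x
  rw [intervalIntegral.integral_of_le (by linarith), ← integral_Icc_eq_integral_Ioc] at h1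
  have h2 : ∀ u, ‖expSum (digitSum L A n) (fun a => (a : ℝ)) u‖ ^ 2 =
    ((A.card : ℝ) ^ n) ^ 2 * powProd (powerSpec A fun a => (a : ℝ)) L 0 n u := fun u =>
      norm_expSum_digitSum (Nat.castAddMonoidHom ℝ) hU hA n u
  simp_rw [h2] at h1
  rw [integral_const_mul, hU, Nat.cast_pow] at h1
  rw [eq_div_iff (by positivity)]
  have h3 : (A.card : ℝ) ^ n ≠ 0 := by positivity
  apply mul_left_cancel₀ h3
  linear_combination h1

theorem integral_powProd_scaled (hL : 0 < L) (f : ℝ → ℝ) (q n : ℕ) (hqn : q ≤ n) (a b : ℝ)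
    (hab : a ≤ b) :
    ∫ u in Set.Icc a b, powProd f L q n u =
      ((L : ℝ) ^ q)⁻¹ * ∫ u in Set.Icc ((L : ℝ) ^ q * a) ((L : ℝ) ^ q * b), powProd f L 0 (n - q) u
      := by
  have hL0 : (0 : ℝ) < (L : ℝ) ^ q := by positivity
  have h1 : ∀ u, powProd f L q n u = powProd f L 0 (n - q) ((L : ℝ) ^ q * u) := fun u => by
    rw [← powProd_scale, Nat.add_sub_cancel' hqn]
  simp_rw [h1]
  rw [integral_Icc_eq_integral_Ioc, ← intervalIntegral.integral_of_le hab,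
    intervalIntegral.integral_comp_mul_left _ hL0.ne', integral_Icc_eq_integral_Ioc,
    ← intervalIntegral.integral_of_le (by gcongr), smul_eq_mul]

theorem lintegral_biUnion_finset_le' {ι : Type*} (s : Finset ι) (t : ι → Set ℝ) (f : ℝ → ENNReal) :
    ∫⁻ x in ⋃ i ∈ s, t i, f x ≤ ∑ i ∈ s, ∫⁻ x in t i, f x := by
  classical
  induction s using Finset.induction_on with
  | empty => simp
  | insert i s hi ih =>
    rw [Finset.set_biUnion_insert, Finset.sum_insert hi]
    exact (lintegral_union_le f _ _).trans (by gcongr)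

/-- The mass of `∏_{m ≤ k < n} |φ_A(L^k u)|²` on the points `u` at which `R u` is very close to an
integer. -/
theorem lintegral_smallSet_le (hU : UniqueDigits L A) (hA : A.Nonempty) (hL : 0 < L) {R m q n : ℕ}
    (hR : 0 < R) (hmq : m ≤ q) (hqn : q ≤ n) :
    ∫⁻ u in {u | u ∈ Set.Icc (-1 : ℝ) 1 ∧ ‖expi (R * u) - 1‖ < ((L : ℝ) ^ q)⁻¹},
        ENNReal.ofReal (powProd (powerSpec A fun a => (a : ℝ)) L m n u) ≤
      ENNReal.ofReal ((2 * R + 3) * (((L : ℝ) ^ q)⁻¹ * (1 / (A.card : ℝ) ^ (n - q)))) := by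
  have hL0 : (0 : ℝ) < (L : ℝ) ^ q := by positivity
  have hR1 : (1 : ℝ) ≤ R := by exact_mod_cast hR
  set f := powerSpec A fun a => (a : ℝ)
  have h0 : ∀ u, 0 ≤ f u := powerSpec_nonneg _ _
  have h1 : ∀ u, f u ≤ 1 := powerSpec_le_one _ _
  set h := ((L : ℝ) ^ q)⁻¹ with hh
  have hh0 : 0 < h := by positivity
  set J : ℤ → Set ℝ := fun r => Set.Icc (r / R - h / 4) (r / R - h / 4 + h)
  have hh1 : h ≤ 1 := inv_le_one_of_one_le₀ (one_le_pow₀ (by exact_mod_cast hL))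
  have hsub : {u | u ∈ Set.Icc (-1 : ℝ) 1 ∧ ‖expi (R * u) - 1‖ < h} ⊆
      ⋃ r ∈ Finset.Icc (-(R + 1 : ℤ)) (R + 1), J r := by
    rintro u ⟨hu, hexp⟩
    have h2 := (four_mul_le_norm_expi_sub_one (R * u)).trans hexp.le
    have h3 : |(R : ℝ) * u - round ((R : ℝ) * u)| ≤ h / 4 := by linarith
    have h4 := abs_le.1 h3
    simp only [Set.mem_iUnion, exists_prop]
    refine ⟨round ((R : ℝ) * u), ?_, ?_⟩
    · rw [Set.mem_Icc] at hu
      rw [Finset.mem_Icc]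
      constructor
      · have : ((-(R + 1 : ℤ) : ℤ) : ℝ) ≤ (round ((R : ℝ) * u) : ℤ) := by
          push_cast; nlinarith
        exact_mod_cast this
      · have : (round ((R : ℝ) * u) : ℤ) ≤ (((R + 1 : ℤ) : ℤ) : ℝ) := by
          push_cast; nlinarith
        exact_mod_cast this
    · have h5 : |u - round ((R : ℝ) * u) / R| ≤ h / 4 := by
        have h6 : u - round ((R : ℝ) * u) / R = (R * u - round ((R : ℝ) * u)) / R := by
          field_simp
        rw [h6, abs_div, abs_of_pos (by linarith : (0 : ℝ) < R)]
        exact (div_le_self (abs_nonneg _) hR1).trans h3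
      have h6 := abs_le.1 h5
      exact Set.mem_Icc.2 ⟨by linarith, by linarith⟩
  calc _ ≤ ∫⁻ u in ⋃ r ∈ Finset.Icc (-(R + 1 : ℤ)) (R + 1), J r,
        ENNReal.ofReal (powProd f L m n u) := lintegral_mono_set hsub
    _ ≤ ∑ r ∈ Finset.Icc (-(R + 1 : ℤ)) (R + 1), ∫⁻ u in J r,
        ENNReal.ofReal (powProd f L m n u) := lintegral_biUnion_finset_le' _ _ _
    _ ≤ ∑ r ∈ Finset.Icc (-(R + 1 : ℤ)) (R + 1), ENNReal.ofReal (h * (1 / (A.card : ℝ) ^ (n - q)))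
        := by
      refine Finset.sum_le_sum fun r _ => ?_
      calc _ ≤ ∫⁻ u in J r, ENNReal.ofReal (powProd f L q n u) :=
            lintegral_mono fun u => ENNReal.ofReal_le_ofReal (powProd_le_right h0 h1 hmq hqn u)
        _ = ENNReal.ofReal (∫ u in J r, powProd f L q n u) :=
            ofReal_setIntegral (continuous_powProd (continuous_powerSpec _ _) _ _)
              (powProd_nonneg h0 _ _) _ _
        _ ≤ _ := by
            apply ENNReal.ofReal_le_ofReal
            rw [integral_powProd_scaled hL f q n hqn _ _ (by linarith), mul_add _ _ h,
              mul_inv_cancel₀ hL0.ne', integral_powProd_one hU hA]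
    _ = _ := by
      rw [Finset.sum_const, nsmul_eq_mul, Int.card_Icc,
        ← ENNReal.ofReal_natCast, ← ENNReal.ofReal_mul (by positivity)]
      congr 2
      have : (R + 1 + 1 - -(R + 1 : ℤ)).toNat = 2 * R + 3 := by omega
      rw [this]
      push_cast
      ring

theorem lintegral_powProd_Icc_le (hU : UniqueDigits L A) (hA : A.Nonempty) (hL : 0 < L) {m n : ℕ}
    (hmn : m ≤ n) :
    ∫⁻ u in Set.Icc (-1 : ℝ) 1, ENNReal.ofReal (powProd (powerSpec A fun a => (a : ℝ)) L m n u) ≤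
      ENNReal.ofReal (2 * (1 / (A.card : ℝ) ^ (n - m))) := by
  have hL0 : (0 : ℝ) < (L : ℝ) ^ m := by positivity
  set f := powerSpec A fun a => (a : ℝ)
  have hf : Continuous f := continuous_powerSpec _ _
  have h0 : ∀ u, 0 ≤ f u := powerSpec_nonneg _ _
  rw [ofReal_setIntegral (continuous_powProd hf _ _) (powProd_nonneg h0 _ _)]
  apply ENNReal.ofReal_le_ofReal
  rw [integral_powProd_scaled hL f m n hmn _ _ (by norm_num)]
  -- `[-L^m, L^m]` consists of `2 L^m` unit intervals
  have key : ∀ (M : ℕ) (x : ℝ), ∫ u in Set.Icc x (x + M), powProd f L 0 (n - m) u =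
      M * (1 / (A.card : ℝ) ^ (n - m)) := by
    intro M x
    induction M with
    | zero => simp
    | succ M ih =>
      have h2 := integral_powProd_one hU hA (n - m) (x + M)
      rw [integral_Icc_eq_integral_Ioc, ← intervalIntegral.integral_of_le (by linarith)] at h2
      rw [integral_Icc_eq_integral_Ioc, ← intervalIntegral.integral_of_le (by simp)] at ih
      have hint : ∀ a b, IntervalIntegrable (powProd f L 0 (n - m)) volume a b := fun a b =>
        (continuous_powProd hf _ _).intervalIntegrable _ _
      rw [integral_Icc_eq_integral_Ioc, ← intervalIntegral.integral_of_le
        (by push_cast; linarith [(Nat.cast_nonneg M : (0 : ℝ) ≤ M)]),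
        ← intervalIntegral.integral_add_adjacent_intervals (hint x (x + M)) (hint _ _), ih]
      push_cast
      rw [← add_assoc x, h2]
      ring
  have h2 := key (2 * L ^ m) ((L : ℝ) ^ m * -1)
  have h3 : (L : ℝ) ^ m * -1 + ((2 * L ^ m : ℕ) : ℝ) = (L : ℝ) ^ m * 1 := by push_cast; ring
  rw [h3] at h2
  rw [h2]
  push_cast
  apply le_of_eq
  field_simp

end Orthogonality

/-! ### Mass of annuli -/

section Tail

theorem one_sub_sum_le_prod {ι : Type*} (s : Finset ι) (f : ι → ℝ) (a : ι → ℝ)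
    (h0 : ∀ i ∈ s, 0 ≤ f i) (h1 : ∀ i ∈ s, f i ≤ 1) (h : ∀ i ∈ s, 1 - a i ≤ f i)
    (ha : ∀ i ∈ s, 0 ≤ a i) : 1 - ∑ i ∈ s, a i ≤ ∏ i ∈ s, f i := by
  classical
  induction s using Finset.induction_on with
  | empty => simp
  | insert i s hi ih =>
    rw [Finset.sum_insert hi, Finset.prod_insert hi]
    have h2 := ih (fun j hj => h0 j (Finset.mem_insert_of_mem hj))
      (fun j hj => h1 j (Finset.mem_insert_of_mem hj))
      (fun j hj => h j (Finset.mem_insert_of_mem hj))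
      (fun j hj => ha j (Finset.mem_insert_of_mem hj))
    have h3 := h i (Finset.mem_insert_self i s)
    have h4 := h0 i (Finset.mem_insert_self i s)
    have h5 := h1 i (Finset.mem_insert_self i s)
    have h6 : 0 ≤ ∑ j ∈ s, a j := Finset.sum_nonneg fun j hj => ha j (Finset.mem_insert_of_mem hj)
    have h7 := mul_le_mul_of_nonneg_left h2 h4
    nlinarith

/-- Near the origin the low-frequency factors are bounded below. -/
theorem half_le_powProd {f : ℝ → ℝ} {L : ℕ} (hL : 2 ≤ L) (h0 : ∀ u, 0 ≤ f u) (h1 : ∀ u, f u ≤ 1)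
    {c : ℝ} (hc : 0 < c) (hf : ∀ u, 1 - c * |u| ≤ f u) (M : ℕ) {u : ℝ}
    (hu : (L : ℝ) ^ M * |u| ≤ 1 / (2 * c)) : 1 / 2 ≤ powProd f L 0 M u := by
  have hL' : (2 : ℝ) ≤ L := by exact_mod_cast hL
  have hgeom : ∀ M : ℕ, ∑ k ∈ Finset.range M, (L : ℝ) ^ k ≤ (L : ℝ) ^ M := by
    intro M
    induction M with
    | zero => simp
    | succ M ih =>
      rw [Finset.sum_range_succ, pow_succ]
      have : 0 < (L : ℝ) ^ M := by positivity
      nlinarith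
  have h2 := one_sub_sum_le_prod (Finset.Ico 0 M) (fun k => f ((L : ℝ) ^ k * u))
    (fun k => c * ((L : ℝ) ^ k * |u|)) (fun _ _ => h0 _) (fun _ _ => h1 _)
    (fun k _ => by
      have := hf ((L : ℝ) ^ k * u)
      rwa [abs_mul, abs_of_nonneg (by positivity : (0 : ℝ) ≤ (L : ℝ) ^ k)] at this)
    (fun _ _ => by positivity)
  refine le_trans ?_ h2
  rw [← Finset.mul_sum, ← Finset.sum_mul, ← Finset.range_eq_Ico]
  have h3 : (∑ k ∈ Finset.range M, (L : ℝ) ^ k) * |u| ≤ 1 / (2 * c) :=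
    (mul_le_mul_of_nonneg_right (hgeom M) (abs_nonneg _)).trans hu
  have h4 : c * ((∑ k ∈ Finset.range M, (L : ℝ) ^ k) * |u|) ≤ c * (1 / (2 * c)) := by gcongr
  have h5 : c * (1 / (2 * c)) = 1 / 2 := by field_simp
  linarith

/-- The annulus `L^{-m} ≤ |ξ| ≤ c`. -/
def annulus (L : ℕ) (c : ℝ) (m : ℕ) : Set ℝ := {ξ | ((L : ℝ) ^ m)⁻¹ ≤ |ξ| ∧ |ξ| ≤ c}

theorem measurableSet_annulus (L : ℕ) (c : ℝ) (m : ℕ) : MeasurableSet (annulus L c m) :=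
  (measurableSet_le (f := fun _ : ℝ => ((L : ℝ) ^ m)⁻¹) (g := fun ξ : ℝ => |ξ|)
    (by fun_prop) (by fun_prop)).inter
    (measurableSet_le (f := fun ξ : ℝ => |ξ|) (g := fun _ : ℝ => c) (by fun_prop) (by fun_prop))

open scoped Classical in
/-- Every point lies in at most `m + 1` of the annuli `L^{-k} annulus`. -/
theorem card_annuli_le {L : ℕ} (hL : 2 ≤ L) {c : ℝ} (hc : c ≤ 1) (m : ℕ) (F : Finset ℕ) (η : ℝ) :
    (F.filter fun k => (L : ℝ) ^ k * η ∈ annulus L c m).card ≤ m + 1 := by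
  set T := F.filter fun k => (L : ℝ) ^ k * η ∈ annulus L c m
  rcases T.eq_empty_or_nonempty with h | h
  · simp [h]
  set k₀ := T.min' h
  have hL1 : (1 : ℝ) < L := by exact_mod_cast (by omega : 1 < L)
  have hsub : T ⊆ Finset.Icc k₀ (k₀ + m) := by
    intro k hk
    refine Finset.mem_Icc.2 ⟨Finset.min'_le _ _ hk, ?_⟩
    have h1 := (Finset.mem_filter.1 (Finset.min'_mem T h)).2.1
    have h2 := (Finset.mem_filter.1 hk).2.2
    have hp : ∀ j : ℕ, (0 : ℝ) < (L : ℝ) ^ j := fun j => by positivity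
    rw [abs_mul, abs_of_pos (hp _)] at h1 h2
    rw [inv_le_iff_one_le_mul₀ (hp m)] at h1
    have h3 : (0 : ℝ) < |η| := by
      rcases (abs_nonneg η).eq_or_lt with h | h
      · rw [← h] at h1; norm_num at h1
      · exact h
    have h4 : (L : ℝ) ^ k ≤ (L : ℝ) ^ (k₀ + m) := by
      rw [pow_add]
      refine le_of_mul_le_mul_right ?_ h3
      change (L : ℝ) ^ k * |η| ≤ (L : ℝ) ^ k₀ * (L : ℝ) ^ m * |η|
      have : (1 : ℝ) ≤ (L : ℝ) ^ k₀ * (L : ℝ) ^ m * |η| := by linarith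
      linarith
    exact (pow_le_pow_iff_right₀ hL1).1 h4
  refine (Finset.card_le_card hsub).trans ?_
  rw [Nat.card_Icc]
  omega

theorem lintegral_comp_mul (g : ℝ → ENNReal) {a : ℝ} (ha : 0 < a) :
    ∫⁻ x, g x = ENNReal.ofReal a * ∫⁻ x, g (a * x) := by
  have h1 : (volume : Measure ℝ) = ENNReal.ofReal |a| • Measure.map (a * ·) volume :=
    (Real.smul_map_volume_mul_left ha.ne').symm
  have h2 : ∫⁻ x, g x ∂(Measure.map (a * ·) volume) = ∫⁻ x, g (a * x) :=
    (Homeomorph.mulLeft₀ a ha.ne').measurableEmbedding.lintegral_map g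
  conv_lhs => rw [h1]
  rw [lintegral_smul_measure, abs_of_pos ha, smul_eq_mul, h2]

open scoped Classical in
/-- The annuli carry little mass on average over the levels `n`. -/
theorem sum_lintegral_annulus_le {f : ℝ → ℝ} {L : ℕ} (hL : 2 ≤ L) (hfc : Continuous f)
    (h0 : ∀ u, 0 ≤ f u) (h1 : ∀ u, f u ≤ 1) {c : ℝ} (hc : 0 < c) (hc1 : 1 / (2 * c) ≤ 1)
    (hf : ∀ u, 1 - c * |u| ≤ f u) (m N : ℕ) :
    ∑ n ∈ Finset.range N, ENNReal.ofReal ((L : ℝ) ^ n) *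
        ∫⁻ ξ in annulus L (1 / (2 * c)) m, ENNReal.ofReal (powProd f L 0 n ξ) ≤
      ENNReal.ofReal (2 * (m + 1) * ((L : ℝ) ^ N * ∫ ξ in Set.Icc (-1 : ℝ) 1, powProd f L 0 N ξ)) := by
  have hL0 : (0 : ℝ) < L := by positivity
  set S := annulus L (1 / (2 * c)) m
  have hS : MeasurableSet S := measurableSet_annulus _ _ _
  have hmeas : ∀ n, Measurable fun ξ => ENNReal.ofReal (powProd f L 0 n ξ) := fun n =>
    (continuous_powProd hfc 0 n).measurable.ennreal_ofReal
  have hterm : ∀ n ∈ Finset.range N, ENNReal.ofReal ((L : ℝ) ^ n) *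
      ∫⁻ ξ in S, ENNReal.ofReal (powProd f L 0 n ξ) ≤ ENNReal.ofReal ((L : ℝ) ^ N) *
        ∫⁻ η, 2 * (((fun η => (L : ℝ) ^ (N - n) * η) ⁻¹' S).indicator
          (fun η => ENNReal.ofReal (powProd f L 0 N η)) η) := by
    intro n hn
    have hn' := Finset.mem_range.1 hn
    rw [← lintegral_indicator hS,
      lintegral_comp_mul _ (by positivity : (0 : ℝ) < (L : ℝ) ^ (N - n)), ← mul_assoc,
      ← ENNReal.ofReal_mul (by positivity), ← pow_add, Nat.add_sub_cancel' hn'.le]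
    gcongr with η
    by_cases hη : (L : ℝ) ^ (N - n) * η ∈ S
    · rw [Set.indicator_of_mem hη, Set.indicator_of_mem (by exact hη),
        show (2 : ENNReal) = ENNReal.ofReal 2 by simp, ← ENNReal.ofReal_mul (by norm_num)]
      apply ENNReal.ofReal_le_ofReal
      have h2 := powProd_mul (f := f) (L := L) (Nat.zero_le (N - n)) (Nat.sub_le N n) η
      have h3 := powProd_scale (f := f) (L := L) (N - n) n η
      rw [Nat.sub_add_cancel hn'.le] at h3
      have h4 : 1 / 2 ≤ powProd f L 0 (N - n) η := by
        refine half_le_powProd hL h0 h1 hc hf _ ?_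
        have := hη.2
        rwa [abs_mul, abs_of_pos (by positivity)] at this
      rw [← h2, h3]
      have h5 := powProd_nonneg h0 (L := L) 0 n ((L : ℝ) ^ (N - n) * η)
      nlinarith
    · rw [Set.indicator_of_notMem hη]
      exact zero_le
  have hmeas2 : ∀ n, Measurable fun η => 2 * (((fun η => (L : ℝ) ^ (N - n) * η) ⁻¹' S).indicator
          (fun η => ENNReal.ofReal (powProd f L 0 N η)) η) := fun n =>
    ((hmeas N).indicator (hS.preimage (by fun_prop))).const_mul 2
  refine (Finset.sum_le_sum hterm).trans ?_
  rw [← Finset.mul_sum, ← lintegral_finsetSum _ fun n _ => hmeas2 n]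
  have hpt : ∀ η, ∑ n ∈ Finset.range N, 2 * (((fun η => (L : ℝ) ^ (N - n) * η) ⁻¹' S).indicator
      (fun η => ENNReal.ofReal (powProd f L 0 N η)) η) ≤
      ENNReal.ofReal (2 * (m + 1)) * (Set.Icc (-1 : ℝ) 1).indicator
        (fun η => ENNReal.ofReal (powProd f L 0 N η)) η := by
    intro η
    have hflt : ∑ n ∈ Finset.range N, 2 * (((fun η => (L : ℝ) ^ (N - n) * η) ⁻¹' S).indicator
        (fun η => ENNReal.ofReal (powProd f L 0 N η)) η) =
        (((Finset.range N).filter fun n => (L : ℝ) ^ (N - n) * η ∈ S).card : ENNReal) *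
          (2 * ENNReal.ofReal (powProd f L 0 N η)) := by
      rw [← nsmul_eq_mul, ← Finset.sum_const, Finset.sum_filter]
      refine Finset.sum_congr rfl fun n _ => ?_
      by_cases hη : (L : ℝ) ^ (N - n) * η ∈ S
      · rw [Set.indicator_of_mem (by exact hη), if_pos hη]
      · rw [Set.indicator_of_notMem (by exact hη), if_neg hη, mul_zero]
    rw [hflt]
    by_cases hη : η ∈ Set.Icc (-1 : ℝ) 1
    · rw [Set.indicator_of_mem hη, ← mul_assoc]
      gcongr
      have h2 := card_annuli_le hL hc1 m ((Finset.range N).image fun n => N - n) η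
      have h3 : ((Finset.range N).filter fun n => (L : ℝ) ^ (N - n) * η ∈ S).card ≤ m + 1 := by
        refine le_trans ?_ h2
        refine Finset.card_le_card_of_injOn (fun n => N - n) ?_ ?_
        · intro n hn
          have := Finset.mem_filter.1 hn
          exact Finset.mem_filter.2 ⟨Finset.mem_image_of_mem _ this.1, this.2⟩
        · intro a ha b hb hab
          have h1 := Finset.mem_range.1 (Finset.mem_filter.1 ha).1
          have h2 := Finset.mem_range.1 (Finset.mem_filter.1 hb).1
          simp only at hab
          omega
      calc (((Finset.range N).filter fun n => (L : ℝ) ^ (N - n) * η ∈ S).card : ENNReal) * 2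
          ≤ ((m + 1 : ℕ) : ENNReal) * 2 := by gcongr
        _ = ENNReal.ofReal (2 * (m + 1)) := by
          rw [← ENNReal.ofReal_natCast, ← ENNReal.ofReal_ofNat 2,
            ← ENNReal.ofReal_mul (by positivity)]
          push_cast
          rw [mul_comm]
    · have : ((Finset.range N).filter fun n => (L : ℝ) ^ (N - n) * η ∈ S) = ∅ := by
        refine Finset.filter_false_of_mem fun n _ hmem => hη ?_
        have h2 := hmem.2
        rw [abs_mul, abs_of_pos (by positivity)] at h2
        have h3 : (1 : ℝ) ≤ (L : ℝ) ^ (N - n) := one_le_pow₀ (by exact_mod_cast (by omega : 1 ≤ L))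
        have h4 : |η| ≤ 1 := by nlinarith [abs_nonneg η]
        exact Set.mem_Icc.2 (abs_le.1 h4)
      rw [this]
      simp
  calc _ ≤ ENNReal.ofReal ((L : ℝ) ^ N) * ∫⁻ η, ENNReal.ofReal (2 * (m + 1)) *
        (Set.Icc (-1 : ℝ) 1).indicator (fun η => ENNReal.ofReal (powProd f L 0 N η)) η := by
        gcongr with η
        exact hpt η
    _ = _ := by
      rw [lintegral_const_mul _ ((hmeas N).indicator measurableSet_Icc),
        lintegral_indicator measurableSet_Icc,
        ofReal_setIntegral (continuous_powProd hfc 0 N) (powProd_nonneg h0 _ _),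
        ← ENNReal.ofReal_mul (by positivity), ← ENNReal.ofReal_mul (by positivity)]
      congr 1
      ring

end Tail

/-! ### Averages over directions -/

section Polar

theorem lintegral_even_le {g : ℝ → ENNReal} (hg : ∀ x, g (-x) = g x) :
    ∫⁻ x, g x = 2 * ∫⁻ x in Set.Ioi 0, g x := by
  have h1 : ∫⁻ x in Set.Iic 0, g x = ∫⁻ x in Set.Ioi 0, g x := by
    rw [setLIntegral_congr Iio_ae_eq_Iic.symm]
    have := (Measure.measurePreserving_neg (volume : Measure ℝ)).setLIntegral_comp_preimage_emb
      (Homeomorph.neg ℝ).measurableEmbedding g (Set.Iio 0)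
    rw [← this]
    simp [hg]
  rw [← lintegral_add_compl g (measurableSet_Iic (a := (0 : ℝ))), Set.compl_Iic, h1, two_mul]

/-- Averaging over all directions turns a line integral along the annulus into a plane integral. -/
theorem lintegral_polar_le {L : ℕ} {c : ℝ} (hL : 0 < L) (hc : c ≤ 1) (m : ℕ) {F G : ℝ → ENNReal}
    (hF : Measurable F) (hG : Measurable G) (hF' : ∀ x, F (-x) = F x) (hG' : ∀ x, G (-x) = G x) :
    ∫⁻ θ in Set.Icc 0 Real.pi, ∫⁻ ξ in annulus L c m, F (ξ * Real.cos θ) * G (ξ * Real.sin θ) ≤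
      ENNReal.ofReal (2 * (L : ℝ) ^ m) *
        ((∫⁻ u in Set.Icc (-1 : ℝ) 1, F u) * ∫⁻ v in Set.Icc (-1 : ℝ) 1, G v) := by
  have hL0 : (0 : ℝ) < (L : ℝ) ^ m := by positivity
  set I := Set.Icc (-1 : ℝ) 1
  set f : ℝ × ℝ → ENNReal := fun p => I.indicator F p.1 * I.indicator G p.2 with hf
  have hfm : Measurable f :=
    ((hF.indicator measurableSet_Icc).comp measurable_fst).mul
      ((hG.indicator measurableSet_Icc).comp measurable_snd)
  have h1 : ∫⁻ p, f p = (∫⁻ u in I, F u) * ∫⁻ v in I, G v := by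
    rw [Measure.volume_eq_prod, lintegral_prod_mul
      (hF.indicator measurableSet_Icc).aemeasurable (hG.indicator measurableSet_Icc).aemeasurable,
      lintegral_indicator measurableSet_Icc, lintegral_indicator measurableSet_Icc]
  have h2 := lintegral_comp_polarCoord_symm f
  rw [h1] at h2
  rw [← h2, polarCoord_target, Measure.volume_eq_prod, ← Measure.prod_restrict,
    lintegral_prod_symm' _ (by
      have : Measurable fun p : ℝ × ℝ => polarCoord.symm p := by
        simp only [polarCoord_symm_apply]; fun_prop
      exact (by fun_prop : Measurable fun p : ℝ × ℝ => ENNReal.ofReal p.1).smul (hfm.comp this))]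
  have hin : ∀ θ : ℝ, ∫⁻ ξ in annulus L c m, F (ξ * Real.cos θ) * G (ξ * Real.sin θ) ≤
      ENNReal.ofReal (2 * (L : ℝ) ^ m) * ∫⁻ x in Set.Ioi 0,
        ENNReal.ofReal x • f (polarCoord.symm (x, θ)) := by
    intro θ
    rw [← lintegral_indicator (measurableSet_annulus _ _ _), lintegral_even_le (by
      intro x
      by_cases hx : x ∈ annulus L c m
      · rw [Set.indicator_of_mem hx, Set.indicator_of_mem (by
          simpa [annulus, abs_neg] using hx), neg_mul, neg_mul, hF', hG']
      · rw [Set.indicator_of_notMem hx, Set.indicator_of_notMem (by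
          simpa [annulus, abs_neg] using hx)]),
      ENNReal.ofReal_mul (by norm_num), ENNReal.ofReal_ofNat, mul_assoc,
      ← lintegral_const_mul' _ _ ENNReal.ofReal_ne_top]
    gcongr 2 * ?_
    refine setLIntegral_mono' measurableSet_Ioi fun x hx => ?_
    by_cases hxa : x ∈ annulus L c m
    · have hx0 : (0 : ℝ) < x := hx
      have h3 := hxa.1
      have h4 := hxa.2.trans hc
      rw [abs_of_pos hx0] at h3 h4
      have hI : ∀ t : ℝ, |t| ≤ 1 → x * t ∈ I := fun t ht => by
        refine Set.mem_Icc.2 (abs_le.1 ?_)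
        rw [abs_mul, abs_of_pos hx0]
        exact mul_le_one₀ h4 (abs_nonneg _) ht
      rw [Set.indicator_of_mem hxa, polarCoord_symm_apply]
      simp only [hf]
      rw [Set.indicator_of_mem (hI _ (Real.abs_cos_le_one θ)),
        Set.indicator_of_mem (hI _ (Real.abs_sin_le_one θ)), smul_eq_mul, ← mul_assoc,
        ← ENNReal.ofReal_mul hL0.le]
      refine le_mul_of_one_le_left zero_le ?_
      rw [ENNReal.one_le_ofReal]
      rwa [inv_le_iff_one_le_mul₀' hL0] at h3
    · rw [Set.indicator_of_notMem hxa]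
      exact zero_le
  calc _ ≤ ∫⁻ θ in Set.Icc 0 Real.pi, ENNReal.ofReal (2 * (L : ℝ) ^ m) * ∫⁻ x in Set.Ioi 0,
        ENNReal.ofReal x • f (polarCoord.symm (x, θ)) := lintegral_mono fun θ => hin θ
    _ = ENNReal.ofReal (2 * (L : ℝ) ^ m) * ∫⁻ θ in Set.Ico 0 Real.pi, ∫⁻ x in Set.Ioi 0,
        ENNReal.ofReal x • f (polarCoord.symm (x, θ)) := by
      rw [lintegral_const_mul' _ _ ENNReal.ofReal_ne_top, setLIntegral_congr Ico_ae_eq_Icc.symm]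
    _ ≤ _ := by
      refine mul_le_mul_right (lintegral_mono_set fun θ hθ => ?_) _
      exact ⟨by linarith [hθ.1, Real.pi_pos], hθ.2⟩

end Polar

/-! ### Salem's inequality for the high-frequency factors -/

section SalemInequality

variable {G : Type} [AddCommMonoid G] [DecidableEq G] {L : ℕ} {D : Finset G} {l : G →+ ℝ}

/-- Salem's positivity argument: the measure of `Γ` is bounded by the integral of any majorant of the
high-frequency factors on the difference set of `Γ`. -/
theorem measure_mul_pow_le (hU : UniqueDigits L D) (hD : D.card = L) (hL : 0 < L) {Γ : Set ℝ}
    (hΓm : MeasurableSet Γ) (hΓ : volume Γ ≠ ⊤) {m n : ℕ} (hmn : m ≤ n) {Ψ : ℝ → ENNReal}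
    (hΨ : ∀ x ∈ Γ, ∀ y ∈ Γ, ENNReal.ofReal (powProd (powerSpec D l) L m n (x - y)) ≤ Ψ (x - y)) :
    ENNReal.ofReal (volume.real Γ * (L : ℝ) ^ m) ≤ ENNReal.ofReal ((L : ℝ) ^ n) * ∫⁻ η, Ψ η := by
  have hDne : D.Nonempty := Finset.card_pos.1 (by omega)
  have hL0 : (0 : ℝ) < L := by exact_mod_cast hL
  set g := powProd (powerSpec D l) L m n with hg
  have hgc : Continuous g := continuous_powProd (continuous_powerSpec _ _) _ _
  have hg0 : ∀ u, 0 ≤ g u := powProd_nonneg (powerSpec_nonneg _ _) _ _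
  have hg1 : ∀ u, g u ≤ 1 := powProd_le_one (powerSpec_nonneg _ _) (powerSpec_le_one _ _) _ _
  have h1 := card_mul_sq_le_integral (digitSum L D (n - m)) (fun w => (L : ℝ) ^ m * l w) hΓ
  have h2 : ∀ u, ‖expSum (digitSum L D (n - m)) (fun w => (L : ℝ) ^ m * l w) u‖ ^ 2 =
      ((L : ℝ) ^ (n - m)) ^ 2 * g u := by
    intro u
    have h3 : expSum (digitSum L D (n - m)) (fun w => (L : ℝ) ^ m * l w) u =
        expSum (digitSum L D (n - m)) l ((L : ℝ) ^ m * u) := by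
      unfold expSum
      refine Finset.sum_congr rfl fun w _ => ?_
      congr 1; ring
    rw [h3, norm_expSum_digitSum l hU hDne, hD, hg, ← powProd_scale, Nat.add_sub_cancel' hmn]
  simp_rw [h2] at h1
  simp_rw [integral_const_mul] at h1
  rw [hU, hD, Nat.cast_pow] at h1
  set I := ∫ y in Γ, ∫ x in Γ, g (x - y) with hI
  have hpos : (0 : ℝ) < (L : ℝ) ^ (n - m) := by positivity
  have h4 : volume.real Γ ^ 2 ≤ (L : ℝ) ^ (n - m) * I := by
    refine le_of_mul_le_mul_left ?_ hpos
    linarith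
  have hin : ∀ y ∈ Γ, ENNReal.ofReal (∫ x in Γ, g (x - y)) ≤ ∫⁻ η, Ψ η := by
    intro y hy
    rw [ofReal_integral_eq_lintegral_ofReal]
    · calc _ ≤ ∫⁻ x in Γ, Ψ (x - y) := setLIntegral_mono' hΓm fun x hx => hΨ x hx y hy
        _ ≤ ∫⁻ x, Ψ (x - y) := setLIntegral_le_lintegral _ _
        _ = _ := lintegral_sub_right_eq_self Ψ y
    · exact Measure.integrableOn_of_bounded (M := 1) hΓ
        (by fun_prop : Continuous fun x => g (x - y)).aestronglyMeasurable
        (Filter.Eventually.of_forall fun x => by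
          rw [Real.norm_of_nonneg (hg0 _)]; exact hg1 _)
    · exact Filter.Eventually.of_forall fun x => hg0 _
  have h5 : ENNReal.ofReal I ≤ volume Γ * ∫⁻ η, Ψ η := by
    rcases eq_or_ne (∫⁻ η, Ψ η) ⊤ with h | h
    · rcases eq_or_ne (volume Γ) 0 with h6 | h6
      · rw [hI, Measure.restrict_eq_zero.2 h6]; simp
      · rw [h, ENNReal.mul_top h6]; exact le_top
    · have h6 : ∀ y ∈ Γ, ‖∫ x in Γ, g (x - y)‖ ≤ (∫⁻ η, Ψ η).toReal := by
        intro y hy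
        rw [Real.norm_of_nonneg (integral_nonneg fun x => hg0 _)]
        exact (ENNReal.ofReal_le_iff_le_toReal h).1 (hin y hy)
      have h7 := (le_abs_self _).trans (norm_setIntegral_le_of_norm_le_const hΓ.lt_top h6)
      calc ENNReal.ofReal I ≤ ENNReal.ofReal ((∫⁻ η, Ψ η).toReal * volume.real Γ) :=
            ENNReal.ofReal_le_ofReal h7
        _ = _ := by
            rw [ENNReal.ofReal_mul ENNReal.toReal_nonneg, ENNReal.ofReal_toReal h, mul_comm,
              measureReal_def, ENNReal.ofReal_toReal hΓ]
  rcases eq_or_ne (volume Γ) 0 with h6 | h6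
  · rw [measureReal_def, h6]; simp
  have hv : volume Γ = ENNReal.ofReal (volume.real Γ) := (ENNReal.ofReal_toReal hΓ).symm
  rw [← ENNReal.mul_le_mul_iff_right h6 hΓ]
  calc volume Γ * ENNReal.ofReal (volume.real Γ * (L : ℝ) ^ m)
      = ENNReal.ofReal (volume.real Γ ^ 2 * (L : ℝ) ^ m) := by
        rw [hv, ← ENNReal.ofReal_mul measureReal_nonneg]
        congr 1
        ring
    _ ≤ ENNReal.ofReal ((L : ℝ) ^ n * I) := by
        apply ENNReal.ofReal_le_ofReal
        calc _ ≤ (L : ℝ) ^ (n - m) * I * (L : ℝ) ^ m := by gcongr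
          _ = (L : ℝ) ^ (n - m + m) * I := by rw [pow_add]; ring
          _ = _ := by rw [Nat.sub_add_cancel hmn]
    _ = ENNReal.ofReal ((L : ℝ) ^ n) * ENNReal.ofReal I := ENNReal.ofReal_mul (by positivity)
    _ ≤ ENNReal.ofReal ((L : ℝ) ^ n) * (volume Γ * ∫⁻ η, Ψ η) := by gcongr
    _ = _ := by ring

/-- Few close pairs mean a small `L²` norm. -/
theorem pow_mul_integral_powProd_le (hU : UniqueDigits L D) (hD : D.card = L) (hL : 0 < L)
    {C R M : ℝ} (hC0 : 0 ≤ C) {n : ℕ}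
    (hC : ∫ ξ in Set.Icc (-1) 1, ‖expSum (digitSum L D n) l ξ‖ ^ 2 ≤
      C * (closePairs l R (digitSum L D n)).card)
    (hM : ((closePairs l R (digitSum L D n)).card : ℝ) ≤ M * (L : ℝ) ^ n) :
    (L : ℝ) ^ n * ∫ ξ in Set.Icc (-1 : ℝ) 1, powProd (powerSpec D l) L 0 n ξ ≤ C * M := by
  have hDne : D.Nonempty := Finset.card_pos.1 (by omega)
  have hL0 : (0 : ℝ) < L := by exact_mod_cast hL
  simp_rw [norm_expSum_digitSum l hU hDne, hD] at hC
  rw [integral_const_mul] at hC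
  have hpos : (0 : ℝ) < (L : ℝ) ^ n := by positivity
  refine le_of_mul_le_mul_left ?_ hpos
  calc _ = ((L : ℝ) ^ n) ^ 2 * ∫ ξ in Set.Icc (-1 : ℝ) 1, powProd (powerSpec D l) L 0 n ξ := by ring
    _ ≤ C * (M * (L : ℝ) ^ n) := hC.trans (by gcongr)
    _ = _ := by ring

/-- The high-frequency factors near the origin are a rescaled full product. -/
theorem pow_mul_lintegral_central_le {f : ℝ → ℝ} (hf : Continuous f) (h0 : ∀ u, 0 ≤ f u)
    (hL : 0 < L) {m n : ℕ} (hmn : m ≤ n) :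
    ENNReal.ofReal ((L : ℝ) ^ n) * ∫⁻ η in Set.Icc (-((L : ℝ) ^ m)⁻¹) ((L : ℝ) ^ m)⁻¹,
        ENNReal.ofReal (powProd f L m n η) =
      ENNReal.ofReal ((L : ℝ) ^ (n - m) * ∫ ξ in Set.Icc (-1 : ℝ) 1, powProd f L 0 (n - m) ξ) := by
  have hL0 : (0 : ℝ) < (L : ℝ) ^ m := by positivity
  have h1 : 0 ≤ ((L : ℝ) ^ m)⁻¹ := by positivity
  rw [ofReal_setIntegral (continuous_powProd hf _ _) (powProd_nonneg h0 _ _),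
    integral_powProd_scaled hL f m n hmn _ _ (by linarith), ← ENNReal.ofReal_mul (by positivity),
    mul_neg, mul_inv_cancel₀ hL0.ne', ← mul_assoc]
  congr 2
  rw [← div_eq_mul_inv, div_eq_iff hL0.ne', ← pow_add, Nat.sub_add_cancel hmn]

end SalemInequality

/-! ### Product sets -/

section ProductSets

/-- The projection `(a, b) ↦ a cos θ + b sin θ` on pairs of digits. -/
noncomputable def projHom (θ : ℝ) : ℕ × ℕ →+ ℝ :=
  ((AddMonoidHom.mulRight (Real.cos θ)).comp (Nat.castAddMonoidHom ℝ)).coprod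
    ((AddMonoidHom.mulRight (Real.sin θ)).comp (Nat.castAddMonoidHom ℝ))

theorem projHom_apply (θ : ℝ) (w : ℕ × ℕ) :
    projHom θ w = w.1 * Real.cos θ + w.2 * Real.sin θ := rfl

variable {A B : Finset ℕ} {L : ℕ}

theorem expSum_product (θ ξ : ℝ) : expSum (A ×ˢ B) (projHom θ) ξ =
    expSum A (fun a => (a : ℝ)) (ξ * Real.cos θ) * expSum B (fun b => (b : ℝ)) (ξ * Real.sin θ) := by
  unfold expSum
  rw [Finset.sum_mul_sum, Finset.sum_product]
  refine Finset.sum_congr rfl fun a _ => Finset.sum_congr rfl fun b _ => ?_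
  rw [← expi_add, projHom_apply]
  congr 1
  ring

theorem powProd_product (θ : ℝ) (i j : ℕ) (ξ : ℝ) :
    powProd (powerSpec (A ×ˢ B) (projHom θ)) L i j ξ =
      powProd (powerSpec A fun a => (a : ℝ)) L i j (ξ * Real.cos θ) *
        powProd (powerSpec B fun b => (b : ℝ)) L i j (ξ * Real.sin θ) := by
  unfold powProd
  rw [← Finset.prod_mul_distrib]
  refine Finset.prod_congr rfl fun k _ => ?_
  unfold powerSpec
  rw [expSum_product, norm_mul, mul_pow, Finset.card_product, Nat.cast_mul, mul_pow,
    mul_div_mul_comm, mul_assoc, mul_assoc]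

theorem digitSum_product (n : ℕ) :
    digitSum L (A ×ˢ B) n = digitSum L A n ×ˢ digitSum L B n := by
  induction n with
  | zero => rfl
  | succ n ih =>
    rw [digitSum, ih, digitSum, digitSum]
    ext ⟨x, y⟩
    simp only [Finset.mem_image, Finset.mem_product, Prod.exists, Prod.mk.injEq, Prod.smul_mk,
      Prod.mk_add_mk]
    constructor
    · rintro ⟨u, v, a, b, ⟨⟨hu, hv⟩, ha, hb⟩, rfl, rfl⟩
      exact ⟨⟨u, a, ⟨hu, ha⟩, rfl⟩, v, b, ⟨hv, hb⟩, rfl⟩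
    · rintro ⟨⟨u, a, ⟨hu, ha⟩, rfl⟩, v, b, ⟨hv, hb⟩, rfl⟩
      exact ⟨u, v, a, b, ⟨⟨hu, hv⟩, ha, hb⟩, rfl, rfl⟩

theorem UniqueDigits.of_product (hA : A.Nonempty) (hB : B.Nonempty)
    (h : UniqueDigits L (A ×ˢ B)) : UniqueDigits L A ∧ UniqueDigits L B := by
  have key : ∀ n, (digitSum L A n).card = A.card ^ n ∧ (digitSum L B n).card = B.card ^ n := by
    intro n
    have h1 := h n
    rw [digitSum_product, Finset.card_product, Finset.card_product, mul_pow] at h1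
    have h2 := card_digitSum_le (L := L) (D := A) n
    have h3 := card_digitSum_le (L := L) (D := B) n
    have h4 : 0 < A.card ^ n := pow_pos hA.card_pos n
    have h5 : 0 < B.card ^ n := pow_pos hB.card_pos n
    constructor
    · refine le_antisymm h2 (le_of_mul_le_mul_right ?_ h5)
      rw [← h1]
      exact Nat.mul_le_mul_left _ h3
    · refine le_antisymm h3 (le_of_mul_le_mul_left ?_ h4)
      rw [← h1]
      exact Nat.mul_le_mul_right _ h2
  exact ⟨fun n => (key n).1, fun n => (key n).2⟩

/-- The set `s E` has a translate that meets `Γ` in a set of proportional measure. -/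
theorem exists_translate {E Γ : Set ℝ} (hE : MeasurableSet E) (hE1 : E ⊆ Set.Icc 0 1)
    (hΓm : MeasurableSet Γ) (hΓ : Γ ⊆ Set.Icc 0 1) {s : ℝ} (hs : |s| ≤ 1) :
    ∃ a : ℝ, volume.real E * volume.real Γ / 4 ≤ volume.real {ξ | ξ ∈ E ∧ a + ξ * s ∈ Γ} := by
  by_contra! hcon
  have hEfin : volume E < ⊤ := (measure_mono hE1).trans_lt (by simp)
  have hΓfin : volume Γ < ⊤ := (measure_mono hΓ).trans_lt (by simp)
  have hm : Measurable (Γ.indicator fun _ => (1 : ENNReal)) := measurable_one.indicator hΓm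
  have h1 : ∀ a : ℝ, ∫⁻ ξ in E, Γ.indicator (fun _ => 1) (a + ξ * s) ≤
      ENNReal.ofReal (volume.real E * volume.real Γ / 4) := by
    intro a
    have hpre : MeasurableSet {ξ | a + ξ * s ∈ Γ} :=
      (by fun_prop : Measurable fun ξ : ℝ => a + ξ * s) hΓm
    have h2 : ∀ ξ, Γ.indicator (fun _ => (1 : ENNReal)) (a + ξ * s) =
        {ξ | a + ξ * s ∈ Γ}.indicator (fun _ => 1) ξ := fun ξ => rfl
    simp_rw [h2]
    rw [lintegral_indicator hpre, lintegral_one, Measure.restrict_restrict hpre,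
      Measure.restrict_apply_univ]
    have h3 := (hcon a).le
    rw [measureReal_def] at h3
    have h4 : {ξ | a + ξ * s ∈ Γ} ∩ E = {ξ | ξ ∈ E ∧ a + ξ * s ∈ Γ} := by
      ext; simp [and_comm]
    rw [h4]
    refine (ENNReal.le_ofReal_iff_toReal_le ?_ (by positivity)).2 h3
    exact ((measure_mono (t := E) fun x hx => hx.1).trans_lt hEfin).ne
  have h2 : ∫⁻ a in Set.Icc (-1 : ℝ) 2, ∫⁻ ξ in E, Γ.indicator (fun _ => 1) (a + ξ * s) =
      volume E * volume Γ := by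
    rw [lintegral_lintegral_swap]
    · have h3 : ∀ ξ ∈ E, ∫⁻ a in Set.Icc (-1 : ℝ) 2, Γ.indicator (fun _ => (1 : ENNReal)) (a + ξ * s) =
          volume Γ := by
        intro ξ hξ
        rw [← lintegral_indicator measurableSet_Icc]
        calc _ = ∫⁻ a, Γ.indicator (fun _ => (1 : ENNReal)) (a + ξ * s) := by
              refine lintegral_congr fun a => ?_
              by_cases h : a ∈ Set.Icc (-1 : ℝ) 2
              · rw [Set.indicator_of_mem h]
              · rw [Set.indicator_of_notMem h, Set.indicator_of_notMem]
                intro h5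
                apply h
                have h6 := hΓ h5
                have h7 := hE1 hξ
                have h8 : |ξ * s| ≤ 1 := by
                  rw [abs_mul, abs_of_nonneg h7.1]
                  exact mul_le_one₀ h7.2 (abs_nonneg _) hs
                have h9 := abs_le.1 h8
                exact ⟨by linarith [h6.1], by linarith [h6.2]⟩
          _ = _ := by
              rw [lintegral_add_right_eq_self (Γ.indicator fun _ => (1 : ENNReal)),
                lintegral_indicator hΓm, lintegral_one, Measure.restrict_apply_univ]
      rw [setLIntegral_congr_fun hE h3, lintegral_const, Measure.restrict_apply_univ, mul_comm]
    · exact (hm.comp (by fun_prop : Measurable fun p : ℝ × ℝ => p.1 + p.2 * s)).aemeasurable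
  have h3 : volume E * volume Γ ≤ ENNReal.ofReal (volume.real E * volume.real Γ / 4) * 3 := by
    rw [← h2]
    calc _ ≤ ∫⁻ a in Set.Icc (-1 : ℝ) 2, ENNReal.ofReal (volume.real E * volume.real Γ / 4) :=
          lintegral_mono fun a => h1 a
      _ = _ := by
          rw [lintegral_const, Measure.restrict_apply_univ, Real.volume_Icc]
          norm_num
  have h4 : volume.real E * volume.real Γ ≤ volume.real E * volume.real Γ / 4 * 3 := by
    have h5 := ENNReal.toReal_mono (by finiteness) h3
    rw [ENNReal.toReal_mul, ENNReal.toReal_mul, ENNReal.toReal_ofReal (by positivity)] at h5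
    simpa [measureReal_def] using h5
  have h5 := hcon 0
  have h6 : 0 ≤ volume.real {ξ | ξ ∈ E ∧ 0 + ξ * s ∈ Γ} := measureReal_nonneg
  linarith

/-- A large set of parameters on the line in direction `θ` such that the two coordinates of the
differences of its points lie in the difference sets of `ΓA` and `ΓB`. -/
theorem exists_line_set {ΓA ΓB : Set ℝ} (hAm : MeasurableSet ΓA) (hA : ΓA ⊆ Set.Icc 0 1)
    (hBm : MeasurableSet ΓB) (hB : ΓB ⊆ Set.Icc 0 1) {c : ℝ} (hc0 : 0 ≤ c) (hc1 : c ≤ 1) (θ : ℝ) :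
    ∃ Γ ⊆ Set.Icc 0 c, MeasurableSet Γ ∧ c * volume.real ΓA * volume.real ΓB / 16 ≤ volume.real Γ ∧
      ∀ x ∈ Γ, ∀ y ∈ Γ,
        (∃ x' ∈ ΓA, ∃ y' ∈ ΓA, (x - y) * Real.cos θ = x' - y') ∧
        (∃ x' ∈ ΓB, ∃ y' ∈ ΓB, (x - y) * Real.sin θ = x' - y') := by
  have hc1' : Set.Icc 0 c ⊆ Set.Icc 0 1 := Set.Icc_subset_Icc le_rfl hc1
  obtain ⟨a, ha⟩ := exists_translate measurableSet_Icc hc1' hAm hA (Real.abs_cos_le_one θ)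
  set E := {ξ | ξ ∈ Set.Icc 0 c ∧ a + ξ * Real.cos θ ∈ ΓA} with hEdef
  have hE : MeasurableSet E := measurableSet_Icc.inter
    ((by fun_prop : Measurable fun ξ : ℝ => a + ξ * Real.cos θ) hAm)
  have hEs : E ⊆ Set.Icc 0 c := fun x hx => hx.1
  obtain ⟨b, hb⟩ := exists_translate hE (hEs.trans hc1') hBm hB (Real.abs_sin_le_one θ)
  refine ⟨_, fun x hx => hEs hx.1, hE.inter
    ((by fun_prop : Measurable fun ξ : ℝ => b + ξ * Real.sin θ) hBm), le_trans ?_ hb, ?_⟩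
  · rw [Real.volume_real_Icc_of_le hc0, sub_zero] at ha
    have : 0 ≤ volume.real ΓB := measureReal_nonneg
    nlinarith
  · intro x hx y hy
    exact ⟨⟨_, hx.1.2, _, hy.1.2, by ring⟩, _, hx.2, _, hy.2, by ring⟩

end ProductSets

/-! ### Difference sets with large low-frequency factors -/

section LowerBoundSet

/-- Large sets on whose difference sets the low-frequency product is at least `α ^ m`, except near the
rationals with denominator `R L^m`. -/
theorem exists_lower_bound_set {A : Finset ℕ} {b : ℕ} (hA : 2 ≤ A.card) (hb : 2 ≤ b)
    (hroots : UnitRootsAreRootsOfUnity A) {L : ℕ} (hL : L = A.card * b)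
    (hD : DivisorCondition L A) :
    ∃ (R : ℕ) (α c' : ℝ), 0 < R ∧ 0 < α ∧ 0 < c' ∧ ∀ m : ℕ, 1 ≤ m → ∃ Γ ⊆ Set.Icc (0 : ℝ) 1,
      MeasurableSet Γ ∧ c' * (((b : ℝ) + 1) / L) ^ m ≤ volume.real Γ ∧
      ∀ x ∈ Γ, ∀ y ∈ Γ, ((L : ℝ) ^ (3 * L * m))⁻¹ ≤ ‖expi ((R * L ^ m : ℕ) * (x - y)) - 1‖ →
        α ^ m ≤ powProd (powerSpec A fun a => (a : ℝ)) L 0 m (x - y) := by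
  subst hL
  obtain ⟨X, S, i, D, c, c', hS, hi, hc, hc', hX, hΓ⟩ := exists_admissible hA hb hroots hD
  set L := A.card * b
  have hL : 0 < L := by positivity
  have hL0 : (0 : ℝ) < L := by exact_mod_cast hL
  refine ⟨S * L ^ i, c * (((L : ℝ) ^ (3 * L))⁻¹ / (L : ℝ) ^ i / 2) ^ (D * i), c', by positivity,
    by positivity, hc', fun m hm => ?_⟩
  obtain ⟨Γ, hΓ1, hΓm, hΓv, hΓX⟩ := hΓ m
  refine ⟨Γ, hΓ1, hΓm, hΓv, fun x hx y hy hfar => ?_⟩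
  have h1 := le_powProd_of_far (powerSpec_nonneg _ _) hc.le hi hL hX m (hΓX x hx y hy)
    (h := ((L : ℝ) ^ (3 * L * m))⁻¹) (by positivity) (by
      convert hfar using 4
      push_cast
      ring)
  refine le_trans ?_ h1
  rw [mul_pow, ← pow_mul, mul_comm (D * i) m, pow_mul _ m]
  gcongr
  rw [div_div, div_pow, inv_pow, ← pow_mul, div_div]
  have h2 : (1 : ℝ) ≤ (L : ℝ) ^ i * 2 := by
    have : (1 : ℝ) ≤ (L : ℝ) ^ i := one_le_pow₀ (by exact_mod_cast hL)
    linarith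
  gcongr
  exact le_self_pow₀ h2 (by omega)

end LowerBoundSet

/-! ### Exceptional directions -/

section ExceptionalSet

/-- The integral of `F(ξ cos θ) G(ξ sin θ)` over the annulus, along the line in direction `θ`. -/
noncomputable def lineMass (L : ℕ) (c : ℝ) (m : ℕ) (F G : ℝ → ENNReal) (θ : ℝ) : ENNReal :=
  ∫⁻ ξ in annulus L c m, F (ξ * Real.cos θ) * G (ξ * Real.sin θ)

theorem measurable_lineMass (L : ℕ) (c : ℝ) (m : ℕ) {F G : ℝ → ENNReal} (hF : Measurable F)
    (hG : Measurable G) : Measurable (lineMass L c m F G) := by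
  have : Measurable fun p : ℝ × ℝ => F (p.2 * Real.cos p.1) * G (p.2 * Real.sin p.1) := by
    fun_prop
  exact this.lintegral_prod_right'

/-- The points of `[-1, 1]` at which `R u` is within about `L^{-q}` of an integer. -/
def nearRational (L R q : ℕ) : Set ℝ :=
  {u | u ∈ Set.Icc (-1 : ℝ) 1 ∧ ‖expi (R * u) - 1‖ < ((L : ℝ) ^ q)⁻¹}

theorem measurableSet_nearRational (L R q : ℕ) : MeasurableSet (nearRational L R q) := by
  have := continuous_expi
  exact measurableSet_Icc.inter
    (measurableSet_lt (by fun_prop : Continuous fun u : ℝ => ‖expi (R * u) - 1‖).measurable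
      measurable_const)

theorem neg_mem_nearRational {L R q : ℕ} {u : ℝ} (h : u ∈ nearRational L R q) :
    -u ∈ nearRational L R q := by
  refine ⟨⟨by linarith [h.1.2], by linarith [h.1.1]⟩, ?_⟩
  have h1 : expi (R * -u) - 1 = (starRingEnd ℂ) (expi (R * u) - 1) := by
    rw [mul_neg, expi_neg, map_sub, map_one]
  rw [h1, RCLike.norm_conj]
  exact h.2

/-- The product of the factors of the digit set `A` with index in `[m, n)`. -/
noncomputable def highPart (L : ℕ) (A : Finset ℕ) (m n : ℕ) (u : ℝ) : ENNReal :=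
  ENNReal.ofReal (powProd (powerSpec A fun a => (a : ℝ)) L m n u)

theorem measurable_highPart (L : ℕ) (A : Finset ℕ) (m n : ℕ) : Measurable (highPart L A m n) :=
  (continuous_powProd (continuous_powerSpec _ _) _ _).measurable.ennreal_ofReal

theorem highPart_neg (L : ℕ) (A : Finset ℕ) (m n : ℕ) (u : ℝ) :
    highPart L A m n (-u) = highPart L A m n u := by
  unfold highPart
  rw [powProd_neg (powerSpec_neg _ _)]

theorem indicator_highPart_neg (L : ℕ) (A : Finset ℕ) (m n R q : ℕ) (u : ℝ) :
    (nearRational L R q).indicator (highPart L A m n) (-u) =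
      (nearRational L R q).indicator (highPart L A m n) u := by
  by_cases h : u ∈ nearRational L R q
  · rw [Set.indicator_of_mem h, Set.indicator_of_mem (neg_mem_nearRational h), highPart_neg]
  · rw [Set.indicator_of_notMem h, Set.indicator_of_notMem]
    intro h1
    apply h
    simpa using neg_mem_nearRational h1

theorem measurable_indicator_highPart (L : ℕ) (A : Finset ℕ) (m n R q : ℕ) :
    Measurable ((nearRational L R q).indicator (highPart L A m n)) :=
  (measurable_highPart L A m n).indicator (measurableSet_nearRational L R q)

variable {A B : Finset ℕ} {L : ℕ}

/-- The plane integral that bounds the average over directions of the contribution of the frequencies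
with one nearly rational coordinate. The width `L^{-3 L m}` of the neighbourhoods outweighs the loss
of `L^{3 m}` elsewhere. -/
theorem lintegral_lintegral_nearRational_le (hUA : UniqueDigits L A) (hUB : UniqueDigits L B)
    (hA : 0 < A.card) (hB : 2 ≤ B.card) (hL : L = A.card * B.card) {m n R : ℕ} (hR : 0 < R)
    (hn : 3 * L * m ≤ n) :
    ENNReal.ofReal ((L : ℝ) ^ n) *
        ((∫⁻ u in Set.Icc (-1 : ℝ) 1,
          (nearRational L (R * L ^ m) (3 * L * m)).indicator (highPart L A m n) u) *
        ∫⁻ v in Set.Icc (-1 : ℝ) 1, highPart L B m n v) * ENNReal.ofReal (2 * (L : ℝ) ^ m) ≤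
      ENNReal.ofReal (20 * R) := by
  have hLpos : 0 < L := by rw [hL]; positivity
  have hAne : A.Nonempty := Finset.card_pos.1 hA
  have hBne : B.Nonempty := Finset.card_pos.1 (by omega)
  have hmq : m ≤ 3 * L * m := Nat.le_mul_of_pos_left _ (by positivity)
  set q := 3 * L * m with hq
  have h1 : ∫⁻ u in Set.Icc (-1 : ℝ) 1, (nearRational L (R * L ^ m) q).indicator
      (highPart L A m n) u ≤
      ENNReal.ofReal ((2 * (R * L ^ m : ℕ) + 3) * (((L : ℝ) ^ q)⁻¹ * (1 / (A.card : ℝ) ^ (n - q))))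
      := by
    refine le_trans ?_ (lintegral_smallSet_le hUA hAne hLpos (R := R * L ^ m) (by positivity)
      hmq hn)
    refine (setLIntegral_le_lintegral _ _).trans ?_
    rw [lintegral_indicator (measurableSet_nearRational _ _ _)]
    exact le_rfl
  have h2 := lintegral_powProd_Icc_le hUB hBne hLpos (hmq.trans hn)
  calc _ ≤ ENNReal.ofReal ((L : ℝ) ^ n) *
        (ENNReal.ofReal ((2 * (R * L ^ m : ℕ) + 3) * (((L : ℝ) ^ q)⁻¹ *
          (1 / (A.card : ℝ) ^ (n - q)))) *
        ENNReal.ofReal (2 * (1 / (B.card : ℝ) ^ (n - m)))) * ENNReal.ofReal (2 * (L : ℝ) ^ m) := by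
        gcongr
        exact h2
    _ = ENNReal.ofReal ((L : ℝ) ^ n * ((2 * (R * L ^ m : ℕ) + 3) * (((L : ℝ) ^ q)⁻¹ *
          (1 / (A.card : ℝ) ^ (n - q))) * (2 * (1 / (B.card : ℝ) ^ (n - m)))) *
            (2 * (L : ℝ) ^ m)) := by
        rw [← ENNReal.ofReal_mul (by positivity), ← ENNReal.ofReal_mul (by positivity),
          ← ENNReal.ofReal_mul (by positivity)]
    _ ≤ _ := by
        apply ENNReal.ofReal_le_ofReal
        set a := (A.card : ℝ) with ha
        set b := (B.card : ℝ) with hb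
        have ha0 : 1 ≤ a := by rw [ha]; exact_mod_cast hA
        have hb0 : 2 ≤ b := by rw [hb]; exact_mod_cast hB
        have hLab : (L : ℝ) = a * b := by rw [hL]; push_cast; rfl
        have hL1 : 1 ≤ (L : ℝ) := by exact_mod_cast hLpos
        have hLm : 1 ≤ (L : ℝ) ^ m := one_le_pow₀ hL1
        have hR1 : (1 : ℝ) ≤ R := by exact_mod_cast hR
        have hsplit : ∀ x : ℝ, ∀ k, k ≤ n → x ^ n = x ^ k * x ^ (n - k) := fun x k hk => by
          rw [← pow_add, Nat.add_sub_cancel' hk]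
        have e1 : (L : ℝ) ^ n * ((2 * (R * L ^ m : ℕ) + 3) * (((L : ℝ) ^ q)⁻¹ *
          (1 / a ^ (n - q))) * (2 * (1 / b ^ (n - m)))) * (2 * (L : ℝ) ^ m) =
            (2 * (R * (L : ℝ) ^ m) + 3) * 4 * (L : ℝ) ^ m * b ^ m / b ^ q := by
          have : (L : ℝ) ^ n = (a ^ q * a ^ (n - q)) * (b ^ m * b ^ (n - m)) := by
            rw [← hsplit _ _ hn, ← hsplit _ _ (hmq.trans hn), hLab, mul_pow]
          rw [this, hLab, mul_pow _ _ q]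
          push_cast
          rw [hLab]
          have : a ≠ 0 := by positivity
          have : b ≠ 0 := by positivity
          field_simp
          ring
        rw [e1, div_le_iff₀ (by positivity)]
        have e2 : 2 * (R * (L : ℝ) ^ m) + 3 ≤ 5 * R * (L : ℝ) ^ m := by nlinarith
        have e3 : b ^ m ≤ (L : ℝ) ^ m := by
          apply pow_le_pow_left₀ (by linarith)
          rw [hLab]; nlinarith
        have e4 : ((L : ℝ) ^ m) ^ 3 ≤ b ^ q := by
          calc ((L : ℝ) ^ m) ^ 3 = (L : ℝ) ^ (m * 3) := (pow_mul _ _ _).symm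
            _ ≤ ((2 : ℝ) ^ L) ^ (m * 3) := by
                gcongr
                exact_mod_cast (Nat.lt_two_pow_self (n := L)).le
            _ = 2 ^ q := by rw [← pow_mul, hq]; congr 1; ring
            _ ≤ b ^ q := by gcongr
        calc (2 * (R * (L : ℝ) ^ m) + 3) * 4 * (L : ℝ) ^ m * b ^ m
            ≤ (5 * R * (L : ℝ) ^ m) * 4 * (L : ℝ) ^ m * (L : ℝ) ^ m := by gcongr
          _ = 20 * R * ((L : ℝ) ^ m) ^ 3 := by ring
          _ ≤ _ := by gcongr

/-- Salem's inequality, with the difference set split into the central part, the part with one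
nearly rational coordinate and the part where the low-frequency factors are bounded below. -/
theorem mul_pow_le_split (hU : UniqueDigits L (A ×ˢ B)) (hD : (A ×ˢ B).card = L) (hL : 0 < L)
    {ΓA ΓB : Set ℝ} (hAm : MeasurableSet ΓA) (hA : ΓA ⊆ Set.Icc 0 1)
    (hBm : MeasurableSet ΓB) (hB : ΓB ⊆ Set.Icc 0 1) {c : ℝ} (hc0 : 0 ≤ c) (hc1 : c ≤ 1)
    {m n q RA RB : ℕ} (hmn : m ≤ n) {α β : ℝ} (hα0 : 0 < α) (hβ0 : 0 < β)
    (hα : ∀ x ∈ ΓA, ∀ y ∈ ΓA, ((L : ℝ) ^ q)⁻¹ ≤ ‖expi (RA * (x - y)) - 1‖ →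
      α ≤ powProd (powerSpec A fun a => (a : ℝ)) L 0 m (x - y))
    (hβ : ∀ x ∈ ΓB, ∀ y ∈ ΓB, ((L : ℝ) ^ q)⁻¹ ≤ ‖expi (RB * (x - y)) - 1‖ →
      β ≤ powProd (powerSpec B fun a => (a : ℝ)) L 0 m (x - y)) (θ : ℝ) :
    ENNReal.ofReal (c * volume.real ΓA * volume.real ΓB / 16 * (L : ℝ) ^ m) ≤
      ENNReal.ofReal ((L : ℝ) ^ n) *
        (∫⁻ η in Set.Icc (-((L : ℝ) ^ m)⁻¹) ((L : ℝ) ^ m)⁻¹,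
          ENNReal.ofReal (powProd (powerSpec (A ×ˢ B) (projHom θ)) L m n η)) +
      ENNReal.ofReal ((L : ℝ) ^ n) *
        (lineMass L c m ((nearRational L RA q).indicator (highPart L A m n)) (highPart L B m n) θ +
        lineMass L c m (highPart L A m n) ((nearRational L RB q).indicator (highPart L B m n)) θ) +
      ENNReal.ofReal (1 / (α * β)) * (ENNReal.ofReal ((L : ℝ) ^ n) *
        ∫⁻ ξ in annulus L c m,
          ENNReal.ofReal (powProd (powerSpec (A ×ˢ B) (projHom θ)) L 0 n ξ)) := by
  obtain ⟨Γ, hΓc, hΓm, hΓv, hΓ⟩ := exists_line_set hAm hA hBm hB hc0 hc1 θ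
  have hΓfin : volume Γ ≠ ⊤ := ((measure_mono hΓc).trans_lt (by simp)).ne
  set P := powerSpec (A ×ˢ B) (projHom θ) with hP
  have hPc : ∀ i j, Measurable fun η => ENNReal.ofReal (powProd P L i j η) := fun i j =>
    (continuous_powProd (continuous_powerSpec _ _) _ _).measurable.ennreal_ofReal
  have hP0 : ∀ i j u, 0 ≤ powProd P L i j u := powProd_nonneg (powerSpec_nonneg _ _)
  set J := Set.Icc (-((L : ℝ) ^ m)⁻¹) ((L : ℝ) ^ m)⁻¹ with hJ
  set FA := (nearRational L RA q).indicator (highPart L A m n) with hFA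
  set GB := (nearRational L RB q).indicator (highPart L B m n) with hGB
  have hFAm : Measurable FA := measurable_indicator_highPart _ _ _ _ _ _
  have hGBm : Measurable GB := measurable_indicator_highPart _ _ _ _ _ _
  have hHA := measurable_highPart L A m n
  have hHB := measurable_highPart L B m n
  have hann := measurableSet_annulus L c m
  set Ψ₁ : ℝ → ENNReal := J.indicator fun η => ENNReal.ofReal (powProd P L m n η)
  set Ψ₂ : ℝ → ENNReal := (annulus L c m).indicator fun η =>
    FA (η * Real.cos θ) * highPart L B m n (η * Real.sin θ)
  set Ψ₃ : ℝ → ENNReal := (annulus L c m).indicator fun η =>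
    highPart L A m n (η * Real.cos θ) * GB (η * Real.sin θ)
  set Ψ₄ : ℝ → ENNReal := (annulus L c m).indicator fun η => ENNReal.ofReal (powProd P L 0 n η)
  have hm1 : Measurable Ψ₁ := (hPc m n).indicator measurableSet_Icc
  have hm2 : Measurable Ψ₂ := (by fun_prop : Measurable fun η =>
    FA (η * Real.cos θ) * highPart L B m n (η * Real.sin θ)).indicator hann
  have hm3 : Measurable Ψ₃ := (by fun_prop : Measurable fun η =>
    highPart L A m n (η * Real.cos θ) * GB (η * Real.sin θ)).indicator hann
  have hm4 : Measurable Ψ₄ := (hPc 0 n).indicator hann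
  have hpt : ∀ x ∈ Γ, ∀ y ∈ Γ, ENNReal.ofReal (powProd P L m n (x - y)) ≤
      Ψ₁ (x - y) + (Ψ₂ (x - y) + Ψ₃ (x - y)) + ENNReal.ofReal (1 / (α * β)) * Ψ₄ (x - y) := by
    intro x hx y hy
    obtain ⟨⟨x₁, hx₁, y₁, hy₁, h₁⟩, x₂, hx₂, y₂, hy₂, h₂⟩ := hΓ x hx y hy
    set η := x - y
    have hηc : |η| ≤ c := abs_le.2 ⟨by linarith [(hΓc hx).1, (hΓc hy).2],
      by linarith [(hΓc hx).2, (hΓc hy).1]⟩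
    have hbd : ∀ t : ℝ, |t| ≤ 1 → η * t ∈ Set.Icc (-1 : ℝ) 1 := fun t ht => by
      refine Set.mem_Icc.2 (abs_le.1 ?_)
      rw [abs_mul]
      exact mul_le_one₀ (hηc.trans hc1) (abs_nonneg _) ht
    have hprod : ∀ i, ENNReal.ofReal (powProd P L i n η) =
        highPart L A i n (η * Real.cos θ) * highPart L B i n (η * Real.sin θ) := fun i => by
      rw [hP, powProd_product, ENNReal.ofReal_mul (powProd_nonneg (powerSpec_nonneg _ _) _ _ _)]
      rfl
    rcases le_or_gt |η| ((L : ℝ) ^ m)⁻¹ with hη | hη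
    · have : Ψ₁ η = ENNReal.ofReal (powProd P L m n η) :=
        Set.indicator_of_mem (Set.mem_Icc.2 (abs_le.1 hη)) _
      rw [← this, add_assoc]
      exact le_self_add
    have hmem : η ∈ annulus L c m := ⟨hη.le, hηc⟩
    by_cases hsA : η * Real.cos θ ∈ nearRational L RA q
    · have : Ψ₂ η = ENNReal.ofReal (powProd P L m n η) := by
        rw [hprod]
        change (annulus L c m).indicator _ η = _
        rw [Set.indicator_of_mem hmem, hFA, Set.indicator_of_mem hsA]
      rw [← this]
      exact (le_self_add.trans le_add_self).trans le_self_add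
    by_cases hsB : η * Real.sin θ ∈ nearRational L RB q
    · have : Ψ₃ η = ENNReal.ofReal (powProd P L m n η) := by
        rw [hprod]
        change (annulus L c m).indicator _ η = _
        rw [Set.indicator_of_mem hmem, hGB, Set.indicator_of_mem hsB]
      rw [← this]
      exact (le_add_self.trans le_add_self).trans le_self_add
    · have hA' : α ≤ powProd (powerSpec A fun a => (a : ℝ)) L 0 m (η * Real.cos θ) := by
        rw [h₁]
        refine hα _ hx₁ _ hy₁ (le_of_not_gt fun h => hsA ⟨hbd _ (Real.abs_cos_le_one θ), ?_⟩)
        rwa [h₁]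
      have hB' : β ≤ powProd (powerSpec B fun a => (a : ℝ)) L 0 m (η * Real.sin θ) := by
        rw [h₂]
        refine hβ _ hx₂ _ hy₂ (le_of_not_gt fun h => hsB ⟨hbd _ (Real.abs_sin_le_one θ), ?_⟩)
        rwa [h₂]
      have h5 : α * β ≤ powProd P L 0 m η := by
        rw [hP, powProd_product]
        exact mul_le_mul hA' hB' hβ0.le (hα0.le.trans hA')
      have h6 : powProd P L m n η ≤ 1 / (α * β) * powProd P L 0 n η := by
        rw [← powProd_mul (Nat.zero_le m) hmn, one_div, ← div_eq_inv_mul,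
          le_div_iff₀ (by positivity), mul_comm]
        gcongr
        exact hP0 _ _ _
      refine le_trans ?_ le_add_self
      rw [show Ψ₄ η = ENNReal.ofReal (powProd P L 0 n η) from Set.indicator_of_mem hmem _,
        ← ENNReal.ofReal_mul (by positivity)]
      exact ENNReal.ofReal_le_ofReal h6
  have hkey := measure_mul_pow_le hU hD hL hΓm hΓfin hmn (Ψ := fun η =>
    Ψ₁ η + (Ψ₂ η + Ψ₃ η) + ENNReal.ofReal (1 / (α * β)) * Ψ₄ η) hpt
  rw [lintegral_add_right _ (by fun_prop), lintegral_add_left hm1, lintegral_add_left hm2,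
    lintegral_const_mul _ hm4, lintegral_indicator measurableSet_Icc, lintegral_indicator hann,
    lintegral_indicator hann, lintegral_indicator hann] at hkey
  refine (ENNReal.ofReal_le_ofReal ?_).trans (hkey.trans (le_of_eq ?_))
  · gcongr
  · unfold lineMass
    ring

/-- Outside a small set of directions the number of close pairs is large at some level. Otherwise sum
`mul_pow_le_split` over `N ≤ n < 2 N`: the central part and the annuli account for at most half of the
left-hand side, and the nearly rational frequencies for the rest, which is exceptional. -/
theorem exists_exceptional_set (hU : UniqueDigits L (A ×ˢ B)) (hA2 : 2 ≤ A.card)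
    (hB2 : 2 ≤ B.card) (hLAB : L = A.card * B.card) {C c : ℝ} (hC0 : 0 < C) (hc0 : 1 ≤ c)
    (hC : ∀ (θ : ℝ) (n : ℕ), ∫ ξ in Set.Icc (-1) 1, ‖expSum (digitSum L (A ×ˢ B) n) (projHom θ) ξ‖ ^ 2
      ≤ C * (closePairs (projHom θ) (2 * c) (digitSum L (A ×ˢ B) n)).card)
    (hc : ∀ θ, ∀ d ∈ A ×ˢ B, |projHom θ d| ≤ c)
    {ΓA ΓB : Set ℝ} (hAm : MeasurableSet ΓA) (hA : ΓA ⊆ Set.Icc 0 1)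
    (hBm : MeasurableSet ΓB) (hB : ΓB ⊆ Set.Icc 0 1)
    {m N RA RB : ℕ} (hRA : 0 < RA) (hRB : 0 < RB) (hmN : 3 * L * m ≤ N) (hN : 0 < N)
    {α β : ℝ} (hα0 : 0 < α) (hβ0 : 0 < β)
    (hα : ∀ x ∈ ΓA, ∀ y ∈ ΓA,
      ((L : ℝ) ^ (3 * L * m))⁻¹ ≤ ‖expi ((RA * L ^ m : ℕ) * (x - y)) - 1‖ →
      α ≤ powProd (powerSpec A fun a => (a : ℝ)) L 0 m (x - y))
    (hβ : ∀ x ∈ ΓB, ∀ y ∈ ΓB,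
      ((L : ℝ) ^ (3 * L * m))⁻¹ ≤ ‖expi ((RB * L ^ m : ℕ) * (x - y)) - 1‖ →
      β ≤ powProd (powerSpec B fun a => (a : ℝ)) L 0 m (x - y))
    {γ : ℝ} (hγ0 : 0 < γ)
    (hγ : γ ≤ 1 / (8 * Real.pi * c) * volume.real ΓA * volume.real ΓB / 16 * (L : ℝ) ^ m)
    (hNm : 2 * (m + 1) / (α * β) ≤ N) :
    ∃ E : Set ℝ, MeasurableSet E ∧
      volume (E ∩ Set.Icc 0 Real.pi) ≤ ENNReal.ofReal (40 * (RA + RB) / γ) ∧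
      ∀ θ ∉ E, ¬ ∀ n ≤ 2 * N, ((closePairs (projHom θ) (2 * c) (digitSum L (A ×ˢ B) n)).card : ℝ) ≤
        2 * (γ / (8 * C)) * (L : ℝ) ^ n := by
  have hpi := Real.pi_pos
  have hL2 : 2 ≤ L := by rw [hLAB]; nlinarith
  have hL : 0 < L := by omega
  have hD : (A ×ˢ B).card = L := by rw [Finset.card_product, hLAB]
  have hDne : (A ×ˢ B).Nonempty := Finset.card_pos.1 (by omega)
  obtain ⟨hUA, hUB⟩ := hU.of_product (Finset.card_pos.1 (by omega)) (Finset.card_pos.1 (by omega))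
  have hmq : m ≤ 3 * L * m := Nat.le_mul_of_pos_left _ (by positivity)
  set q := 3 * L * m with hq
  set c₀ := 1 / (8 * Real.pi * c) with hc₀
  have hc₀0 : 0 < c₀ := by positivity
  have hc₀1 : c₀ ≤ 1 := by
    rw [hc₀, div_le_one (by positivity)]
    nlinarith [Real.pi_gt_three]
  set FA := fun n => (nearRational L (RA * L ^ m) q).indicator (highPart L A m n)
  set GB := fun n => (nearRational L (RB * L ^ m) q).indicator (highPart L B m n)
  set g : ℝ → ENNReal := fun θ => ∑ n ∈ Finset.Ico N (2 * N), ENNReal.ofReal ((L : ℝ) ^ n) *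
    (lineMass L c₀ m (FA n) (highPart L B m n) θ + lineMass L c₀ m (highPart L A m n) (GB n) θ)
    with hg
  have hmA : ∀ n, Measurable fun θ => lineMass L c₀ m (FA n) (highPart L B m n) θ := fun n =>
    measurable_lineMass _ _ _ (measurable_indicator_highPart _ _ _ _ _ _) (measurable_highPart _ _ _ _)
  have hmB : ∀ n, Measurable fun θ => lineMass L c₀ m (highPart L A m n) (GB n) θ := fun n =>
    measurable_lineMass _ _ _ (measurable_highPart _ _ _ _) (measurable_indicator_highPart _ _ _ _ _ _)
  have hmAB : ∀ n, Measurable fun θ => ENNReal.ofReal ((L : ℝ) ^ n) *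
      (lineMass L c₀ m (FA n) (highPart L B m n) θ + lineMass L c₀ m (highPart L A m n) (GB n) θ) :=
    fun n => ((hmA n).add (hmB n)).const_mul _
  have hgm : Measurable g := by
    exact Finset.measurable_fun_sum _ fun n _ => hmAB n
  -- the average of `g` over all directions
  have hgint : ∫⁻ θ in Set.Icc 0 Real.pi, g θ ≤ ENNReal.ofReal (N * (20 * (RA + RB))) := by
    simp only [hg]
    rw [lintegral_finsetSum _ fun n _ => hmAB n]
    have hterm : ∀ n ∈ Finset.Ico N (2 * N), ∫⁻ θ in Set.Icc 0 Real.pi, ENNReal.ofReal ((L : ℝ) ^ n) *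
        (lineMass L c₀ m (FA n) (highPart L B m n) θ + lineMass L c₀ m (highPart L A m n) (GB n) θ) ≤
        ENNReal.ofReal (20 * (RA + RB)) := by
      intro n hn
      have hqn : q ≤ n := hmN.trans (Finset.mem_Ico.1 hn).1
      rw [lintegral_const_mul' _ _ ENNReal.ofReal_ne_top, lintegral_add_left (hmA n), mul_add, mul_add,
        ENNReal.ofReal_add (by positivity) (by positivity)]
      have h1 := lintegral_polar_le hL hc₀1 m
        (measurable_indicator_highPart L A m n (RA * L ^ m) q) (measurable_highPart L B m n)
        (indicator_highPart_neg L A m n (RA * L ^ m) q) (highPart_neg L B m n)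
      have h2 := lintegral_polar_le hL hc₀1 m (measurable_highPart L A m n)
        (measurable_indicator_highPart L B m n (RB * L ^ m) q) (highPart_neg L A m n)
        (indicator_highPart_neg L B m n (RB * L ^ m) q)
      refine add_le_add ?_ ?_
      · refine le_trans (mul_le_mul_right h1 _) (le_trans (le_of_eq ?_)
          (lintegral_lintegral_nearRational_le hUA hUB (by omega) hB2 hLAB hRA hqn))
        ring
      · refine le_trans (mul_le_mul_right h2 _) (le_trans (le_of_eq ?_)
          (lintegral_lintegral_nearRational_le hUB hUA (by omega) hA2 (by rw [hLAB, mul_comm])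
            hRB hqn))
        ring
    refine (Finset.sum_le_card_nsmul _ _ _ hterm).trans (le_of_eq ?_)
    rw [Nat.card_Ico, nsmul_eq_mul, show 2 * N - N = N by omega, ← ENNReal.ofReal_natCast,
      ← ENNReal.ofReal_mul (by positivity)]
  refine ⟨{θ | ENNReal.ofReal (N * γ / 2) ≤ g θ}, measurableSet_le measurable_const hgm, ?_, ?_⟩
  · have h1 := mul_meas_ge_le_lintegral (μ := volume.restrict (Set.Icc 0 Real.pi)) hgm
      (ENNReal.ofReal (N * γ / 2))
    rw [Measure.restrict_apply (measurableSet_le measurable_const hgm)] at h1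
    have h2 := h1.trans hgint
    have hNγ : 0 < N * γ / 2 := by positivity
    refine (ENNReal.mul_le_mul_iff_right (a := ENNReal.ofReal (N * γ / 2))
      (by simpa using hNγ) ENNReal.ofReal_ne_top).1 (h2.trans (le_of_eq ?_))
    rw [← ENNReal.ofReal_mul hNγ.le]
    congr 1
    field_simp
    ring
  · intro θ hθ hclose
    apply hθ
    set P := powerSpec (A ×ˢ B) (projHom θ) with hP
    have hPc : Continuous P := continuous_powerSpec _ _
    have hP0 : ∀ u, 0 ≤ P u := powerSpec_nonneg _ _
    have hP1 : ∀ u, P u ≤ 1 := powerSpec_le_one _ _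
    have hL2n : ∀ n ≤ 2 * N, (L : ℝ) ^ n * ∫ ξ in Set.Icc (-1 : ℝ) 1, powProd P L 0 n ξ ≤ γ / 4 := by
      intro n hn
      refine (pow_mul_integral_powProd_le hU hD hL hC0.le (hC θ n) (hclose n hn)).trans
        (le_of_eq ?_)
      field_simp
      norm_num
    have hsum := sum_lintegral_annulus_le hL2 hPc hP0 hP1 (c := 4 * Real.pi * c) (by positivity)
      (by
        rw [show 2 * (4 * Real.pi * c) = 8 * Real.pi * c by ring]
        exact hc₀1) (one_sub_le_powerSpec hDne _ (hc θ)) m (2 * N)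
    rw [show 2 * (4 * Real.pi * c) = 8 * Real.pi * c by ring, ← hc₀] at hsum
    have hterm : ∀ n ∈ Finset.Ico N (2 * N), ENNReal.ofReal γ ≤ ENNReal.ofReal (γ / 4) +
        ENNReal.ofReal ((L : ℝ) ^ n) * (lineMass L c₀ m (FA n) (highPart L B m n) θ +
          lineMass L c₀ m (highPart L A m n) (GB n) θ) +
        ENNReal.ofReal (1 / (α * β)) * (ENNReal.ofReal ((L : ℝ) ^ n) *
          ∫⁻ ξ in annulus L c₀ m, ENNReal.ofReal (powProd P L 0 n ξ)) := by
      intro n hn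
      have hn' := Finset.mem_Ico.1 hn
      have hmn : m ≤ n := by omega
      refine (ENNReal.ofReal_le_ofReal hγ).trans ((mul_pow_le_split hU hD hL hAm hA hBm hB hc₀0.le
        hc₀1 hmn hα0 hβ0 hα hβ θ).trans ?_)
      gcongr
      rw [pow_mul_lintegral_central_le hPc hP0 hL hmn]
      exact ENNReal.ofReal_le_ofReal (hL2n _ (by omega))
    have htot := Finset.sum_le_sum hterm
    rw [Finset.sum_add_distrib, Finset.sum_add_distrib, ← Finset.mul_sum, Finset.sum_const,
      Finset.sum_const, Nat.card_Ico, nsmul_eq_mul, nsmul_eq_mul, show 2 * N - N = N by omega,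
      ← ENNReal.ofReal_natCast, ← ENNReal.ofReal_mul (by positivity),
      ← ENNReal.ofReal_mul (by positivity)] at htot
    have htail : ENNReal.ofReal (1 / (α * β)) * ∑ n ∈ Finset.Ico N (2 * N),
        ENNReal.ofReal ((L : ℝ) ^ n) * ∫⁻ ξ in annulus L c₀ m, ENNReal.ofReal (powProd P L 0 n ξ) ≤
        ENNReal.ofReal (N * γ / 4) := by
      calc _ ≤ ENNReal.ofReal (1 / (α * β)) * ENNReal.ofReal (2 * (m + 1) * (γ / 4)) := by
            gcongr
            refine (Finset.sum_le_sum_of_subset (fun n hn => ?_)).trans (hsum.trans ?_)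
            · exact Finset.mem_range.2 (Finset.mem_Ico.1 hn).2
            · apply ENNReal.ofReal_le_ofReal
              gcongr
              exact hL2n _ le_rfl
        _ = ENNReal.ofReal (2 * (m + 1) / (α * β) * (γ / 4)) := by
            rw [← ENNReal.ofReal_mul (by positivity)]
            congr 1
            ring
        _ ≤ ENNReal.ofReal (N * (γ / 4)) := by gcongr
        _ = _ := by rw [mul_div_assoc]
    have h3 : ENNReal.ofReal (N * γ) ≤ ENNReal.ofReal (N * γ / 2) + g θ := by
      refine htot.trans ((add_le_add_right htail _).trans (le_of_eq ?_))
      rw [add_right_comm, ← ENNReal.ofReal_add (by positivity) (by positivity)]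
      congr 2
      ring
    rw [← tsub_le_iff_left, ← ENNReal.ofReal_sub _ (by positivity)] at h3
    refine le_trans (ENNReal.ofReal_le_ofReal ?_) h3
    linarith

end ExceptionalSet

/-! ### Densities of projections -/

section Density

variable {G : Type*} [AddCommMonoid G] [DecidableEq G] {L : ℕ} {D : Finset G} {l : G →+ ℝ}

theorem density_le {r : ℝ} (hr : 0 ≤ r) (hL : 0 < L) (n : ℕ) :
    density L D l r n ≤ (digitSum L D n).card / (L : ℝ) ^ n * (2 * r) := by
  have hL0 : (0 : ℝ) < L := by exact_mod_cast hL
  rw [density, div_mul_eq_mul_div]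
  gcongr
  exact measureReal_nbhd_le _ hr _

theorem density_le_two_mul {r : ℝ} (hr : 0 ≤ r) (hL : 0 < L) (hD : D.card = L) (n : ℕ) :
    density L D l r n ≤ 2 * r := by
  have hL0 : (0 : ℝ) < L := by exact_mod_cast hL
  refine (density_le hr hL n).trans (mul_le_of_le_one_left (by positivity) ?_)
  rw [div_le_one (by positivity)]
  have := card_digitSum_le (L := L) (D := D) n
  rw [hD] at this
  exact_mod_cast this

/-- The neighbourhood of a level contains the rescaled neighbourhoods of later levels. -/
theorem density_anti {c : ℝ} (hL : 2 ≤ L) (hc : ∀ d ∈ D, |l d| ≤ c) {m n : ℕ}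
    (hmn : m ≤ n) : density L D l c n ≤ density L D l c m := by
  obtain ⟨k, rfl⟩ := Nat.exists_eq_add_of_le hmn
  have hL0 : (0 : ℝ) < L := by positivity
  have hsub : nbhd l c (digitSum L D (m + k)) ⊆
      ⋃ v ∈ digitSum L D m, Metric.ball ((L : ℝ) ^ k * l v) ((L : ℝ) ^ k * c) := by
    intro y hy
    simp only [nbhd, Set.mem_iUnion, exists_prop] at hy ⊢
    obtain ⟨w, hw, hy⟩ := hy
    obtain ⟨u, hu, x, hx, rfl⟩ := exists_of_mem_digitSum_add hw
    refine ⟨u, hu, Metric.ball_subset_ball' ?_ hy⟩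
    have h1 := abs_le_of_mem_digitSum hL hc hx
    rw [Real.dist_eq, map_add, map_nsmul, nsmul_eq_mul, Nat.cast_pow, add_sub_cancel_left]
    linarith
  rw [density, density, div_le_div_iff₀ (by positivity) (by positivity)]
  have h2 := measureReal_mono hsub
    (measure_biUnion_lt_top (μ := volume) (Finset.finite_toSet _) fun _ _ =>
      measure_ball_lt_top).ne
  rw [PileSystem.measureReal_scaled _ _ (by omega)] at h2
  rw [pow_add]
  calc _ ≤ (L : ℝ) ^ k * volume.real (nbhd l c (digitSum L D m)) * (L : ℝ) ^ m := by gcongr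
    _ = _ := by ring

/-- The density at level `n j` is at most the `j`-th power of the number of points of level `n`
relative to `L ^ n`. -/
theorem density_mul_le_card_pow {r : ℝ} (hr : 0 ≤ r) (hL : 0 < L) (n j : ℕ) :
    density L D l r (n * j) ≤ ((digitSum L D n).card / (L : ℝ) ^ n) ^ j * (2 * r) := by
  have hL0 : (0 : ℝ) < L := by exact_mod_cast hL
  refine (density_le hr hL _).trans ?_
  gcongr
  rw [div_pow, pow_mul]
  gcongr
  have : (digitSum L D (n * j)).card ≤ (digitSum L D n).card ^ j := by
    induction j with
    | zero => simp [digitSum]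
    | succ j ih =>
      rw [mul_add, mul_one, pow_succ]
      exact (card_digitSum_add_le _ _).trans (Nat.mul_le_mul_right _ ih)
  exact_mod_cast this

theorem one_sub_pow_le {x : ℝ} (hx0 : 0 < x) (hx1 : x ≤ 1) {j : ℕ} (hj : 0 < j) :
    (1 - x) ^ j ≤ 1 / (j * x) := by
  have hj0 : (0 : ℝ) < j := by exact_mod_cast hj
  have h1 := one_add_mul_le_pow (a := x) (by linarith) j
  have h2 : (1 - x) ^ j * (1 + x) ^ j ≤ 1 := by
    rw [← mul_pow]
    exact pow_le_one₀ (by nlinarith) (by nlinarith)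
  rw [le_div_iff₀ (by positivity)]
  refine le_trans ?_ h2
  gcongr
  linarith

/-- If the number of close pairs is large at some level, then the densities become as small as
`O(1 / K)`. -/
theorem density_le_of_not_closePairs (hU : UniqueDigits L D) (hD : D.card = L) (hL : 2 ≤ L)
    {c K : ℝ} (hc1 : 1 ≤ c) (hc : ∀ d ∈ D, |l d| ≤ c) (hK : 0 < K) {N j M : ℕ}
    (hN : ¬ ∀ n ≤ N, ((closePairs l (2 * c) (digitSum L D n)).card : ℝ) ≤ 2 * K * (L : ℝ) ^ n)
    (hj : 16 * L * K ^ 2 ≤ (j : ℕ)) (hj0 : 0 < j) (hM : N * j ≤ M) :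
    density L D l c M ≤ 8 * c / K := by
  rcases le_or_gt 1 K with hK1 | hK1
  · refine (density_anti hL hc hM).trans ?_
    rcases closePairs_or_density hU hD hL (by linarith) hc hK1 N with h | h
    · exact absurd h hN
    refine (h j).trans ?_
    have hL0 : (0 : ℝ) < L := by positivity
    have hL1 : (1 : ℝ) ≤ L := by exact_mod_cast (by omega : 1 ≤ L)
    have hx1 : 1 / (16 * L * K) ≤ 1 := by
      rw [div_le_one (by positivity)]
      exact one_le_mul_of_one_le_of_one_le (by linarith) hK1
    have hpow := one_sub_pow_le (by positivity) hx1 hj0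
    have hj0' : (0 : ℝ) < j := by exact_mod_cast hj0
    have hfin : 1 / (j * (1 / (16 * L * K))) ≤ 1 / K := by
      apply one_div_le_one_div_of_le hK
      rw [mul_one_div, le_div_iff₀ (by positivity)]
      linarith
    calc 6 * c / K + (1 - 1 / (16 * L * K)) ^ j * (2 * c)
        ≤ 6 * c / K + 1 / K * (2 * c) := by gcongr; exact hpow.trans hfin
      _ = 8 * c / K := by ring
  · refine (density_le_two_mul (by linarith) (by omega) hD M).trans ?_
    rw [le_div_iff₀ hK]
    nlinarith

end Density

/-! ### Decay of the Favard length -/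

section FavardLength

variable {A B : Finset ℕ} {L : ℕ}

theorem exists_of_mem_iter (hL : 0 < L) {N : ℕ} {x : ℝ} (hx : x ∈ iter L A N) :
    ∃ y ∈ digitSum L A N, x = L / (L : ℝ) ^ N * y := by
  have hL0 : (0 : ℝ) < L := by exact_mod_cast hL
  induction N generalizing x with
  | zero =>
    have : x = 0 := hx
    exact ⟨0, by simp [digitSum], by simp [this]⟩
  | succ N ih =>
    obtain ⟨x', hx', a, ha, rfl⟩ := hx
    obtain ⟨y, hy, rfl⟩ := ih hx'
    refine ⟨L • y + a, Finset.mem_image.2 ⟨(y, a), Finset.mem_product.2 ⟨hy, ha⟩, rfl⟩, ?_⟩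
    rw [smul_eq_mul, pow_succ]
    push_cast
    field_simp

theorem abs_proj_le (θ : ℝ) (z : ℂ) : |proj θ z| ≤ ‖z‖ := by
  apply abs_le_of_sq_le_sq _ (norm_nonneg z)
  rw [Complex.sq_norm, Complex.normSq_apply, proj]
  nlinarith [sq_nonneg (z.re * Real.sin θ - z.im * Real.cos θ), Real.sin_sq_add_cos_sq θ]

/-- Rescaled by `L^{N-1}`, the projection lies in a neighbourhood of the projected digit sums. -/
theorem volume_proj_le (hL : L = A.card * B.card) (hLpos : 0 < L) {c : ℝ} (hc : 1 ≤ c) (θ : ℝ)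
    (N : ℕ) : volume (proj θ '' cantorNbhd A B N) ≤
      ENNReal.ofReal (L * density L (A ×ˢ B) (projHom θ) c N) := by
  have hL0 : (0 : ℝ) < L := by exact_mod_cast hLpos
  have hL1 : (1 : ℝ) ≤ L := by exact_mod_cast hLpos
  set t := (L : ℝ) / (L : ℝ) ^ N with ht
  have ht0 : 0 < t := by positivity
  have hsub : proj θ '' cantorNbhd A B N ⊆
      (fun y => t⁻¹ * y) ⁻¹' nbhd (projHom θ) c (digitSum L (A ×ˢ B) N) := by
    rintro _ ⟨z, ⟨x, hx, y, hy, hz⟩, rfl⟩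
    rw [← hL] at hx hy hz
    obtain ⟨u, hu, hxu⟩ := exists_of_mem_iter hLpos hx
    obtain ⟨v, hv, hyv⟩ := exists_of_mem_iter hLpos hy
    simp only [nbhd, Set.mem_preimage, Set.mem_iUnion, exists_prop]
    refine ⟨(u, v), by rw [digitSum_product]; exact Finset.mem_product.2 ⟨hu, hv⟩, ?_⟩
    have h1 : proj θ (z - (x + y * Complex.I)) = proj θ z - t * projHom θ (u, v) := by
      have hre : (z - (x + y * Complex.I)).re = z.re - x := by simp
      have him : (z - (x + y * Complex.I)).im = z.im - y := by simp
      rw [proj, proj, projHom_apply, hre, him, hxu, hyv]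
      ring
    have h2 := (abs_proj_le θ (z - (x + y * Complex.I))).trans_lt hz
    rw [h1] at h2
    rw [Metric.mem_ball, Real.dist_eq]
    have h3 : t⁻¹ * proj θ z - projHom θ (u, v) = t⁻¹ * (proj θ z - t * projHom θ (u, v)) := by
      field_simp
    rw [h3, abs_mul, abs_of_pos (inv_pos.2 ht0), ← div_eq_inv_mul, div_lt_iff₀ ht0]
    refine h2.trans_le ?_
    rw [ht, ← mul_div_assoc]
    gcongr
    nlinarith
  refine (measure_mono hsub).trans (le_of_eq ?_)
  rw [Real.volume_preimage_mul_left (inv_ne_zero ht0.ne'), inv_inv, abs_of_pos ht0,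
    ← ENNReal.ofReal_toReal (measure_nbhd_lt_top _ _ _).ne, ← ENNReal.ofReal_mul ht0.le,
    ← measureReal_def, density]
  congr 1
  rw [ht]
  ring

/-- A bound for the Favard length in terms of a set `E` of exceptional directions. -/
theorem favard_le (hL : L = A.card * B.card) (hLpos : 0 < L) {c M d v : ℝ} (hc : 1 ≤ c) {N : ℕ}
    (hM : 0 ≤ M) (hd : 0 ≤ d) (hv : 0 ≤ v)
    {E : Set ℝ} (hE : MeasurableSet E) (hEv : volume (E ∩ Set.Icc 0 Real.pi) ≤ ENNReal.ofReal v)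
    (h1 : ∀ θ, density L (A ×ˢ B) (projHom θ) c N ≤ M)
    (h2 : ∀ θ ∉ E, density L (A ×ˢ B) (projHom θ) c N ≤ d) :
    favard (cantorNbhd A B N) ≤ ENNReal.ofReal (L * (M * v + d * 4)) := by
  have hL0 : (0 : ℝ) < L := by exact_mod_cast hLpos
  have hpi : ENNReal.ofReal (1 / Real.pi) ≤ 1 := by
    rw [ENNReal.ofReal_le_one, div_le_one Real.pi_pos]
    linarith [Real.pi_gt_three]
  have hin : ∫⁻ θ in Set.Icc 0 Real.pi, volume (proj θ '' cantorNbhd A B N) ≤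
      ENNReal.ofReal (L * (M * v + d * 4)) := by
    rw [← lintegral_inter_add_sdiff _ _ hE]
    have e1 : ∫⁻ θ in Set.Icc 0 Real.pi ∩ E, volume (proj θ '' cantorNbhd A B N) ≤
        ENNReal.ofReal (L * M) * ENNReal.ofReal v := by
      calc _ ≤ ∫⁻ θ in Set.Icc 0 Real.pi ∩ E, ENNReal.ofReal (L * M) :=
            lintegral_mono fun θ => (volume_proj_le hL hLpos hc θ N).trans
              (ENNReal.ofReal_le_ofReal (by gcongr; exact h1 θ))
        _ ≤ _ := by
            rw [lintegral_const, Measure.restrict_apply_univ, Set.inter_comm]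
            gcongr
    have e2 : ∫⁻ θ in Set.Icc 0 Real.pi \ E, volume (proj θ '' cantorNbhd A B N) ≤
        ENNReal.ofReal (L * d) * ENNReal.ofReal 4 := by
      calc _ ≤ ∫⁻ θ in Set.Icc 0 Real.pi \ E, ENNReal.ofReal (L * d) :=
            setLIntegral_mono' (measurableSet_Icc.diff hE) fun θ hθ =>
              (volume_proj_le hL hLpos hc θ N).trans
                (ENNReal.ofReal_le_ofReal (by gcongr; exact h2 θ hθ.2))
        _ ≤ _ := by
            rw [lintegral_const, Measure.restrict_apply_univ]
            gcongr
            refine (measure_mono Set.sdiff_subset).trans ?_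
            rw [Real.volume_Icc]
            exact ENNReal.ofReal_le_ofReal (by linarith [Real.pi_le_four])
    refine (add_le_add e1 e2).trans (le_of_eq ?_)
    rw [← ENNReal.ofReal_mul (by positivity), ← ENNReal.ofReal_mul (by positivity),
      ← ENNReal.ofReal_add (by positivity) (by positivity)]
    congr 1
    ring
  calc _ ≤ 1 * ENNReal.ofReal (L * (M * v + d * 4)) := mul_le_mul' hpi hin
    _ = _ := one_mul _

/-- Geometric decay along the scales `W ^ m` is a power law. -/
theorem exists_power_law {F : ℕ → ENNReal} {C ρ : ℝ} (hC : 0 < C) (hρ : 1 < ρ) {W : ℕ} (hW : 2 ≤ W)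
    (h : ∀ m N : ℕ, W ^ m ≤ N → F N ≤ ENNReal.ofReal (C / ρ ^ m)) :
    ∃ p : ℝ, 0 < p ∧ ∃ C' : ℝ, 0 < C' ∧ ∀ N : ℕ, 1 ≤ N →
      F N ≤ ENNReal.ofReal (C' * (N : ℝ) ^ (-p)) := by
  have hW1 : (1 : ℝ) < W := by exact_mod_cast (by omega : 1 < W)
  have hlogW := Real.log_pos hW1
  have hρ0 : 0 < ρ := by linarith
  set p := Real.log ρ / Real.log W with hp
  have hp0 : 0 < p := div_pos (Real.log_pos hρ) hlogW
  have hWp : (W : ℝ) ^ p = ρ := by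
    rw [Real.rpow_def_of_pos (by linarith), hp, mul_div_cancel₀ _ hlogW.ne', Real.exp_log hρ0]
  refine ⟨p, hp0, C * ρ, by positivity, fun N hN => ?_⟩
  refine (h (Nat.log W N) N (Nat.pow_log_le_self W (by omega))).trans
    (ENNReal.ofReal_le_ofReal ?_)
  have hN0 : (0 : ℝ) < N := by exact_mod_cast hN
  have h1 : (N : ℝ) ^ p ≤ ρ ^ (Nat.log W N + 1) := by
    calc (N : ℝ) ^ p ≤ ((W : ℝ) ^ (Nat.log W N + 1)) ^ p := by
          apply Real.rpow_le_rpow hN0.le _ hp0.le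
          exact_mod_cast (Nat.lt_pow_succ_log_self (by omega) N).le
      _ = _ := by
          rw [← Real.rpow_natCast_mul (by linarith), mul_comm, Real.rpow_mul_natCast (by linarith),
            hWp]
  rw [Real.rpow_neg hN0.le, ← div_eq_mul_inv, div_le_div_iff₀ (by positivity) (by positivity)]
  rw [pow_succ] at h1
  calc C * (N : ℝ) ^ p ≤ C * (ρ ^ Nat.log W N * ρ) := by gcongr
    _ = _ := by ring

theorem exists_projHom_bound (A B : Finset ℕ) :
    ∃ c : ℝ, 1 ≤ c ∧ ∀ θ, ∀ d ∈ A ×ˢ B, |projHom θ d| ≤ c := by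
  refine ⟨1 + ∑ a ∈ A, (a : ℝ) + ∑ b ∈ B, (b : ℝ), ?_, fun θ d hd => ?_⟩
  · have h1 : 0 ≤ ∑ a ∈ A, (a : ℝ) := by positivity
    have h2 : 0 ≤ ∑ b ∈ B, (b : ℝ) := by positivity
    linarith
  · obtain ⟨ha, hb⟩ := Finset.mem_product.1 hd
    have h1 := Finset.single_le_sum (f := fun a : ℕ => (a : ℝ)) (fun _ _ => by positivity) ha
    have h2 := Finset.single_le_sum (f := fun a : ℕ => (a : ℝ)) (fun _ _ => by positivity) hb
    rw [projHom_apply]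
    refine (abs_add_le _ _).trans ?_
    rw [abs_mul, abs_mul, Nat.abs_cast, Nat.abs_cast]
    have h3 := mul_le_of_le_one_right (Nat.cast_nonneg (α := ℝ) d.1) (Real.abs_cos_le_one θ)
    have h4 := mul_le_of_le_one_right (Nat.cast_nonneg (α := ℝ) d.2) (Real.abs_sin_le_one θ)
    linarith

/-- If two words of digits represent the same point, then the Favard length decays rapidly. -/
theorem exists_decay_of_not_uniqueDigits (hL : L = A.card * B.card) (hL2 : 2 ≤ L)
    (hU : ¬ UniqueDigits L (A ×ˢ B)) :
    ∃ (C ρ : ℝ) (W : ℕ), 0 < C ∧ 1 < ρ ∧ 2 ≤ W ∧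
      ∀ m N : ℕ, W ^ m ≤ N → favard (cantorNbhd A B N) ≤ ENNReal.ofReal (C / ρ ^ m) := by
  obtain ⟨c, hc1, hc⟩ := exists_projHom_bound A B
  have hL0 : (0 : ℝ) < L := by positivity
  have hD : (A ×ˢ B).card = L := by rw [Finset.card_product, hL]
  unfold UniqueDigits at hU
  push Not at hU
  obtain ⟨n, hn⟩ := hU
  have hn0 : 0 < n := Nat.pos_of_ne_zero (by rintro rfl; simp [digitSum] at hn)
  have hlt : (digitSum L (A ×ˢ B) n).card < L ^ n := by
    rw [← hD] at *
    exact lt_of_le_of_ne (card_digitSum_le n) hn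
  have hpos : 0 < (digitSum L (A ×ˢ B) n).card := by
    have hne : (A ×ˢ B).Nonempty := Finset.card_pos.1 (by omega)
    have : ∀ k, (digitSum L (A ×ˢ B) k).Nonempty := by
      intro k
      induction k with
      | zero => exact Finset.singleton_nonempty _
      | succ k ih => exact (ih.product hne).image _
    exact (this n).card_pos
  have hpos' : (0 : ℝ) < (digitSum L (A ×ˢ B) n).card := by exact_mod_cast hpos
  set ρ := (L : ℝ) ^ n / (digitSum L (A ×ˢ B) n).card with hρ
  refine ⟨L * (2 * c * 4), ρ, 2 * n, by positivity, ?_, by omega, fun m N hN => ?_⟩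
  · rw [hρ, one_lt_div hpos']
    exact_mod_cast hlt
  have hρ0 : 0 < ρ := by positivity
  have hle : n * m ≤ N := by
    refine le_trans ?_ hN
    rcases Nat.eq_zero_or_pos m with rfl | hm
    · simp
    rw [mul_pow, mul_comm]
    exact Nat.mul_le_mul Nat.lt_two_pow_self.le (Nat.le_self_pow (by omega) n)
  have h1 : ∀ θ, density L (A ×ˢ B) (projHom θ) c N ≤ 2 * c / ρ ^ m := by
    intro θ
    refine (density_anti hL2 (hc θ) hle).trans
      ((density_mul_le_card_pow (by linarith) (by omega) n m).trans (le_of_eq ?_))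
    rw [hρ, div_pow, div_pow]
    field_simp
  refine (favard_le hL (by omega) hc1 (M := 2 * c / ρ ^ m) (d := 2 * c / ρ ^ m) (v := 0)
    (by positivity) (by positivity) le_rfl MeasurableSet.empty (by simp) h1
    fun θ _ => h1 θ).trans (ENNReal.ofReal_le_ofReal (le_of_eq ?_))
  ring

set_option maxHeartbeats 800000 in
/-- Without coincidences, the Favard length decays geometrically along geometric scales. -/
theorem exists_decay_of_uniqueDigits (hA : 2 ≤ A.card) (hB : 2 ≤ B.card)
    (hL : L = A.card * B.card) (hU : UniqueDigits L (A ×ˢ B))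
    (hDA : DivisorCondition L A) (hDB : DivisorCondition L B)
    (hrA : UnitRootsAreRootsOfUnity A) (hrB : UnitRootsAreRootsOfUnity B) :
    ∃ (C ρ : ℝ) (W : ℕ), 0 < C ∧ 1 < ρ ∧ 2 ≤ W ∧
      ∀ m N : ℕ, W ^ m ≤ N → favard (cantorNbhd A B N) ≤ ENNReal.ofReal (C / ρ ^ m) := by
  obtain ⟨c, hc1, hc⟩ := exists_projHom_bound A B
  obtain ⟨C₁, hC₁, hC₁'⟩ := exists_integral_expSum_le
  obtain ⟨RA, α, cA, hRA, hα, hcA, hΓA⟩ := exists_lower_bound_set hA hB hrA hL hDA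
  obtain ⟨RB, β, cB, hRB, hβ, hcB, hΓB⟩ := exists_lower_bound_set hB hA hrB
    (hL.trans (mul_comm _ _)) hDB
  have hpi := Real.pi_pos
  have hL4 : 4 ≤ L := by rw [hL]; exact Nat.mul_le_mul hA hB
  have hL0 : (0 : ℝ) < L := by positivity
  have hD : (A ×ˢ B).card = L := by rw [Finset.card_product, hL]
  set ρ : ℝ := ((B.card : ℝ) + 1) * ((A.card : ℝ) + 1) / L with hρ
  have hρ1 : 1 < ρ := by
    rw [hρ, one_lt_div hL0, hL]
    push_cast
    nlinarith [(Nat.cast_nonneg A.card : (0 : ℝ) ≤ A.card),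
      (Nat.cast_nonneg B.card : (0 : ℝ) ≤ B.card)]
  have hρ0 : 0 < ρ := by linarith
  set κ : ℝ := 1 / (8 * Real.pi * c) * cA * cB / 16 with hκ
  have hκ0 : 0 < κ := by positivity
  set ε : ℝ := κ / (8 * C₁) with hε
  have hε0 : 0 < ε := by positivity
  -- `N = T ^ m` is the number of levels in the dichotomy, and `T' ^ m ≥ 16 L K²` that of its iterations
  set T : ℕ := ⌈4 / (α * β)⌉₊ + 6 * L with hT
  set T' : ℕ := ⌈16 * L * (1 + ε) ^ 2 * ρ ^ 2⌉₊ with hT'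
  have hT1 : 4 / (α * β) ≤ T := by
    rw [hT]; push_cast
    have := Nat.le_ceil (4 / (α * β))
    linarith
  have hT2 : 16 * L * (1 + ε) ^ 2 * ρ ^ 2 ≤ T' := Nat.le_ceil _
  have hT'0 : 0 < T' := Nat.ceil_pos.2 (by positivity)
  have hT0 : 24 ≤ T := by omega
  set C := L * (2 * c * (40 * (RA + RB) / κ) + 8 * c / ε * 4) + L * (2 * c * 4) with hC
  refine ⟨C, ρ, 2 * T * T', by positivity, hρ1, by nlinarith, fun m N hN => ?_⟩
  have htriv : ∀ θ, density L (A ×ˢ B) (projHom θ) c N ≤ 2 * c := fun θ =>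
    density_le_two_mul (by linarith) (by omega) hD N
  rcases Nat.eq_zero_or_pos m with rfl | hm
  · refine (favard_le hL (by omega) hc1 (M := 2 * c) (d := 2 * c) (v := 0) (by positivity)
      (by positivity) le_rfl MeasurableSet.empty (by simp) htriv fun θ _ => htriv θ).trans
      (ENNReal.ofReal_le_ofReal ?_)
    rw [pow_zero, div_one, mul_zero, zero_add, hC]
    have : 0 ≤ L * (2 * c * (40 * (RA + RB) / κ) + 8 * c / ε * 4) := by positivity
    linarith
  obtain ⟨ΓA, hΓA1, hΓAm, hΓAv, hΓA⟩ := hΓA m hm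
  obtain ⟨ΓB, hΓB1, hΓBm, hΓBv, hΓB⟩ := hΓB m hm
  have h2m : 2 ≤ 2 ^ m := Nat.le_self_pow (by omega) 2
  have hmm : m + 1 ≤ 2 ^ m := Nat.lt_two_pow_self
  have hρm : 0 < ρ ^ m := by positivity
  have hTm : 3 * L * m ≤ T ^ m := by
    calc 3 * L * m ≤ (3 * L) ^ m * 2 ^ m :=
          Nat.mul_le_mul (Nat.le_self_pow (by omega) _) (by omega)
      _ = (6 * L) ^ m := by rw [← mul_pow]; congr 1; ring
      _ ≤ T ^ m := Nat.pow_le_pow_left (by omega) _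
  have hTm' : 2 * ((m : ℝ) + 1) / (α ^ m * β ^ m) ≤ (T ^ m : ℕ) := by
    calc 2 * ((m : ℝ) + 1) / (α ^ m * β ^ m) ≤ 2 ^ m * 2 ^ m / (α ^ m * β ^ m) := by
          gcongr
          · exact_mod_cast h2m
          · exact_mod_cast hmm
      _ = (4 / (α * β)) ^ m := by
          rw [div_pow, ← mul_pow, ← mul_pow]; norm_num
      _ ≤ _ := by push_cast; gcongr
  have hγ : κ * ρ ^ m ≤
      1 / (8 * Real.pi * c) * volume.real ΓA * volume.real ΓB / 16 * (L : ℝ) ^ m := by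
    calc κ * ρ ^ m = 1 / (8 * Real.pi * c) * (cA * (((B.card : ℝ) + 1) / L) ^ m) *
          (cB * (((A.card : ℝ) + 1) / L) ^ m) / 16 * (L : ℝ) ^ m := by
          rw [hκ, hρ, div_pow, div_pow, div_pow, mul_pow]
          field_simp
      _ ≤ _ := by gcongr
  obtain ⟨E, hEm, hEv, hE⟩ := exists_exceptional_set hU hA hB hL hC₁ hc1
    (fun θ n => hC₁' _ _ _ _ (by linarith)) hc hΓAm hΓA1 hΓBm hΓB1 hRA hRB hTm
    (pow_pos (by omega) m) (pow_pos hα m) (pow_pos hβ m) hΓA hΓB (γ := κ * ρ ^ m) (by positivity)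
    hγ hTm'
  have hK : κ * ρ ^ m / (8 * C₁) = ε * ρ ^ m := by rw [hε]; ring
  rw [hK] at hE
  set K := ε * ρ ^ m with hKdef
  have hK0 : 0 < K := by positivity
  have hdens : ∀ θ ∉ E, density L (A ×ˢ B) (projHom θ) c N ≤ 8 * c / K := by
    intro θ hθ
    have hle : 2 * T ^ m * T' ^ m ≤ N := by
      refine le_trans ?_ hN
      rw [mul_pow, mul_pow]
      gcongr
    refine density_le_of_not_closePairs hU hD (by omega) hc1 (hc θ) hK0 (hE θ hθ) ?_
      (pow_pos hT'0 m) hle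
    have hy0 : (1 : ℝ) ≤ L := by exact_mod_cast (by omega : 1 ≤ L)
    have hy1 : 1 ≤ (1 + ε) ^ 2 := one_le_pow₀ (by linarith)
    have hy : 1 ≤ 16 * L * (1 + ε) ^ 2 := one_le_mul_of_one_le_of_one_le (by linarith) hy1
    calc 16 * L * K ^ 2 = 16 * L * ε ^ 2 * (ρ ^ 2) ^ m := by
          rw [hKdef, mul_pow, ← pow_mul, ← pow_mul, mul_comm m 2]; ring
      _ ≤ 16 * L * (1 + ε) ^ 2 * (ρ ^ 2) ^ m := by gcongr; linarith
      _ ≤ (16 * L * (1 + ε) ^ 2) ^ m * (ρ ^ 2) ^ m := by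
          gcongr; exact le_self_pow₀ hy (by omega)
      _ = (16 * L * (1 + ε) ^ 2 * ρ ^ 2) ^ m := (mul_pow _ _ _).symm
      _ ≤ _ := by push_cast; gcongr
  refine (favard_le hL (by omega) hc1 (M := 2 * c) (d := 8 * c / K) (by positivity) (by positivity)
    (by positivity) hEm hEv htriv hdens).trans (ENNReal.ofReal_le_ofReal ?_)
  have : L * (2 * c * (40 * (RA + RB) / (κ * ρ ^ m)) + 8 * c / K * 4) =
      L * (2 * c * (40 * (RA + RB) / κ) + 8 * c / ε * 4) / ρ ^ m := by
    rw [hKdef]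
    field_simp
  rw [this]
  gcongr
  rw [hC]
  have : 0 ≤ L * (2 * c * 4) := by positivity
  linarith

end FavardLength

end BuffonNeedle

theorem theorem1p4 (A B : Finset ℕ)
    (hA0 : 0 ∈ A) (hB0 : 0 ∈ B) (hA : 2 ≤ A.card) (hB : 2 ≤ B.card)
    (hAB : (A.card ≤ 6 ∧ B.card ≤ 6) ∨
      (BuffonNeedle.DivisorCondition (A.card * B.card) A ∧
        BuffonNeedle.DivisorCondition (A.card * B.card) B))
    (hrootsA : BuffonNeedle.UnitRootsAreRootsOfUnity A)
    (hrootsB : BuffonNeedle.UnitRootsAreRootsOfUnity B) :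
    ∃ p : ℝ, 0 < p ∧ ∃ C : ℝ, 0 < C ∧ ∀ N : ℕ, 1 ≤ N →
      BuffonNeedle.favard (BuffonNeedle.cantorNbhd A B N) ≤
        ENNReal.ofReal (C * (N : ℝ) ^ (-p)) := by
  have hD : BuffonNeedle.DivisorCondition (A.card * B.card) A ∧
      BuffonNeedle.DivisorCondition (A.card * B.card) B := by
    rcases hAB with ⟨hA6, hB6⟩ | h
    · exact ⟨BuffonNeedle.divisorCondition_of_card_le_six hA hA6 (dvd_mul_right _ _),
        BuffonNeedle.divisorCondition_of_card_le_six hB hB6 (dvd_mul_left _ _)⟩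
    · exact h
  have hdecay : ∃ (C ρ : ℝ) (W : ℕ), 0 < C ∧ 1 < ρ ∧ 2 ≤ W ∧ ∀ m N : ℕ, W ^ m ≤ N →
      BuffonNeedle.favard (BuffonNeedle.cantorNbhd A B N) ≤ ENNReal.ofReal (C / ρ ^ m) := by
    by_cases hU : BuffonNeedle.UniqueDigits (A.card * B.card) (A ×ˢ B)
    · exact BuffonNeedle.exists_decay_of_uniqueDigits hA hB rfl hU hD.1 hD.2 hrootsA hrootsB
    · exact BuffonNeedle.exists_decay_of_not_uniqueDigits rfl (by nlinarith) hU
  obtain ⟨C, ρ, W, hC, hρ, hW, h⟩ := hdecay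
  exact BuffonNeedle.exists_power_law hC hρ hW h
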